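/- **Setting.** Let $\mathbf v_1=(\tfrac{\sqrt3}{2},\tfrac12)$, $\mathbf v_2=(\tfrac{\sqrt3}{2},-\tfrac12)$, $\Lambda=\mathbb Z\mathbf v_1+\mathbb Z\mathbf v_2$, $\Omega=\{\theta_1\mathbf v_1+\theta_2\mathbf v_2:0\le\theta_1,\theta_2\le1\}$, $\mathbf A=\tfrac13(\mathbf v_1+\mathbf v_2)$, $\mathbf B=\tfrac23(\mathbf v_1+\mathbf v_2)$. For $0<r<\tfrac12|\mathbf A-\mathbf B|$ let $\Omega_1=B_r(\mathbf A)\cup B_r(\mathbf B)$ (open discs), $\Omega_2=\Omega\setminus\Omega_1$, and $\Gamma=\partial B_r(\mathbf A)\cup\partial B_r(\mathbf B)$, with unit normal $n$ pointing out of $\Omega_1$. Let $W$ be a $\Lambda$-periodic material weight that equals constant Hermitian positive definite $2\times2$ matrices $W_{\mathbf A}$, $W_{\mathbf B}$, $W_0$ on $B_r(\mathbf A)$, $B_r(\mathbf B)$, $\Omega_2$ respectively. Write $W_i$ for $W|_{\Omega_i}$ (one-sided values on $\Gamma$) and $\|W_i\|_\infty$ for the maximum over $\Omega_i$ of its Euclidean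 operator norm. Fix $\mathbf k\in\mathbb R^2$. **Mesh.** For $N\ge1$ divide $\Omega$ into $N^2$ congruent sub-rhombuses, with mesh size $h=\|\mathbf v_1\|/N$, and split each of them into two closed isosceles triangles by a diagonal (the short one in all of them, or the long one in all of them); this gives $\mathcal T_h$. Let $\mathcal T_{\Gamma,h}=\{K\in\mathcal T_h:K\cap\Gamma\ne\emptyset\}$, $\mathcal T_{i,h}=\{K\in\mathcal T_h:K\cap\overline{\Omega_i}\neq\emptyset\}$, $\Omega_{i,h}=\bigcup_{K\in\mathcal T_{i,h}}K$. We assume that $\Gamma$ meets the boundary $\partial K$ of each $K\in\mathcal T_{\Gamma,h}$ in exactly two points and each open edge of $K$ in at most one point. Let $V_{h,per}$ be the space of pairs $q=(q_1,q_2)$ of $\Lambda$-periodic complex-valued functions such that $q_i$ is continuous on $\Omega_{i,h}$ and a polynomial of degree at most one on every $K\in\mathcal T_{i,h}$. **Form and norm.** For $K\in\mathcal T_{\Gamma,h}$ put $K_i=K\cap\Omega_i$, $\Gamma_K=\Gamma\cap K$, let $|K_i|$, $|\Gamma_K|$ be area and arc length, and $$D_K=\|W_2\|_\infty|K_1|+\|W_1\|_\infty|K_2|,\quad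 \kappa_1|_K=\frac{\|W_2\|_\infty|K_1|}{D_K},\quad \kappa_2|_K=\frac{\|W_1\|_\infty|K_2|}{D_K},\quad \lambda_K=\frac{h\|W_1\|_\infty\|W_2\|_\infty|\Gamma_K|}{D_K}.$$ On $\Gamma_K$ let $\llbracket q\rrbracket=q_1-q_2$, $\{\!\{W(\nabla+i\mathbf k)q\cdot n\}\!\}=\sum_{i=1}^2\kappa_i\,W_i(\nabla+i\mathbf k)q_i\cdot n$, and $\lambda|_K=\hat\lambda\lambda_K$ with the stabilization parameter $\hat\lambda>0$. Define $$a_h(\phi,q)=\sum_{i=1}^2\int_{\Omega_i}W_i(\nabla+i\mathbf k)\phi_i\cdot\overline{(\nabla+i\mathbf k)q_i}\,d\mathbf x-\int_\Gamma\{\!\{W(\nabla+i\mathbf k)\phi\cdot n\}\!\}\,\overline{\llbracket q\rrbracket}\,ds-\int_\Gamma\overline{\{\!\{W(\nabla+i\mathbf k)q\cdot n\}\!\}}\,\llbracket\phi\rrbracket\,ds+\frac1h\int_\Gamma\lambda\,\llbracket\phi\rrbracket\,\overline{\llbracket q\rrbracket}\,ds,$$ $$|||q|||_h^2=\sum_{i=1}^2\|(\nabla+i\mathbf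 k)q_i\|_{L^2(\Omega_i)}^2+\sum_{K\in\mathcal T_{\Gamma,h}}h^{-1}\|\llbracket q\rrbracket\|_{L^2(\Gamma_K)}^2 .$$ **Theorem.** Fix the type of diagonal, the matrices $W_{\mathbf A},W_{\mathbf B},W_0$, the vector $\mathbf k$, and a number $\sigma>0$. There is $\hat\lambda_0>0$ such that for every $\hat\lambda\ge\hat\lambda_0$ there are constants $C_5,C_6>0$ with the following property. For every $r\in(0,\tfrac12|\mathbf A-\mathbf B|)$ and every $N\ge1$ such that $h\le\sigma r$ (the mesh resolves the interface) and the above assumption on the intersections of $\Gamma$ with the mesh holds, $$a_h(q_h,q_h)\in\mathbb R\quad\text{and}\quad C_5\,|||q_h|||_h^2\le a_h(q_h,q_h)\qquad\text{for all }q_h\in V_{h,per},$$ $$|a_h(q_h,\chi_h)|\le C_6\,|||q_h|||_h\,|||\chi_h|||_h\qquad\text{for all }q_h,\chi_h\in V_{h,per}.$$ In particular $\hat\lambda_0$, $C_5$, $C_6$ do not depend on the mesh size or on the location of the interface relative to the mesh. -/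

import Mathlib

open MeasureTheory
open scoped Matrix ComplexOrder ComplexConjugate

noncomputable section

namespace UnfittedNitsche

/-! ## Geometry of the fundamental cell -/

/-- The Euclidean plane. -/
abbrev Plane := EuclideanSpace ℝ (Fin 2)

/-- The two lattice basis vectors of the hexagonal lattice. -/
def v₁ : Plane := !₂[√3 / 2, 1 / 2]

def v₂ : Plane := !₂[√3 / 2, -(1 / 2)]

/-- The fundamental cell `Ω`, a closed parallelogram. -/
def cell : Set Plane :=
  {x | ∃ s ∈ Set.Icc (0 : ℝ) 1, ∃ t ∈ Set.Icc (0 : ℝ) 1, x = s • v₁ + t • v₂}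

/-- The two honeycomb sites in the cell. -/
def siteA : Plane := (1 / 3 : ℝ) • (v₁ + v₂)

def siteB : Plane := (2 / 3 : ℝ) • (v₁ + v₂)

/-- The subdomains: index `0` is `Ω₁` (the union of the two discs), index `1` is
`Ω₂ = Ω \ Ω₁`. Throughout, the index `i : Fin 2` stands for the subscript `i + 1`. -/
def subdomain (r : ℝ) : Fin 2 → Set Plane :=
  ![Metric.ball siteA r ∪ Metric.ball siteB r,
    cell \ (Metric.ball siteA r ∪ Metric.ball siteB r)]

/-- The interface `Γ`, the union of the two circles. -/
def interface (r : ℝ) : Set Plane := Metric.sphere siteA r ∪ Metric.sphere siteB r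

/-- Arc length on the circle of centre `c` and radius `r`. -/
def circleArcLength (c : Plane) (r : ℝ) : Measure Plane :=
  ENNReal.ofReal r • Measure.map
    (fun θ : ℝ => c + r • (!₂[Real.cos θ, Real.sin θ] : Plane))
    (volume.restrict (Set.Ioc 0 (2 * Real.pi)))

/-- Arc length `ds` on the interface `Γ`. -/
def arcLength (r : ℝ) : Measure Plane := circleArcLength siteA r + circleArcLength siteB r

open Classical in
/-- The unit normal of `Γ` pointing out of `Ω₁`. -/
def normal (r : ℝ) (x : Plane) : Plane :=
  if x ∈ Metric.sphere siteA r then r⁻¹ • (x - siteA) else r⁻¹ • (x - siteB)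

/-! ## The uniform triangulation -/

/-- Each sub-rhombus is split along its short diagonal or along its long diagonal
(the same choice in every sub-rhombus). -/
inductive Diagonal
  | short
  | long

/-- The mesh size. -/
def meshSize (N : ℕ) : ℝ := ‖v₁‖ / N

/-- Indices of the elements: the sub-rhombus `(i, j)` and one of its two triangles. -/
abbrev ElemIndex (N : ℕ) := (Fin N × Fin N) × Fin 2

/-- The mesh node `(i v₁ + j v₂) / N`. -/
def node (N i j : ℕ) : Plane := ((i : ℝ) / N) • v₁ + ((j : ℝ) / N) • v₂

/-- The three vertices of an element. -/
def vertex (d : Diagonal) (N : ℕ) (τ : ElemIndex N) : Fin 3 → Plane :=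
  let i : ℕ := τ.1.1
  let j : ℕ := τ.1.2
  match d with
  | .short => ![![node N i j, node N (i + 1) (j + 1)] τ.2, node N (i + 1) j, node N i (j + 1)]
  | .long => ![node N i j, ![node N (i + 1) j, node N i (j + 1)] τ.2, node N (i + 1) (j + 1)]

/-- The (closed) triangle `K`. -/
def elem (d : Diagonal) (N : ℕ) (τ : ElemIndex N) : Set Plane :=
  convexHull ℝ (Set.range (vertex d N τ))

open Classical in
/-- The interface elements. -/
def cutElems (d : Diagonal) (r : ℝ) (N : ℕ) : Finset (ElemIndex N) :=
  Finset.univ.filter fun τ => (interface r ∩ elem d N τ).Nonempty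

open Classical in
/-- The elements that cover the `i`-th subdomain. -/
def subdomainElems (d : Diagonal) (r : ℝ) (N : ℕ) (i : Fin 2) : Finset (ElemIndex N) :=
  Finset.univ.filter fun τ => (closure (subdomain r i) ∩ elem d N τ).Nonempty

/-- The fictitious domain `Ω_{i,h}`. -/
def fictDomain (d : Diagonal) (r : ℝ) (N : ℕ) (i : Fin 2) : Set Plane :=
  ⋃ τ ∈ subdomainElems d r N i, elem d N τ

/-- The interface intersects the boundary of each interface element exactly twice,
and each open edge at most once. -/
def InterfaceAssumption (d : Diagonal) (r : ℝ) (N : ℕ) : Prop :=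
  ∀ τ ∈ cutElems d r N,
    (interface r ∩ frontier (elem d N τ)).ncard = 2 ∧
    ∀ a b : Fin 3, a ≠ b →
      (interface r ∩ openSegment ℝ (vertex d N τ a) (vertex d N τ b)).Subsingleton

/-! ## The finite element space -/

/-- `v` is `Λ`-periodic. -/
def IsPeriodic (v : Plane → ℂ) : Prop :=
  ∀ (m₁ m₂ : ℤ) (x : Plane), v (x + ((m₁ : ℝ) • v₁ + (m₂ : ℝ) • v₂)) = v x

/-- `v` is a polynomial of degree at most one on `K`. -/
def IsAffineOn (v : Plane → ℂ) (K : Set Plane) : Prop :=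
  ∃ (c : ℂ) (g : Fin 2 → ℂ), ∀ x ∈ K, v x = c + ∑ j, g j * (x j : ℂ)

/-- The space `V_{h,per}` of pairs `q = (q₁, q₂)`. The values of `q i` outside the periodic
copies of the `i`-th fictitious domain are never used. -/
def femSpace (d : Diagonal) (r : ℝ) (N : ℕ) : Set (Fin 2 → Plane → ℂ) :=
  {q | ∀ i, ContinuousOn (q i) (fictDomain d r N i) ∧
    (∀ τ ∈ subdomainElems d r N i, IsAffineOn (q i) (elem d N τ)) ∧ IsPeriodic (q i)}

/-! ## The material weight -/

/-- A piecewise constant material weight: constant Hermitian positive definite matrices on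
`B_r(A)`, on `B_r(B)`, and on `Ω₂` (everything is extended `Λ`-periodically). -/
structure MaterialWeight where
  WA : Matrix (Fin 2) (Fin 2) ℂ
  WB : Matrix (Fin 2) (Fin 2) ℂ
  W0 : Matrix (Fin 2) (Fin 2) ℂ
  posDefA : WA.PosDef
  posDefB : WB.PosDef
  posDef0 : W0.PosDef

open Classical in
/-- The restriction `W_i` of the weight to (the closure in the cell of) the `i`-th subdomain;
on `Γ` this is the one-sided value. -/
def MaterialWeight.side (W : MaterialWeight) (r : ℝ) (i : Fin 2) (x : Plane) :
    Matrix (Fin 2) (Fin 2) ℂ :=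
  ![if x ∈ Metric.closedBall siteA r then W.WA else W.WB, W.W0] i

/-- The Euclidean operator norm of a `2 × 2` matrix. -/
def matNorm (M : Matrix (Fin 2) (Fin 2) ℂ) : ℝ := ‖Matrix.toEuclideanCLM (n := Fin 2) (𝕜 := ℂ) M‖

/-- `‖W_i‖_∞`, the maximum over the `i`-th subdomain of the matrix norm of the weight. -/
def MaterialWeight.supNorm (W : MaterialWeight) : Fin 2 → ℝ :=
  ![max (matNorm W.WA) (matNorm W.WB), matNorm W.W0]

/-! ## Weights on the interface elements -/

/-- `|K_i|`, the area of `K ∩ Ω_i`. -/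
def partArea (d : Diagonal) (r : ℝ) (N : ℕ) (τ : ElemIndex N) (i : Fin 2) : ℝ :=
  volume.real (elem d N τ ∩ subdomain r i)

/-- `Γ_K`. -/
def cutArc (d : Diagonal) (r : ℝ) (N : ℕ) (τ : ElemIndex N) : Set Plane :=
  interface r ∩ elem d N τ

/-- The common denominator `‖W₂‖ |K₁| + ‖W₁‖ |K₂|`. -/
def weightDenom (W : MaterialWeight) (d : Diagonal) (r : ℝ) (N : ℕ) (τ : ElemIndex N) : ℝ :=
  W.supNorm 1 * partArea d r N τ 0 + W.supNorm 0 * partArea d r N τ 1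

/-- The averaging weights `κ₁`, `κ₂` on `K`. -/
def kappa (W : MaterialWeight) (d : Diagonal) (r : ℝ) (N : ℕ) (τ : ElemIndex N) : Fin 2 → ℝ :=
  ![W.supNorm 1 * partArea d r N τ 0 / weightDenom W d r N τ,
    W.supNorm 0 * partArea d r N τ 1 / weightDenom W d r N τ]

/-- The constant `λ_K`. -/
def lambdaK (W : MaterialWeight) (d : Diagonal) (r : ℝ) (N : ℕ) (τ : ElemIndex N) : ℝ :=
  meshSize N * W.supNorm 0 * W.supNorm 1 * (arcLength r).real (cutArc d r N τ) /
    weightDenom W d r N τ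

/-! ## The Nitsche form and the energy norm -/

/-- `(∇ + i k) v`. -/
def blochGrad (k : Plane) (v : Plane → ℂ) (x : Plane) : Fin 2 → ℂ :=
  fun j => fderiv ℝ v x (EuclideanSpace.single j 1) + Complex.I * (k j : ℂ) * v x

/-- The jump across `Γ`. -/
def jump (q : Fin 2 → Plane → ℂ) (x : Plane) : ℂ := q 0 x - q 1 x

/-- The one-sided normal flux `W_i (∇ + i k) q_i · n`. -/
def flux (W : MaterialWeight) (k : Plane) (r : ℝ) (q : Fin 2 → Plane → ℂ) (i : Fin 2)
    (x : Plane) : ℂ :=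
  (W.side r i x *ᵥ blochGrad k (q i) x) ⬝ᵥ fun j => (normal r x j : ℂ)

/-- The weighted average on `Γ_K` of the normal flux. -/
def avgFlux (W : MaterialWeight) (k : Plane) (d : Diagonal) (r : ℝ) (N : ℕ) (τ : ElemIndex N)
    (q : Fin 2 → Plane → ℂ) (x : Plane) : ℂ :=
  ∑ i, (kappa W d r N τ i : ℂ) * flux W k r q i x

/-- The Nitsche sesquilinear form `a_h` with stabilization parameter `lam`; integrals over `Γ`
of element-wise defined quantities are sums over the interface elements. -/
def nitscheForm (W : MaterialWeight) (k : Plane) (lam : ℝ) (d : Diagonal) (r : ℝ) (N : ℕ)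
    (φ q : Fin 2 → Plane → ℂ) : ℂ :=
  (∑ i, ∫ x in subdomain r i,
      (W.side r i x *ᵥ blochGrad k (φ i) x) ⬝ᵥ star (blochGrad k (q i) x))
  - (∑ τ ∈ cutElems d r N, ∫ x in cutArc d r N τ,
      avgFlux W k d r N τ φ x * conj (jump q x) ∂(arcLength r))
  - (∑ τ ∈ cutElems d r N, ∫ x in cutArc d r N τ,
      conj (avgFlux W k d r N τ q x) * jump φ x ∂(arcLength r))
  + ((meshSize N)⁻¹ : ℂ) * ∑ τ ∈ cutElems d r N, ∫ x in cutArc d r N τ,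
      ((lam * lambdaK W d r N τ : ℝ) : ℂ) * jump φ x * conj (jump q x) ∂(arcLength r)

/-- The square of the mesh-dependent energy norm. -/
def energyNormSq (k : Plane) (d : Diagonal) (r : ℝ) (N : ℕ) (q : Fin 2 → Plane → ℂ) : ℝ :=
  (∑ i, ∫ x in subdomain r i, ∑ j, ‖blochGrad k (q i) x j‖ ^ 2)
  + ∑ τ ∈ cutElems d r N, (meshSize N)⁻¹ * ∫ x in cutArc d r N τ, ‖jump q x‖ ^ 2 ∂(arcLength r)

/-- The mesh-dependent energy norm. -/
def energyNorm (k : Plane) (d : Diagonal) (r : ℝ) (N : ℕ) (q : Fin 2 → Plane → ℂ) : ℝ :=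
  √(energyNormSq k d r N q)

end UnfittedNitsche

end

/-! The denominator D_K is of order h², so λ_K is of order |Γ_K|/h. Hence the stabilization almost
vanishes on an element that Γ crosses in a short arc, whereas the energy norm weights all jumps by
1/h. Let X be the squared broken Bloch seminorm (`bulkSq`), S the stabilization sum without the
parameter (`stabSum`) and J the unweighted jump sum (`jumpSum`). Two estimates carry the theorem:
|flux term|² ≤ F S X (`normSq_fluxForm_le`) and J ≤ C (X + S) (`exists_jumpSum_le`). If m bounds the
weight from below and the parameter is at least 4F/m, the first one and Young's inequality bound the
form from below by a multiple of X + S; the second replaces S by J. Boundedness follows from the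
first, Cauchy–Schwarz and an upper bound for λ_K. The diagonal values are real because W is
Hermitian and the two flux terms are conjugate to each other.

Flux estimate. On an element the Bloch gradient is an affine function G. At points x of Γ_K it
satisfies |G(x)|² |K_i| ≤ c ∫_{K_i} |G|² with c independent of the cut
(`Admissible.inverse_energy`), and the factor |K_i| in κ_i pays for a small part K_i. The part
inside the disc is convex and needs only a midpoint argument. The part outside is not convex, but
the intersection assumption leaves few positions of a triangle relative to a circle
(`CutsRegularly.cases`). Unless the outer part is null, it then lies between two comparable boxes in
the barycentric coordinates at a vertex, so it is stable under suitable contractions. Only one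
circle matters at a time, since no element meets both discs (`Admissible.inter_other_eq_empty`).

Jump estimate. Where the cut is long, λ_K is bounded below. Where it is short, the arc joins two
sides with a common vertex V, close to V. Continued over a length of order h, the circle stays among
the at most 8 elements at V and meets their boundaries in at most 16 points. So one of 17 equal
pieces lies inside a single element, whose cut is therefore long. On the circle the jump is a
trigonometric polynomial of degree one, so its mean square on that piece controls it at a nearby
point of a side through V. From there the jump is carried along the side to V, from V to the two
ends of the short arc, and from the ends over the chord to the arc itself.

Carrying values rests on v(x)(1 + i k·(x−y)) − v(y) = G(x)·(x−y) and the inverse estimate, so it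
costs |x−y|²/|K_i| times the energy, and |K_i| must dominate |x−y|². On a side, a ball about the
interface point P of radius comparable to |P−V| is covered by the two adjacent elements and is
shared fairly by disc and exterior (`half_ball_volume`); one of the two elements has the area
needed, and the values at P and V do not depend on the element. On a short arc, the triangle
contains a ball about the midpoint of the arc whose radius is the sagitta
(`RegularTri.closedBall_mid_subset`). The condition h ≤ σ r makes arcs of length of order h turn by
a small angle and keeps these balls smaller than the disc. Every element has boundedly many
neighbours, so summing costs only a constant. -/

noncomputable section
namespace UnfittedNitsche

/-! ## Planar triangles -/

theorem normSq_eq (x : Plane) : ‖x‖ ^ 2 = x 0 ^ 2 + x 1 ^ 2 := by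
  simp [EuclideanSpace.real_norm_sq_eq]

/-- The oriented area of the parallelogram spanned by two vectors. -/
def det2 (u v : Plane) : ℝ := u 0 * v 1 - u 1 * v 0

theorem plane_ext {x y : Plane} (h0 : x 0 = y 0) (h1 : x 1 = y 1) : x = y := by
  ext i; fin_cases i
  · exact h0
  · exact h1

/-- The closed triangle with vertices `A`, `B`, `C`. -/
def tri (A B C : Plane) : Set Plane :=
  {x | ∃ a b c : ℝ, 0 ≤ a ∧ 0 ≤ b ∧ 0 ≤ c ∧ a + b + c = 1 ∧ x = a • A + b • B + c • C}

theorem tri_rotate (A B C : Plane) : tri A B C = tri B C A := by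
  ext x; constructor
  · rintro ⟨a, b, c, ha, hb, hc, h, rfl⟩
    exact ⟨b, c, a, hb, hc, ha, by linarith, by abel⟩
  · rintro ⟨a, b, c, ha, hb, hc, h, rfl⟩
    exact ⟨c, a, b, hc, ha, hb, by linarith, by abel⟩

theorem tri_swap (A B C : Plane) : tri A B C = tri A C B := by
  ext x; constructor
  · rintro ⟨a, b, c, ha, hb, hc, h, rfl⟩
    exact ⟨a, c, b, ha, hc, hb, by linarith, by abel⟩
  · rintro ⟨a, b, c, ha, hb, hc, h, rfl⟩
    exact ⟨a, c, b, ha, hc, hb, by linarith, by abel⟩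

theorem convex_tri (A B C : Plane) : Convex ℝ (tri A B C) := by
  rintro x ⟨a, b, c, ha, hb, hc, hs, rfl⟩ y ⟨a', b', c', ha', hb', hc', hs', rfl⟩ s t hs0 ht0 hst
  refine ⟨s * a + t * a', s * b + t * b', s * c + t * c', by positivity, by positivity,
    by positivity, ?_, ?_⟩
  · linear_combination s * hs + t * hs' + hst
  · module

theorem convexHull_range_eq_tri (v : Fin 3 → Plane) :
    convexHull ℝ (Set.range v) = tri (v 0) (v 1) (v 2) := by
  apply Set.Subset.antisymm
  · refine convexHull_min ?_ (convex_tri _ _ _)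
    rintro _ ⟨i, rfl⟩
    fin_cases i
    · exact ⟨1, 0, 0, by simp⟩
    · exact ⟨0, 1, 0, by simp⟩
    · exact ⟨0, 0, 1, by simp⟩
  · rintro x ⟨a, b, c, ha, hb, hc, hs, rfl⟩
    have := (convex_convexHull ℝ (Set.range v)).sum_mem (t := Finset.univ) (w := ![a, b, c])
      (z := v) (by intro i _; fin_cases i <;> simpa) (by simpa [Fin.sum_univ_three] using hs)
      (fun i _ => subset_convexHull ℝ _ ⟨i, rfl⟩)
    simpa [Fin.sum_univ_three] using this

/-- The barycentric coordinate belonging to the third vertex. -/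
def bary (A B C x : Plane) : ℝ := det2 (B - A) (x - A) / det2 (B - A) (C - A)

/-- A triangle whose sides lie between `h` and `√3 h` and whose area is that of the equilateral
triangle of side `h`. -/
structure RegularTri (h : ℝ) (A B C : Plane) : Prop where
  pos : 0 < h
  AB_ge : h ^ 2 ≤ ‖B - A‖ ^ 2
  AB_le : ‖B - A‖ ^ 2 ≤ 3 * h ^ 2
  BC_ge : h ^ 2 ≤ ‖C - B‖ ^ 2
  BC_le : ‖C - B‖ ^ 2 ≤ 3 * h ^ 2
  AC_ge : h ^ 2 ≤ ‖C - A‖ ^ 2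
  AC_le : ‖C - A‖ ^ 2 ≤ 3 * h ^ 2
  det_sq : det2 (B - A) (C - A) ^ 2 = 3 / 4 * h ^ 4

namespace RegularTri

variable {h : ℝ} {A B C : Plane}

theorem swap (T : RegularTri h A B C) : RegularTri h A C B where
  pos := T.pos
  AB_ge := T.AC_ge
  AB_le := T.AC_le
  BC_ge := by rw [norm_sub_rev]; exact T.BC_ge
  BC_le := by rw [norm_sub_rev]; exact T.BC_le
  AC_ge := T.AB_ge
  AC_le := T.AB_le
  det_sq := by rw [← T.det_sq]; simp only [det2]; ring

theorem rotate (T : RegularTri h A B C) : RegularTri h B C A where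
  pos := T.pos
  AB_ge := T.BC_ge
  AB_le := T.BC_le
  BC_ge := by rw [norm_sub_rev]; exact T.AC_ge
  BC_le := by rw [norm_sub_rev]; exact T.AC_le
  AC_ge := by rw [norm_sub_rev]; exact T.AB_ge
  AC_le := by rw [norm_sub_rev]; exact T.AB_le
  det_sq := by rw [← T.det_sq]; simp only [det2, PiLp.sub_apply]; ring

theorem det_ne (T : RegularTri h A B C) : det2 (B - A) (C - A) ≠ 0 := by
  intro h0
  have := T.det_sq
  rw [h0] at this
  have := pow_pos T.pos 4
  nlinarith

theorem bary_comb (T : RegularTri h A B C) {a b c : ℝ} (hs : a + b + c = 1) :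
    bary A B C (a • A + b • B + c • C) = c := by
  have hd := T.det_ne
  rw [bary, div_eq_iff hd]
  obtain rfl : a = 1 - b - c := by linarith
  simp only [det2, PiLp.sub_apply, PiLp.add_apply, PiLp.smul_apply, smul_eq_mul]
  ring

theorem bary_sum (T : RegularTri h A B C) (x : Plane) :
    bary B C A x + bary C A B x + bary A B C x = 1 := by
  have hd := T.det_ne
  have e1 : det2 (C - B) (A - B) = det2 (B - A) (C - A) := by
    simp only [det2, PiLp.sub_apply]; ring
  have e2 : det2 (A - C) (B - C) = det2 (B - A) (C - A) := by
    simp only [det2, PiLp.sub_apply]; ring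
  rw [bary, bary, bary, e1, e2, ← add_div, ← add_div, div_eq_one_iff_eq hd]
  simp only [det2, PiLp.sub_apply]; ring

theorem bary_rec (T : RegularTri h A B C) (x : Plane) :
    x = bary B C A x • A + bary C A B x • B + bary A B C x • C := by
  have hd := T.det_ne
  have e1 : det2 (C - B) (A - B) = det2 (B - A) (C - A) := by
    simp only [det2, PiLp.sub_apply]; ring
  have e2 : det2 (A - C) (B - C) = det2 (B - A) (C - A) := by
    simp only [det2, PiLp.sub_apply]; ring
  rw [bary, bary, bary, e1, e2]
  apply plane_ext
  · simp only [PiLp.add_apply, PiLp.smul_apply, smul_eq_mul]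
    rw [div_mul_eq_mul_div, div_mul_eq_mul_div, div_mul_eq_mul_div, ← add_div, ← add_div,
      eq_div_iff hd]
    simp only [det2, PiLp.sub_apply]; ring
  · simp only [PiLp.add_apply, PiLp.smul_apply, smul_eq_mul]
    rw [div_mul_eq_mul_div, div_mul_eq_mul_div, div_mul_eq_mul_div, ← add_div, ← add_div,
      eq_div_iff hd]
    simp only [det2, PiLp.sub_apply]; ring

theorem mem_tri_iff (T : RegularTri h A B C) (x : Plane) :
    x ∈ tri A B C ↔ 0 ≤ bary B C A x ∧ 0 ≤ bary C A B x ∧ 0 ≤ bary A B C x := by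
  constructor
  · rintro ⟨a, b, c, ha, hb, hc, hs, rfl⟩
    refine ⟨?_, ?_, ?_⟩
    · rw [show a • A + b • B + c • C = b • B + c • C + a • A by abel,
        T.rotate.bary_comb (by linarith)]; exact ha
    · rw [show a • A + b • B + c • C = c • C + a • A + b • B by abel,
        T.rotate.rotate.bary_comb (by linarith)]; exact hb
    · rw [T.bary_comb hs]; exact hc
  · rintro ⟨ha, hb, hc⟩
    exact ⟨_, _, _, ha, hb, hc, T.bary_sum x, T.bary_rec x⟩

/-- The Gram matrix of two sides is bounded below. -/
theorem norm_comb_ge (T : RegularTri h A B C) (α β : ℝ) :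
    h ^ 2 / 8 * (α ^ 2 + β ^ 2) ≤ ‖α • (B - A) + β • (C - A)‖ ^ 2 := by
  have h1 := T.AB_le
  have h2 := T.AC_le
  have h3 := T.det_sq
  have hp := T.pos
  -- The smaller eigenvalue of the Gram matrix is at least determinant over trace. The determinant
  -- is 3h⁴/4 and the trace at most 6h², whence the factor h²/8.
  have key : det2 (B - A) (C - A) ^ 2 * (α ^ 2 + β ^ 2) ≤
      ‖α • (B - A) + β • (C - A)‖ ^ 2 * (‖B - A‖ ^ 2 + ‖C - A‖ ^ 2) := by
    rw [normSq_eq, normSq_eq, normSq_eq]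
    simp only [det2, PiLp.add_apply, PiLp.smul_apply, smul_eq_mul]
    generalize (B - A) 0 = p
    generalize (B - A) 1 = q
    generalize (C - A) 0 = s
    generalize (C - A) 1 = t
    nlinarith [sq_nonneg (p * (α * p + β * s) + q * (α * q + β * t)),
      sq_nonneg (s * (α * p + β * s) + t * (α * q + β * t))]
  rw [h3] at key
  have hn : 0 ≤ ‖α • (B - A) + β • (C - A)‖ ^ 2 := by positivity
  have h4 : 3 / 4 * h ^ 4 * (α ^ 2 + β ^ 2) ≤
      ‖α • (B - A) + β • (C - A)‖ ^ 2 * (6 * h ^ 2) :=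
    key.trans (mul_le_mul_of_nonneg_left (by linarith) hn)
  have h5 : (0 : ℝ) < 6 * h ^ 2 := by positivity
  refine le_of_mul_le_mul_right ?_ h5
  calc _ = 3 / 4 * h ^ 4 * (α ^ 2 + β ^ 2) := by ring
    _ ≤ _ := h4

theorem continuous_bary (A B C : Plane) : Continuous (bary A B C) := by
  unfold bary det2; fun_prop

theorem mem_interior_iff (T : RegularTri h A B C) (x : Plane) :
    x ∈ interior (tri A B C) ↔ 0 < bary B C A x ∧ 0 < bary C A B x ∧ 0 < bary A B C x := by
  have aux : ∀ {A B C : Plane}, RegularTri h A B C → ∀ x, x ∈ interior (tri A B C) →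
      0 < bary A B C x := by
    intro A B C T x hx
    have hnh : tri A B C ∈ nhds x := mem_interior_iff_mem_nhds.1 hx
    -- Moving in the direction A − C lowers the third coordinate at unit rate. A short move stays in
    -- the triangle, so the coordinate was positive.
    have ht : Filter.Tendsto (fun ε : ℝ => x - ε • (C - A)) (nhds 0) (nhds x) := by
      have : Continuous (fun ε : ℝ => x - ε • (C - A)) := by fun_prop
      simpa using this.tendsto 0
    have hev := ht.eventually hnh
    obtain ⟨ε, hε, hε0⟩ := ((hev.filter_mono nhdsWithin_le_nhds).and
      (self_mem_nhdsWithin : Set.Ioi (0 : ℝ) ∈ nhdsWithin 0 (Set.Ioi 0))).exists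
    have hmem := ((T.mem_tri_iff _).1 hε).2.2
    have : bary A B C (x - ε • (C - A)) = bary A B C x - ε := by
      rw [bary, bary, div_eq_iff T.det_ne, sub_mul, div_mul_cancel₀ _ T.det_ne]
      simp only [det2, PiLp.sub_apply, PiLp.smul_apply, smul_eq_mul]; ring
    rw [this] at hmem
    have hε0' : 0 < ε := hε0
    linarith
  constructor
  · intro hx
    refine ⟨aux T.rotate x ?_, aux T.rotate.rotate x ?_, aux T x hx⟩
    · rwa [← tri_rotate]
    · rwa [← tri_rotate, ← tri_rotate]
  · rintro ⟨ha, hb, hc⟩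
    refine mem_interior.2 ⟨{y | 0 < bary B C A y} ∩ ({y | 0 < bary C A B y} ∩
      {y | 0 < bary A B C y}), ?_, ?_, ⟨ha, hb, hc⟩⟩
    · rintro y ⟨h1, h2, h3⟩
      exact (T.mem_tri_iff y).2 ⟨h1.le, h2.le, h3.le⟩
    · exact (isOpen_lt continuous_const (continuous_bary _ _ _)).inter
        ((isOpen_lt continuous_const (continuous_bary _ _ _)).inter
        (isOpen_lt continuous_const (continuous_bary _ _ _)))

theorem isClosed_tri (T : RegularTri h A B C) : IsClosed (tri A B C) := by
  have : tri A B C = {y | 0 ≤ bary B C A y} ∩ ({y | 0 ≤ bary C A B y} ∩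
      {y | 0 ≤ bary A B C y}) := by
    ext y; rw [T.mem_tri_iff]; rfl
  rw [this]
  exact (isClosed_le continuous_const (continuous_bary _ _ _)).inter
        ((isClosed_le continuous_const (continuous_bary _ _ _)).inter
        (isClosed_le continuous_const (continuous_bary _ _ _)))

theorem mem_frontier_iff (T : RegularTri h A B C) (x : Plane) :
    x ∈ frontier (tri A B C) ↔ x ∈ tri A B C ∧
      (bary B C A x = 0 ∨ bary C A B x = 0 ∨ bary A B C x = 0) := by
  rw [T.isClosed_tri.frontier_eq, Set.mem_sdiff, T.mem_interior_iff]
  refine and_congr_right fun hx => ?_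
  obtain ⟨h1, h2, h3⟩ := (T.mem_tri_iff x).1 hx
  constructor
  · intro hn
    by_contra! hc
    exact hn ⟨lt_of_le_of_ne h1 (Ne.symm hc.1), lt_of_le_of_ne h2 (Ne.symm hc.2.1),
      lt_of_le_of_ne h3 (Ne.symm hc.2.2)⟩
  · rintro (h | h | h) ⟨h1', h2', h3'⟩ <;> linarith

end RegularTri

/-! ## The power of a point with respect to a circle -/

/-- The power of the point `x` with respect to the circle of centre `c` and radius `r`. -/
def power (c : Plane) (r : ℝ) (x : Plane) : ℝ := ‖x - c‖ ^ 2 - r ^ 2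

/-- The power is quadratic with leading part ‖x‖², so its deviation from linear interpolation is
exact and involves only the side lengths. The position of a point is thereby read off from the
powers of the vertices. -/
theorem power_comb (c : Plane) (r : ℝ) (A B C : Plane) {a b e : ℝ} (hs : a + b + e = 1) :
    power c r (a • A + b • B + e • C) = a * power c r A + b * power c r B + e * power c r C -
      (a * b * ‖B - A‖ ^ 2 + b * e * ‖C - B‖ ^ 2 + a * e * ‖C - A‖ ^ 2) := by
  obtain rfl : a = 1 - b - e := by linarith
  simp only [power, normSq_eq, PiLp.sub_apply, PiLp.add_apply, PiLp.smul_apply, smul_eq_mul]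
  ring

theorem power_segment (c : Plane) (r : ℝ) (A B : Plane) {a b : ℝ} (hs : a + b = 1) :
    power c r (a • A + b • B) = a * power c r A + b * power c r B - a * b * ‖B - A‖ ^ 2 := by
  obtain rfl : a = 1 - b := by linarith
  simp only [power, normSq_eq, PiLp.sub_apply, PiLp.add_apply, PiLp.smul_apply, smul_eq_mul]
  ring

theorem continuous_power (c : Plane) (r : ℝ) : Continuous (power c r) := by
  unfold power; fun_prop

variable {c : Plane} {r : ℝ} {x : Plane}

theorem power_neg_iff (hr : 0 < r) : power c r x < 0 ↔ x ∈ Metric.ball c r := by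
  rw [power, Metric.mem_ball, dist_eq_norm, sub_neg, sq_lt_sq₀ (norm_nonneg _) hr.le]

theorem power_nonneg_iff (hr : 0 < r) : 0 ≤ power c r x ↔ x ∉ Metric.ball c r := by
  rw [← power_neg_iff hr, not_lt]

theorem power_eq_zero_iff (hr : 0 < r) : power c r x = 0 ↔ x ∈ Metric.sphere c r := by
  rw [power, Metric.mem_sphere, dist_eq_norm, sub_eq_zero,
    sq_eq_sq₀ (norm_nonneg _) hr.le]

theorem power_nonpos_iff (hr : 0 < r) : power c r x ≤ 0 ↔ x ∈ Metric.closedBall c r := by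
  rw [power, Metric.mem_closedBall, dist_eq_norm, sub_nonpos, sq_le_sq₀ (norm_nonneg _) hr.le]

theorem exists_power_eq_zero {A B : Plane} (hA : power c r A < 0) (hB : 0 < power c r B) :
    ∃ z ∈ openSegment ℝ A B, power c r z = 0 := by
  have hcont : ContinuousOn (fun t : ℝ => power c r ((1 - t) • A + t • B)) (Set.Icc 0 1) :=
    ((continuous_power c r).comp (by fun_prop)).continuousOn
  have := intermediate_value_Ioo (zero_le_one' ℝ) hcont
  simp only [sub_zero, one_smul, zero_smul, add_zero, sub_self, zero_add] at this
  obtain ⟨t, ht, h0⟩ := this ⟨hA, hB⟩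
  exact ⟨_, ⟨1 - t, t, by linarith [ht.2], ht.1, by ring, rfl⟩, h0⟩

end UnfittedNitsche
end

noncomputable section
namespace UnfittedNitsche

/-! ## Inverse estimates for affine functions -/

theorem finrank_plane : Module.finrank ℝ Plane = 2 := by simp

theorem integrable_comp_homothety {g : Plane → ℝ} (hg : Integrable g) (a : Plane) {s : ℝ}
    (hs : s ≠ 0) : Integrable (fun y => g (a + s • y)) :=
  (hg.comp_add_left a).comp_smul hs

/-- A homothety of ratio s has Jacobian s² in the plane, and its image of E is a part of E. -/
theorem setIntegral_comp_homothety_le {E : Set Plane} (hE : MeasurableSet E) {g : Plane → ℝ}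
    (hg0 : ∀ x, 0 ≤ g x) (hg : IntegrableOn g E) (a : Plane) {s : ℝ} (hs : 0 < s)
    (hmap : ∀ y ∈ E, a + s • y ∈ E) :
    IntegrableOn (fun y => g (a + s • y)) E ∧
      ∫ y in E, g (a + s • y) ≤ (s ^ 2)⁻¹ * ∫ y in E, g y := by
  have hi : Integrable (E.indicator g) := (integrable_indicator_iff hE).2 hg
  have hi' := integrable_comp_homothety hi a hs.ne'
  have hnn : ∀ y, 0 ≤ E.indicator g y := fun y => Set.indicator_nonneg (fun x _ => hg0 x) y
  have heq : Set.EqOn (fun y => g (a + s • y)) (fun y => E.indicator g (a + s • y)) E :=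
    fun y hy => (Set.indicator_of_mem (hmap y hy) g).symm
  refine ⟨(hi'.integrableOn).congr_fun heq.symm hE, ?_⟩
  rw [setIntegral_congr_fun hE heq]
  calc ∫ y in E, E.indicator g (a + s • y) ≤ ∫ y, E.indicator g (a + s • y) :=
        setIntegral_le_integral hi' (Filter.Eventually.of_forall fun y => hnn _)
    _ = |(s ^ Module.finrank ℝ Plane)⁻¹| • ∫ y, E.indicator g (a + y) :=
        Measure.integral_comp_smul volume (fun y => E.indicator g (a + y)) s
    _ = (s ^ 2)⁻¹ * ∫ y in E, g y := by
        rw [integral_add_left_eq_self, integral_indicator hE, finrank_plane, smul_eq_mul,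
          abs_of_pos (by positivity)]

variable {F : Type*} [NormedAddCommGroup F] [NormedSpace ℝ F]

/-- `G` preserves affine combinations of two points. -/
def PreservesLine (G : Plane → F) : Prop :=
  ∀ (x y : Plane) (t : ℝ), G ((1 - t) • x + t • y) = (1 - t) • G x + t • G y

/-- With z = (1−ε)B + εy and z' = (1−t)x + tz, affinity gives (1−t) G(x) = G(z') − t G(z). Squaring
and integrating over y in E leaves integrals over two homothetic images of E inside E. For a set
that is not convex, the first contraction towards B brings y into a region that can be joined with
x. -/
theorem inverse_estimate_of_maps {G : Plane → F} (hG : PreservesLine G) {E : Set Plane}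
    (hE : MeasurableSet E) (hfin : volume E ≠ ⊤) (hint : IntegrableOn (fun y => ‖G y‖ ^ 2) E)
    {x B : Plane} {ε t : ℝ} (hε : 0 < ε) (ht0 : 0 < t) (ht1 : t < 1)
    (h1 : ∀ y ∈ E, (1 - ε) • B + ε • y ∈ E)
    (h2 : ∀ y ∈ E, (1 - t) • x + t • ((1 - ε) • B + ε • y) ∈ E) :
    ‖G x‖ ^ 2 * volume.real E ≤ 4 / (t * ε * (1 - t)) ^ 2 * ∫ y in E, ‖G y‖ ^ 2 := by
  have h2' : ∀ y ∈ E, ((1 - t) • x + (t * (1 - ε)) • B) + (t * ε) • y ∈ E := by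
    intro y hy
    convert h2 y hy using 1
    module
  obtain ⟨i1, b1⟩ := setIntegral_comp_homothety_le hE (g := fun y => ‖G y‖ ^ 2)
    (fun _ => by positivity) hint _ hε h1
  obtain ⟨i2, b2⟩ := setIntegral_comp_homothety_le hE (g := fun y => ‖G y‖ ^ 2)
    (fun _ => by positivity) hint _ (mul_pos ht0 hε) h2'
  have hpt : ∀ y, (1 - t) ^ 2 * ‖G x‖ ^ 2 ≤
      2 * ‖G (((1 - t) • x + (t * (1 - ε)) • B) + (t * ε) • y)‖ ^ 2 +
      2 * ‖G ((1 - ε) • B + ε • y)‖ ^ 2 := by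
    intro y
    have e := hG x ((1 - ε) • B + ε • y) t
    rw [show (1 - t) • x + t • ((1 - ε) • B + ε • y) =
      ((1 - t) • x + (t * (1 - ε)) • B) + (t * ε) • y by module] at e
    set u := G (((1 - t) • x + (t * (1 - ε)) • B) + (t * ε) • y)
    set v := G ((1 - ε) • B + ε • y)
    have e' : (1 - t) • G x = u - t • v := by rw [e]; abel
    have n1 : ‖(1 - t) • G x‖ = (1 - t) * ‖G x‖ := by
      rw [norm_smul, Real.norm_of_nonneg (by linarith)]
    have n2 : ‖u - t • v‖ ≤ ‖u‖ + ‖v‖ := by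
      refine (norm_sub_le _ _).trans ?_
      rw [norm_smul, Real.norm_of_nonneg ht0.le]
      nlinarith [norm_nonneg v]
    rw [← mul_pow, ← n1, e']
    have := norm_nonneg (u - t • v)
    nlinarith [sq_nonneg (‖u‖ - ‖v‖)]
  have hconst : ∫ y in E, (1 - t) ^ 2 * ‖G x‖ ^ 2 = volume.real E * ((1 - t) ^ 2 * ‖G x‖ ^ 2) := by
    rw [setIntegral_const, smul_eq_mul]
  have hle : ∫ y in E, (1 - t) ^ 2 * ‖G x‖ ^ 2 ≤ ∫ y in E,
      (2 * ‖G (((1 - t) • x + (t * (1 - ε)) • B) + (t * ε) • y)‖ ^ 2 +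
      2 * ‖G ((1 - ε) • B + ε • y)‖ ^ 2) :=
    integral_mono (integrableOn_const hfin) ((i2.const_mul 2).add (i1.const_mul 2)) hpt
  rw [hconst, integral_add (i2.const_mul 2) (i1.const_mul 2), integral_const_mul,
    integral_const_mul] at hle
  set I := ∫ y in E, ‖G y‖ ^ 2
  have hI : 0 ≤ I := integral_nonneg fun _ => by positivity
  have hb : volume.real E * ((1 - t) ^ 2 * ‖G x‖ ^ 2) ≤
      2 * (((t * ε) ^ 2)⁻¹ * I) + 2 * ((ε ^ 2)⁻¹ * I) := by linarith
  have hcmp : (ε ^ 2)⁻¹ ≤ ((t * ε) ^ 2)⁻¹ := by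
    apply inv_anti₀ (by positivity)
    apply pow_le_pow_left₀ (by positivity)
    nlinarith
  have h1t : 0 < 1 - t := by linarith
  have : volume.real E * ((1 - t) ^ 2 * ‖G x‖ ^ 2) ≤ 4 * (((t * ε) ^ 2)⁻¹ * I) := by
    nlinarith [mul_le_mul_of_nonneg_right hcmp hI]
  rw [div_mul_eq_mul_div, le_div_iff₀ (by positivity)]
  calc ‖G x‖ ^ 2 * volume.real E * (t * ε * (1 - t)) ^ 2
      = (t * ε) ^ 2 * (volume.real E * ((1 - t) ^ 2 * ‖G x‖ ^ 2)) := by ring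
    _ ≤ (t * ε) ^ 2 * (4 * (((t * ε) ^ 2)⁻¹ * I)) := by gcongr
    _ = 4 * I := by field_simp

/-- The inverse estimate on a convex set. -/
theorem inverse_estimate_of_midpoint {G : Plane → F} (hG : PreservesLine G) {E : Set Plane}
    (hE : MeasurableSet E) (hfin : volume E ≠ ⊤) (hint : IntegrableOn (fun y => ‖G y‖ ^ 2) E)
    {x : Plane} (h2 : ∀ y ∈ E, (1 / 2 : ℝ) • x + (1 / 2 : ℝ) • y ∈ E) :
    ‖G x‖ ^ 2 * volume.real E ≤ 64 * ∫ y in E, ‖G y‖ ^ 2 := by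
  have := inverse_estimate_of_maps hG hE hfin hint (x := x) (B := x) (ε := 1) (t := 1 / 2)
    one_pos (by norm_num) (by norm_num) (fun y hy => by simpa using hy)
    (fun y hy => by
      convert h2 y hy using 2
      · norm_num
      · simp)
  norm_num at this
  exact this

/-! ## Positions of a triangle relative to a circle -/

/-- The circle meets each open side of the triangle at most once and its boundary at most
twice. -/
structure CutsRegularly (c : Plane) (r : ℝ) (A B C : Plane) : Prop where
  AB : ∀ x ∈ openSegment ℝ A B, ∀ y ∈ openSegment ℝ A B,
    power c r x = 0 → power c r y = 0 → x = y
  BC : ∀ x ∈ openSegment ℝ B C, ∀ y ∈ openSegment ℝ B C,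
    power c r x = 0 → power c r y = 0 → x = y
  CA : ∀ x ∈ openSegment ℝ C A, ∀ y ∈ openSegment ℝ C A,
    power c r x = 0 → power c r y = 0 → x = y
  bdry : ∀ x ∈ frontier (tri A B C), ∀ y ∈ frontier (tri A B C), ∀ z ∈ frontier (tri A B C),
    power c r x = 0 → power c r y = 0 → power c r z = 0 → x = y ∨ y = z ∨ x = z

namespace CutsRegularly

variable {c : Plane} {r h : ℝ} {A B C : Plane}

theorem rotate (H : CutsRegularly c r A B C) : CutsRegularly c r B C A where
  AB := H.BC
  BC := H.CA
  CA := H.AB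
  bdry := by rw [← tri_rotate]; exact H.bdry

theorem swap (H : CutsRegularly c r A B C) : CutsRegularly c r A C B where
  AB := by rw [openSegment_symm]; exact H.CA
  BC := by rw [openSegment_symm]; exact H.BC
  CA := by rw [openSegment_symm]; exact H.AB
  bdry := by rw [← tri_swap]; exact H.bdry

end CutsRegularly

namespace RegularTri

variable {h : ℝ} {A B C : Plane}

theorem bary_seg_AB (T : RegularTri h A B C) {a b : ℝ} (hs : a + b = 1) :
    bary A B C (a • A + b • B) = 0 := by
  have := T.bary_comb (a := a) (b := b) (c := 0) (by linarith)
  simpa using this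

theorem bary_seg_AC (T : RegularTri h A B C) {a b : ℝ} (hs : a + b = 1) :
    bary A B C (a • A + b • C) = b := by
  have := T.bary_comb (a := a) (b := 0) (c := b) (by linarith)
  simpa using this

theorem seg_mem_frontier (T : RegularTri h A B C) {x : Plane} (hx : x ∈ segment ℝ A B) :
    x ∈ frontier (tri A B C) := by
  obtain ⟨a, b, ha, hb, hs, rfl⟩ := hx
  rw [T.mem_frontier_iff]
  refine ⟨⟨a, b, 0, ha, hb, le_rfl, by linarith, by simp⟩, Or.inr (Or.inr (T.bary_seg_AB hs))⟩

theorem bary_eq_zero_of_mem_segment (T : RegularTri h A B C) {x : Plane}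
    (hx : x ∈ segment ℝ A B) : bary A B C x = 0 := by
  obtain ⟨a, b, ha, hb, hs, rfl⟩ := hx
  exact T.bary_seg_AB hs

end RegularTri

/-- Three sides are never all hit: if the circle crosses the open sides `AB` and `AC` and has a
further zero away from them, the cut is not regular. -/
theorem CutsRegularly.no_three {c : Plane} {r h : ℝ} {A B C : Plane} (T : RegularTri h A B C)
    (H : CutsRegularly c r A B C) {x y z : Plane} (hx : x ∈ openSegment ℝ A B)
    (hy : y ∈ openSegment ℝ A C) (hz : z ∈ segment ℝ B C) (px : power c r x = 0)
    (py : power c r y = 0) (pz : power c r z = 0) : False := by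
  have hx' : x ∈ frontier (tri A B C) := T.seg_mem_frontier (openSegment_subset_segment ℝ _ _ hx)
  have hy' : y ∈ frontier (tri A B C) := by
    rw [tri_swap]; exact T.swap.seg_mem_frontier (openSegment_subset_segment ℝ _ _ hy)
  have hz' : z ∈ frontier (tri A B C) := by
    rw [tri_rotate]; exact T.rotate.seg_mem_frontier hz
  have z1 := T.rotate.bary_eq_zero_of_mem_segment hz
  have x1 : 0 < bary B C A x := by
    rw [openSegment_symm] at hx
    obtain ⟨a, b, ha, hb, hs, rfl⟩ := hx
    rw [show a • B + b • A = a • B + (0 : ℝ) • C + b • A by simp, T.rotate.bary_comb (by linarith)]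
    exact hb
  have y1 : 0 < bary B C A y := by
    obtain ⟨a, b, ha, hb, hs, rfl⟩ := hy
    rw [show a • A + b • C = (0 : ℝ) • B + b • C + a • A by simp; abel,
      T.rotate.bary_comb (by linarith)]
    exact ha
  have x2 := T.bary_eq_zero_of_mem_segment (openSegment_subset_segment ℝ _ _ hx)
  have y2 : 0 < bary A B C y := by
    obtain ⟨a, b, ha, hb, hs, rfl⟩ := hy
    rw [T.bary_seg_AC hs]; exact hb
  -- The three zeros are distinct: the coordinate of A vanishes only at z, and that of C separates x
  -- from y.
  rcases H.bdry x hx' y hy' z hz' px py pz with rfl | rfl | rfl <;> linarith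

end UnfittedNitsche
end

/-! ### Regularly cut triangles: classification of their positions -/

noncomputable section
namespace UnfittedNitsche

/-- The zero is sought between y and B. Comparing weights, s < s', records that it lies strictly on
the B side of y; this later separates zeros found in opposite directions. -/
theorem exists_zero_towards {c : Plane} {r : ℝ} {A B y : Plane} (hy : y ∈ segment ℝ A B)
    (h0 : power c r y < 0) (hB : 0 < power c r B) (hA : 0 ≤ power c r A) :
    ∃ s t : ℝ, 0 < s ∧ 0 < t ∧ s + t = 1 ∧ power c r (s • A + t • B) = 0 ∧
      ∃ s' t' : ℝ, 0 < s' ∧ 0 < t' ∧ s' + t' = 1 ∧ y = s' • A + t' • B ∧ s < s' := by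
  obtain ⟨a, b, ha, hb, hs, rfl⟩ := hy
  have ha' : 0 < a := by
    rcases ha.eq_or_lt with h | h
    · subst h; rw [zero_add] at hs; subst hs; simp at h0; linarith
    · exact h
  have hb' : 0 < b := by
    rcases hb.eq_or_lt with h | h
    · subst h; rw [add_zero] at hs; subst hs; simp at h0; linarith
    · exact h
  obtain ⟨z, ⟨u, v, hu, hv, huv, rfl⟩, hz⟩ := exists_power_eq_zero h0 hB
  refine ⟨u * a, u * b + v, by positivity, by positivity, ?_, ?_, a, b, ha', hb', hs, rfl, ?_⟩
  · linear_combination u * hs + huv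
  · rw [← hz]; congr 1; module
  · nlinarith

/-- The power changes sign on either side of y, which produces two zeros separated by y. -/
theorem no_two_zeros_on_side {c : Plane} {r : ℝ} {A B y : Plane} (hAB : A ≠ B)
    (hy : y ∈ segment ℝ A B)
    (h0 : power c r y < 0) (hA : 0 < power c r A) (hB : 0 < power c r B)
    (H : ∀ x ∈ openSegment ℝ A B, ∀ y ∈ openSegment ℝ A B,
      power c r x = 0 → power c r y = 0 → x = y) : False := by
  obtain ⟨s, t, hs, ht, hst, hz, s', t', hs', ht', hst', hy', hlt⟩ :=
    exists_zero_towards hy h0 hB hA.le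
  obtain ⟨u, v, hu, hv, huv, hz2, u', v', hu', hv', huv', hy2, hlt2⟩ :=
    exists_zero_towards (by rw [segment_symm]; exact hy) h0 hA hB.le
  have e := H _ ⟨s, t, hs, ht, hst, rfl⟩ _ ⟨v, u, hv, hu, by linarith, add_comm _ _⟩ hz hz2
  have inj : ∀ p q p' q' : ℝ, p + q = 1 → p' + q' = 1 → p • A + q • B = p' • A + q' • B →
      p = p' := by
    intro p q p' q' h1 h2 he
    have : (p - p') • (A - B) = 0 := by
      obtain rfl : q = 1 - p := by linarith
      obtain rfl : q' = 1 - p' := by linarith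
      have := sub_eq_zero.2 he
      rw [← this]; module
    rcases smul_eq_zero.1 this with h | h
    · linarith
    · exact absurd (sub_eq_zero.1 h) hAB
  have e1 := inj s t v u hst (by linarith) (by rw [e, add_comm])
  have e2 := inj s' t' v' u' hst' (by linarith) (by rw [← hy', hy2, add_comm])
  linarith

/-- Possible positions of a regularly cut triangle. -/
theorem CutsRegularly.cases {c : Plane} {r h : ℝ} {A B C : Plane} (T : RegularTri h A B C)
    (H : CutsRegularly c r A B C) :
    (power c r A ≤ 0 ∧ power c r B ≤ 0 ∧ power c r C ≤ 0) ∨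
    ((0 < power c r A ∧ power c r B < 0 ∧ power c r C < 0) ∨
      (0 < power c r B ∧ power c r C < 0 ∧ power c r A < 0) ∨
      (0 < power c r C ∧ power c r A < 0 ∧ power c r B < 0)) ∨
    ((∀ x ∈ segment ℝ A B, 0 ≤ power c r x) ∨ (∀ x ∈ segment ℝ B C, 0 ≤ power c r x) ∨
      (∀ x ∈ segment ℝ C A, 0 ≤ power c r x)) := by
  -- Otherwise some vertex is outside and every side has a point inside the disc. Two outer vertices
  -- would give two zeros on their open side. If exactly one is outside, another must lie on the
  -- circle, and then the circle crosses both open sides at the outer vertex and passes through the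
  -- other one: three zeros on the boundary.
  by_contra! hcon
  obtain ⟨hnp, ⟨hA1, hB1, hC1⟩, ⟨y1, hy1, py1⟩, ⟨y2, hy2, py2⟩, ⟨y3, hy3, py3⟩⟩ := hcon
  have ne : ∀ {A B C : Plane}, RegularTri h A B C → A ≠ B := by
    rintro A B C T rfl
    have := T.AB_ge; have := T.pos; simp at *; nlinarith
  have two : ∀ {A B C y : Plane}, RegularTri h A B C → CutsRegularly c r A B C →
      y ∈ segment ℝ A B → power c r y < 0 → 0 < power c r A → 0 < power c r B → False :=
    fun T H hy p hA hB => no_two_zeros_on_side (ne T) hy p hA hB H.AB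
  have tAB := two T H hy1 py1
  have tBC := two T.rotate H.rotate hy2 py2
  have tCA := two T.rotate.rotate H.rotate.rotate hy3 py3
  have key : ∀ {A B C y y' : Plane}, RegularTri h A B C → CutsRegularly c r A B C →
      y ∈ segment ℝ A B → power c r y < 0 → y' ∈ segment ℝ C A → power c r y' < 0 →
      0 < power c r A → power c r B ≤ 0 → power c r C ≤ 0 → (power c r B = 0 ∨ power c r C = 0) →
      False := by
    intro A B C y y' T H hy p hy' p' hA hB hC h0
    have z1 : ∃ z ∈ openSegment ℝ A B, power c r z = 0 := by
      rcases hB.lt_or_eq with h | h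
      · rw [openSegment_symm]; exact exists_power_eq_zero h hA
      · obtain ⟨s, t, hs, ht, hst, hz, -⟩ :=
          exists_zero_towards (by rw [segment_symm]; exact hy) p hA h.ge
        exact ⟨_, ⟨t, s, ht, hs, by linarith, add_comm _ _⟩, hz⟩
    have z2 : ∃ z ∈ openSegment ℝ A C, power c r z = 0 := by
      rcases hC.lt_or_eq with h | h
      · rw [openSegment_symm]; exact exists_power_eq_zero h hA
      · obtain ⟨s, t, hs, ht, hst, hz, -⟩ := exists_zero_towards hy' p' hA h.ge
        exact ⟨_, ⟨t, s, ht, hs, by linarith, add_comm _ _⟩, hz⟩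
    obtain ⟨z1, hz1, pz1⟩ := z1
    obtain ⟨z2, hz2, pz2⟩ := z2
    rcases h0 with h0 | h0
    · exact H.no_three T hz1 hz2 (left_mem_segment ℝ B C) pz1 pz2 h0
    · exact H.no_three T hz1 hz2 (right_mem_segment ℝ B C) pz1 pz2 h0
  have kA := key T H hy1 py1 hy3 py3
  have kB := key T.rotate H.rotate hy2 py2 hy1 py1
  have kC := key T.rotate.rotate H.rotate.rotate hy3 py3 hy2 py2
  have kk : ∀ {A B C y : Plane}, RegularTri h A B C → CutsRegularly c r A B C →
      y ∈ segment ℝ B C → power c r y < 0 → power c r A < 0 → power c r B = 0 →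
      0 < power c r C → False := by
    intro A B C y T H hy p hA hB hC
    obtain ⟨s, t, hs, ht, hst, hz, -⟩ := exists_zero_towards hy p hC hB.ge
    obtain ⟨z2, hz2, pz2⟩ := exists_power_eq_zero hA hC
    refine H.rotate.rotate.no_three T.rotate.rotate (x := z2) (y := s • B + t • C) ?_ ?_
      (right_mem_segment ℝ A B) pz2 hz hB
    · rw [openSegment_symm]; exact hz2
    · rw [openSegment_symm]; exact ⟨s, t, hs, ht, hst, rfl⟩
  rcases lt_trichotomy (power c r A) 0 with a | a | a <;>
  rcases lt_trichotomy (power c r B) 0 with b | b | b <;>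
  rcases lt_trichotomy (power c r C) 0 with e | e | e <;>
  grind

/-- The constant of the inverse estimate. -/
def invConst : ℝ := 4 / ((103 / 104) * (1 / 104) * (1 / 104)) ^ 2

theorem invConst_ge : 64 ≤ invConst := by norm_num [invConst]

variable {F : Type*} [NormedAddCommGroup F] [NormedSpace ℝ F]

theorem comb_combine {B V W : Plane} {ε t a b c a' b' c' : ℝ} :
    (1 - t) • (a • V + b • B + c • W) + t • ((1 - ε) • B + ε • (a' • V + b' • B + c' • W)) =
    ((1 - t) * a + t * ε * a') • V + ((1 - t) * b + t * (1 - ε) + t * ε * b') • B +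
      ((1 - t) * c + t * ε * c') • W := by
  module

/-- If membership in `E` forces, and is implied by, bounds on the coordinates belonging to `V`
and `W`, the inverse estimate holds. -/
theorem inverse_estimate_of_box {G : Plane → F} (hG : PreservesLine G) {V B W : Plane}
    {E : Set Plane} (hEs : E ⊆ tri V B W) {p q s : ℝ} (hs : 0 ≤ s) (hp : 0 ≤ p) (hq : 0 ≤ q)
    (hE : MeasurableSet E) (hfin : volume E ≠ ⊤) (hint : IntegrableOn (fun y => ‖G y‖ ^ 2) E)
    (hup : ∀ a b e : ℝ, 0 ≤ a → 0 ≤ b → 0 ≤ e → a + b + e = 1 → a • V + b • B + e • W ∈ E →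
      a * p ≤ 3 * s ∧ e * q ≤ 3 * s)
    (hlow : ∀ a b e : ℝ, 0 ≤ a → 0 ≤ b → 0 ≤ e → a + b + e = 1 → 17 * (a * p) ≤ s →
      17 * (e * q) ≤ s → a • V + b • B + e • W ∈ E) {x : Plane} (hx : x ∈ E) :
    ‖G x‖ ^ 2 * volume.real E ≤ invConst * ∫ y in E, ‖G y‖ ^ 2 := by
  obtain ⟨a, b, e, ha, hb, he, hsum, rfl⟩ := hEs hx
  obtain ⟨u1, u2⟩ := hup a b e ha hb he hsum hx
  -- The contractions multiply the bound 3s by less than 2/104, and 6/104 < 1/17, so both land in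
  -- the inner box. The constant is 4/(tε(1−t))².
  have := inverse_estimate_of_maps hG hE hfin hint (x := a • V + b • B + e • W) (B := B)
    (ε := 1 / 104) (t := 103 / 104) (by norm_num) (by norm_num) (by norm_num) ?_ ?_
  · refine this.trans_eq ?_
    norm_num [invConst]
  · intro y hy
    obtain ⟨a', b', e', ha', hb', he', hsum', rfl⟩ := hEs hy
    obtain ⟨u1', u2'⟩ := hup a' b' e' ha' hb' he' hsum' hy
    have := hlow (1 / 104 * a') (103 / 104 + 1 / 104 * b') (1 / 104 * e') (by positivity)
      (by positivity) (by positivity) (by linarith) (by nlinarith) (by nlinarith)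
    convert this using 1
    module
  · intro y hy
    obtain ⟨a', b', e', ha', hb', he', hsum', rfl⟩ := hEs hy
    obtain ⟨u1', u2'⟩ := hup a' b' e' ha' hb' he' hsum' hy
    rw [comb_combine]
    apply hlow
    · norm_num; positivity
    · norm_num; positivity
    · norm_num; positivity
    · linarith
    · have : 0 ≤ a' * p := by positivity
      nlinarith
    · have : 0 ≤ e' * q := by positivity
      nlinarith

theorem isCompact_tri (A B C : Plane) : IsCompact (tri A B C) := by
  rw [show tri A B C = convexHull ℝ (Set.range ![A, B, C]) from
    (convexHull_range_eq_tri ![A, B, C]).symm]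
  exact (Set.finite_range _).isCompact_convexHull ℝ

/-! ### Inverse estimates on the two parts of a cut triangle -/

theorem tri_diff_ball_data {F : Type*} [NormedAddCommGroup F] {G : Plane → F} (hc : Continuous G) {h : ℝ} {A B C : Plane}
    (T : RegularTri h A B C) (c : Plane) (r : ℝ) :
    MeasurableSet (tri A B C \ Metric.ball c r) ∧ volume (tri A B C \ Metric.ball c r) ≠ ⊤ ∧
      IntegrableOn (fun y => ‖G y‖ ^ 2) (tri A B C \ Metric.ball c r) := by
  have hcomp := isCompact_tri A B C
  have hm : MeasurableSet (tri A B C \ Metric.ball c r) :=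
    T.isClosed_tri.measurableSet.diff measurableSet_ball
  refine ⟨hm, ne_top_of_le_ne_top hcomp.measure_lt_top.ne (measure_mono Set.sdiff_subset), ?_⟩
  exact ((by fun_prop : Continuous fun y => ‖G y‖ ^ 2).continuousOn.integrableOn_compact
    hcomp).mono_set Set.sdiff_subset

/-- The midpoint of BC is not inside the disc, so |BC|² ≤ 4F, where F is the power of B, the larger
one on this side; by shape regularity all squared sides are at most 12F. So F dominates every term
of `power_comb` except the depth of V inside the disc, which enters the weight p. -/
theorem outside_estimate_edge {G : Plane → F} (hG : PreservesLine G) (hc : Continuous G)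
    {h r : ℝ} {c V B C : Plane} (hr : 0 < r) (T : RegularTri h V B C)
    (hE : ∀ x ∈ segment ℝ B C, 0 ≤ power c r x) (hBC : power c r C ≤ power c r B) {x : Plane}
    (hx : x ∈ tri V B C \ Metric.ball c r) :
    ‖G x‖ ^ 2 * volume.real (tri V B C \ Metric.ball c r) ≤
      invConst * ∫ y in tri V B C \ Metric.ball c r, ‖G y‖ ^ 2 := by
  obtain ⟨m1, m2, m3⟩ := tri_diff_ball_data hc T c r
  have hC := hE C (right_mem_segment ℝ B C)
  have hmid := hE ((1 / 2 : ℝ) • B + (1 / 2 : ℝ) • C) ⟨1 / 2, 1 / 2, by norm_num, by norm_num,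
    by norm_num, rfl⟩
  rw [power_segment _ _ _ _ (by norm_num)] at hmid
  have b1 := T.AB_le
  have b2 := T.BC_ge
  have b3 := T.AC_le
  have hp := T.pos
  have hh : 0 < h ^ 2 := by positivity
  set F := power c r B
  have hF : ‖C - B‖ ^ 2 ≤ 4 * F := by linarith
  have hFpos : 0 < F := by linarith
  set d := max 0 (-power c r V) with hd
  have hd0 : 0 ≤ d := le_max_left _ _
  have hdV : -d ≤ power c r V := by linarith [le_max_right 0 (-power c r V)]
  refine inverse_estimate_of_box hG Set.sdiff_subset (p := d + 3 * F) (q := F) (s := F) hFpos.le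
    (by positivity) hFpos.le m1 m2 m3 ?_ ?_ hx
  · intro a b e ha hb he hs hmem
    have hpow := (power_nonneg_iff hr).2 hmem.2
    rw [power_comb _ _ _ _ _ hs] at hpow
    have q1 : 0 ≤ a * b * ‖B - V‖ ^ 2 := by positivity
    have q2 : 0 ≤ b * e * ‖C - B‖ ^ 2 := by positivity
    have q3 : 0 ≤ a * e * ‖C - V‖ ^ 2 := by positivity
    have q4 : e * power c r C ≤ e * F := mul_le_mul_of_nonneg_left hBC he
    have ha1 : a ≤ 1 := by linarith
    have hs' : a * F + b * F + e * F = F := by rw [← add_mul, ← add_mul, hs, one_mul]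
    refine ⟨?_, by nlinarith⟩
    have hbF : 0 ≤ b * F := by positivity
    have heF : 0 ≤ e * F := by positivity
    rcases le_total 0 (-power c r V) with hv | hv
    · have : d = -power c r V := by rw [hd, max_eq_right hv]
      rw [this]; nlinarith
    · have : d = 0 := by rw [hd, max_eq_left hv]
      rw [this]; nlinarith
  · intro a b e ha hb he hs l1 l2
    refine ⟨⟨a, b, e, ha, hb, he, hs, rfl⟩, (power_nonneg_iff hr).1 ?_⟩
    rw [power_comb _ _ _ _ _ hs]
    have ha1 : a ≤ 1 := by linarith
    have hb1 : b ≤ 1 := by linarith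
    have he1 : e ≤ 1 := by linarith
    have q1 : a * b * ‖B - V‖ ^ 2 ≤ a * (12 * F) := by
      have : a * b ≤ a := by nlinarith
      have : ‖B - V‖ ^ 2 ≤ 12 * F := by linarith
      nlinarith [mul_nonneg ha hb]
    have q2 : b * e * ‖C - B‖ ^ 2 ≤ e * (4 * F) := by
      have : b * e ≤ e := by nlinarith
      nlinarith [mul_nonneg hb he]
    have q3 : a * e * ‖C - V‖ ^ 2 ≤ a * (12 * F) := by
      have : a * e ≤ a := by nlinarith
      have : ‖C - V‖ ^ 2 ≤ 12 * F := by linarith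
      nlinarith [mul_nonneg ha he]
    have q4 : 0 ≤ e * power c r C := by positivity
    have q5 : a * (-d) ≤ a * power c r V := mul_le_mul_of_nonneg_left hdV ha
    have hs' : a * F + b * F + e * F = F := by rw [← add_mul, ← add_mul, hs, one_mul]
    have : 0 ≤ a * d := by positivity
    have : 0 ≤ a * F := by positivity
    have : 0 ≤ e * F := by positivity
    nlinarith

/-- Here F, the power of the only outer vertex, can be tiny compared with h², so the side lengths
have to enter the weights. A point outside the disc has b > 0, and dividing its inequality by b
yields a L1 ≤ F and e L2 ≤ F. -/
theorem outside_estimate_corner {G : Plane → F} (hG : PreservesLine G) (hc : Continuous G)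
    {h r : ℝ} {c V B W : Plane} (hr : 0 < r) (T : RegularTri h V B W)
    (hB : 0 < power c r B) (hV : power c r V < 0) (hW : power c r W < 0) {x : Plane}
    (hx : x ∈ tri V B W \ Metric.ball c r) :
    ‖G x‖ ^ 2 * volume.real (tri V B W \ Metric.ball c r) ≤
      invConst * ∫ y in tri V B W \ Metric.ball c r, ‖G y‖ ^ 2 := by
  obtain ⟨m1, m2, m3⟩ := tri_diff_ball_data hc T c r
  set F := power c r B with hF
  set d1 := -power c r V with hd1
  set d2 := -power c r W with hd2
  have hd1' : power c r V = -d1 := by simp [hd1]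
  have hd2' : power c r W = -d2 := by simp [hd2]
  have d1p : 0 < d1 := by linarith
  have d2p : 0 < d2 := by linarith
  set L1 := ‖B - V‖ ^ 2 with hL1
  set L2 := ‖W - B‖ ^ 2 with hL2
  set L := ‖W - V‖ ^ 2 with hL
  have L1n : 0 ≤ L1 := by positivity
  have L2n : 0 ≤ L2 := by positivity
  have hLn : 0 ≤ L := by positivity
  have hLle : L ≤ 2 * L1 + 2 * L2 := by
    have := norm_add_le (W - B) (B - V)
    rw [sub_add_sub_cancel] at this
    have h0 := norm_nonneg (W - V)
    rw [hL, hL1, hL2]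
    nlinarith [sq_nonneg (‖W - B‖ - ‖B - V‖)]
  clear_value L1 L2 L d1 d2 F
  refine inverse_estimate_of_box hG Set.sdiff_subset (p := d1 + F + L1) (q := d2 + F + L2) (s := F)
    hB.le (by positivity) (by positivity) m1 m2 m3 ?_ ?_ hx
  · intro a b e ha hb he hs hmem
    have hpow := (power_nonneg_iff hr).2 hmem.2
    rw [power_comb _ _ _ _ _ hs, hd1', hd2', ← hF, ← hL1, ← hL2, ← hL] at hpow
    have q3 : 0 ≤ a * e * L := by positivity
    have hbpos : 0 < b := by
      rcases hb.eq_or_lt with h0 | h0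
      · exfalso
        subst h0
        have : 0 < a * d1 + e * d2 := by
          rcases ha.eq_or_lt with h1 | h1
          · subst h1
            have : e = 1 := by linarith
            subst this; linarith
          · have : 0 < a * d1 := by positivity
            have : 0 ≤ e * d2 := by positivity
            linarith
        simp at hpow
        linarith
      · exact h0
    have n1 : 0 ≤ a * d1 := by positivity
    have n2 : 0 ≤ e * d2 := by positivity
    have n3 : 0 ≤ a * b * L1 := by positivity
    have n4 : 0 ≤ b * e * L2 := by positivity
    have hb1 : b ≤ 1 := by linarith
    have hbF : b * F ≤ F := mul_le_of_le_one_left hB.le hb1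
    have haF : a * F ≤ F := mul_le_of_le_one_left hB.le (by linarith)
    have heF : e * F ≤ F := mul_le_of_le_one_left hB.le (by linarith)
    have k1 : a * L1 ≤ F := by
      refine le_of_mul_le_mul_left ?_ hbpos
      linarith
    have k2 : e * L2 ≤ F := by
      refine le_of_mul_le_mul_left ?_ hbpos
      linarith
    have k3 : a * d1 ≤ F := by linarith
    have k4 : e * d2 ≤ F := by linarith
    constructor <;> linarith
  · intro a b e ha hb he hs l1 l2
    refine ⟨⟨a, b, e, ha, hb, he, hs, rfl⟩, (power_nonneg_iff hr).1 ?_⟩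
    rw [power_comb _ _ _ _ _ hs, hd1', hd2', ← hF, ← hL1, ← hL2, ← hL]
    have ha1 : a ≤ 1 := by linarith
    have hb1 : b ≤ 1 := by linarith
    have he1 : e ≤ 1 := by linarith
    have q1 : a * b * L1 ≤ a * L1 := by
      exact mul_le_mul_of_nonneg_right (mul_le_of_le_one_right ha hb1) L1n
    have q2 : b * e * L2 ≤ e * L2 := by
      exact mul_le_mul_of_nonneg_right (mul_le_of_le_one_left he hb1) L2n
    have q3 : a * e * L ≤ 2 * (a * L1) + 2 * (e * L2) := by
      have h1 : a * e * L ≤ a * e * (2 * L1 + 2 * L2) :=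
        mul_le_mul_of_nonneg_left hLle (by positivity)
      have h2 : a * e * L1 ≤ a * L1 := by
        exact mul_le_mul_of_nonneg_right (mul_le_of_le_one_right ha he1) L1n
      have h3 : a * e * L2 ≤ e * L2 := by
        exact mul_le_mul_of_nonneg_right (mul_le_of_le_one_left he ha1) L2n
      linarith
    have hs' : a * F + b * F + e * F = F := by rw [← add_mul, ← add_mul, hs, one_mul]
    have : 0 ≤ a * d1 := by positivity
    have : 0 ≤ e * d2 := by positivity
    have : 0 ≤ a * F := by positivity
    have : 0 ≤ e * F := by positivity
    have : 0 ≤ a * L1 := by positivity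
    have : 0 ≤ e * L2 := by positivity
    linarith

/-- The inverse estimate on the part of a regularly cut triangle outside the disc. -/
theorem outside_estimate {G : Plane → F} (hG : PreservesLine G) (hc : Continuous G)
    {h r : ℝ} {c A B C : Plane} (hr : 0 < r) (T : RegularTri h A B C)
    (H : CutsRegularly c r A B C) {x : Plane} (hx : x ∈ tri A B C \ Metric.ball c r) :
    ‖G x‖ ^ 2 * volume.real (tri A B C \ Metric.ball c r) ≤
      invConst * ∫ y in tri A B C \ Metric.ball c r, ‖G y‖ ^ 2 := by
  have edge : ∀ {V B C : Plane}, RegularTri h V B C → (∀ x ∈ segment ℝ B C, 0 ≤ power c r x) →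
      x ∈ tri V B C \ Metric.ball c r →
      ‖G x‖ ^ 2 * volume.real (tri V B C \ Metric.ball c r) ≤
      invConst * ∫ y in tri V B C \ Metric.ball c r, ‖G y‖ ^ 2 := by
    intro V B C T hE hx
    rcases le_total (power c r C) (power c r B) with hle | hle
    · exact outside_estimate_edge hG hc hr T hE hle hx
    · rw [segment_symm] at hE
      rw [tri_swap] at hx ⊢
      exact outside_estimate_edge hG hc hr T.swap hE hle hx
  have r1 := tri_rotate A B C
  have r2 := tri_rotate B C A
  rcases H.cases T with ⟨hA, hB, hC⟩ | (⟨hA, hB, hC⟩ | ⟨hA, hB, hC⟩ | ⟨hA, hB, hC⟩) |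
    (hE | hE | hE)
  -- With all vertices in the closed disc, the convex power is nonpositive on the triangle, so the
  -- outer part lies on the circle and is null.
  · have hsub : tri A B C \ Metric.ball c r ⊆ Metric.sphere c r := by
      rintro y ⟨⟨a, b, e, ha, hb, he, hs, rfl⟩, hy⟩
      have h0 := (power_nonneg_iff hr).2 hy
      refine (power_eq_zero_iff hr).1 (le_antisymm ?_ h0)
      rw [power_comb _ _ _ _ _ hs]
      have q1 : 0 ≤ a * b * ‖B - A‖ ^ 2 := by positivity
      have q2 : 0 ≤ b * e * ‖C - B‖ ^ 2 := by positivity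
      have q3 : 0 ≤ a * e * ‖C - A‖ ^ 2 := by positivity
      nlinarith
    have h0 : volume (tri A B C \ Metric.ball c r) = 0 :=
      measure_mono_null hsub (Measure.addHaar_sphere volume c r)
    rw [Measure.restrict_eq_zero.2 h0, measureReal_def, h0]
    simp
  · rw [r1, r2] at hx ⊢
    exact outside_estimate_corner hG hc hr T.rotate.rotate hA hC hB hx
  · exact outside_estimate_corner hG hc hr T hA hC hB hx
  · rw [r1] at hx ⊢
    exact outside_estimate_corner hG hc hr T.rotate hA hC hB hx
  · rw [r1, r2] at hx ⊢
    exact edge T.rotate.rotate hE hx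
  · exact edge T hE hx
  · rw [r1] at hx ⊢
    exact edge T.rotate hE hx

/-- The inverse estimate on the part of a triangle inside the disc. -/
theorem inside_estimate {G : Plane → F} (hG : PreservesLine G) (hc : Continuous G)
    {h r : ℝ} {c A B C : Plane} (T : RegularTri h A B C) {x : Plane}
    (hx : x ∈ tri A B C) (hxc : x ∈ Metric.closedBall c r) :
    ‖G x‖ ^ 2 * volume.real (tri A B C ∩ Metric.ball c r) ≤
      invConst * ∫ y in tri A B C ∩ Metric.ball c r, ‖G y‖ ^ 2 := by
  have hcomp := isCompact_tri A B C
  have hI : 0 ≤ ∫ y in tri A B C ∩ Metric.ball c r, ‖G y‖ ^ 2 :=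
    integral_nonneg fun _ => by positivity
  -- The midpoint of a point of the closed disc and one of the open disc lies in the open disc, so
  -- points on the circle are admitted.
  refine (inverse_estimate_of_midpoint hG (T.isClosed_tri.measurableSet.inter measurableSet_ball)
    (ne_top_of_le_ne_top hcomp.measure_lt_top.ne (measure_mono Set.inter_subset_left))
    (((by fun_prop : Continuous fun y => ‖G y‖ ^ 2).continuousOn.integrableOn_compact
    hcomp).mono_set Set.inter_subset_left) ?_).trans (mul_le_mul_of_nonneg_right invConst_ge hI)
  rintro y ⟨hy, hyc⟩
  refine ⟨convex_tri A B C hx hy (by norm_num) (by norm_num) (by norm_num), ?_⟩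
  rw [Metric.mem_ball, dist_eq_norm] at hyc ⊢
  rw [Metric.mem_closedBall, dist_eq_norm] at hxc
  rw [show (1 / 2 : ℝ) • x + (1 / 2 : ℝ) • y - c = (1 / 2 : ℝ) • (x - c) + (1 / 2 : ℝ) • (y - c) by
    module]
  refine (norm_add_le _ _).trans_lt ?_
  rw [norm_smul, norm_smul]
  norm_num
  linarith

end UnfittedNitsche
end

noncomputable section
namespace UnfittedNitsche

/-! ## Arc length on circles -/

/-- The parametrization of the circle of centre `c` and radius `r` by the polar angle. -/
def circ (c : Plane) (r θ : ℝ) : Plane := c + r • (!₂[Real.cos θ, Real.sin θ] : Plane)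

variable {c : Plane} {r : ℝ}

theorem circ_zero (c : Plane) (r θ : ℝ) : circ c r θ 0 = c 0 + r * Real.cos θ := by simp [circ]

theorem circ_one (c : Plane) (r θ : ℝ) : circ c r θ 1 = c 1 + r * Real.sin θ := by simp [circ]

theorem continuous_circ (c : Plane) (r : ℝ) : Continuous (circ c r) := by
  have : Continuous fun θ : ℝ => (!₂[Real.cos θ, Real.sin θ] : Plane) := by
    apply (PiLp.continuous_toLp 2 _).comp
    refine continuous_pi fun i => ?_
    fin_cases i
    · exact Real.continuous_cos
    · exact Real.continuous_sin
  unfold circ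
  fun_prop

theorem power_circ (c : Plane) (r θ : ℝ) : power c r (circ c r θ) = 0 := by
  rw [power, normSq_eq]
  simp only [PiLp.sub_apply, circ_zero, circ_one]
  linear_combination r ^ 2 * Real.sin_sq_add_cos_sq θ

theorem circ_mem_sphere (hr : 0 < r) (θ : ℝ) : circ c r θ ∈ Metric.sphere c r :=
  (power_eq_zero_iff hr).1 (power_circ c r θ)

theorem circ_periodic (c : Plane) (r : ℝ) : Function.Periodic (circ c r) (2 * Real.pi) := by
  intro θ; simp [circ]

theorem normSq_circ_sub (c : Plane) (r θ θ' : ℝ) :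
    ‖circ c r θ - circ c r θ'‖ ^ 2 = (2 * r * Real.sin ((θ - θ') / 2)) ^ 2 := by
  rw [normSq_eq]
  simp only [PiLp.sub_apply, circ_zero, circ_one]
  have h1 := Real.cos_sub_cos θ θ'
  have h2 := Real.sin_sub_sin θ θ'
  have e1 : c 0 + r * Real.cos θ - (c 0 + r * Real.cos θ') =
    r * (Real.cos θ - Real.cos θ') := by ring
  have e2 : c 1 + r * Real.sin θ - (c 1 + r * Real.sin θ') =
    r * (Real.sin θ - Real.sin θ') := by ring
  rw [e1, e2, h1, h2]
  linear_combination 4 * r ^ 2 * Real.sin ((θ - θ') / 2) ^ 2 *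
    Real.sin_sq_add_cos_sq ((θ + θ') / 2)

theorem norm_circ_sub (hr : 0 < r) (θ θ' : ℝ) :
    ‖circ c r θ - circ c r θ'‖ = 2 * r * |Real.sin ((θ - θ') / 2)| := by
  have := normSq_circ_sub c r θ θ'
  rw [← abs_of_nonneg (norm_nonneg _), (sq_eq_sq_iff_abs_eq_abs _ _).1 this, abs_mul,
    abs_of_pos (by positivity : 0 < 2 * r)]

theorem norm_circ_sub_le (hr : 0 < r) (θ θ' : ℝ) :
    ‖circ c r θ - circ c r θ'‖ ≤ r * |θ - θ'| := by
  rw [norm_circ_sub hr]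
  have := Real.abs_sin_le_abs (x := (θ - θ') / 2)
  rw [abs_div, abs_two] at this
  nlinarith

theorem circ_injOn (hr : 0 < r) {θ θ' : ℝ} (h : |θ - θ'| < 2 * Real.pi)
    (he : circ c r θ = circ c r θ') : θ = θ' := by
  have h0 := norm_circ_sub (c := c) hr θ θ'
  rw [he, sub_self, norm_zero] at h0
  have h1 : Real.sin ((θ - θ') / 2) = 0 := by
    have : |Real.sin ((θ - θ') / 2)| = 0 := by
      rcases mul_eq_zero.1 h0.symm with h | h
      · linarith
      · exact h
    exact abs_eq_zero.1 this
  rw [abs_lt] at h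
  have := (Real.sin_eq_zero_iff_of_lt_of_lt (by linarith) (by linarith)).1 h1
  linarith

theorem exists_circ_eq (hr : 0 < r) {x : Plane} (hx : x ∈ Metric.sphere c r) (a : ℝ) :
    ∃ θ ∈ Set.Ioc a (a + 2 * Real.pi), circ c r θ = x := by
  have hx0 := (power_eq_zero_iff hr).2 hx
  rw [power, normSq_eq] at hx0
  simp only [PiLp.sub_apply] at hx0
  set z : ℂ := ⟨x 0 - c 0, x 1 - c 1⟩ with hz
  have hn : ‖z‖ = r := by
    have : ‖z‖ ^ 2 = r ^ 2 := by
      rw [Complex.sq_norm, Complex.normSq_apply]; simp [hz]; linarith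
    rwa [sq_eq_sq₀ (norm_nonneg _) hr.le] at this
  obtain ⟨θ, hθ, he⟩ := (circ_periodic c r).exists_mem_Ioc Real.two_pi_pos (Complex.arg z) a
  refine ⟨θ, hθ, ?_⟩
  rw [← he]
  have hz0 : z ≠ 0 := by
    intro h; rw [h, norm_zero] at hn; linarith
  apply plane_ext
  · rw [circ_zero, Complex.cos_arg hz0, hn]; field_simp; simp [hz]
  · rw [circ_one, Complex.sin_arg, hn]; field_simp; simp [hz]

/-- By periodicity the angle may start anywhere, so arcs through angle zero need no splitting. -/
theorem circleArcLength_eq (c : Plane) (r a : ℝ) : circleArcLength c r =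
    ENNReal.ofReal r • Measure.map (circ c r) (volume.restrict (Set.Ioc a (a + 2 * Real.pi))) := by
  have : Fact (0 < 2 * Real.pi) := ⟨Real.two_pi_pos⟩
  have key : ∀ a : ℝ, Measure.map (circ c r) (volume.restrict (Set.Ioc a (a + 2 * Real.pi))) =
      Measure.map (circ_periodic c r).lift (volume : Measure (AddCircle (2 * Real.pi))) := by
    intro a
    have hmp := AddCircle.measurePreserving_mk (2 * Real.pi) a
    have hcl : Continuous ((circ_periodic c r).lift : AddCircle (2 * Real.pi) → Plane) :=
      (continuous_circ c r).quotient_liftOn' _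
    have hl : Measurable ((circ_periodic c r).lift : AddCircle (2 * Real.pi) → Plane) :=
      hcl.measurable
    rw [← hmp.map_eq, Measure.map_map hl hmp.measurable]
    rfl
  have h0 := key 0
  rw [zero_add] at h0
  rw [key a, ← h0]
  rfl

theorem circleArcLength_apply (c : Plane) (r a : ℝ) {S : Set Plane} (hS : MeasurableSet S) :
    circleArcLength c r S =
      ENNReal.ofReal r * volume (circ c r ⁻¹' S ∩ Set.Ioc a (a + 2 * Real.pi)) := by
  rw [circleArcLength_eq c r a, Measure.smul_apply, smul_eq_mul,
    Measure.map_apply (continuous_circ c r).measurable hS,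
    Measure.restrict_apply ((continuous_circ c r).measurable hS)]

instance (c : Plane) (r : ℝ) : IsFiniteMeasure (circleArcLength c r) := by
  constructor
  rw [circleArcLength_apply c r 0 MeasurableSet.univ]
  refine ENNReal.mul_lt_top ENNReal.ofReal_lt_top ?_
  refine (measure_mono Set.inter_subset_right).trans_lt ?_
  rw [Real.volume_Ioc]
  exact ENNReal.ofReal_lt_top

instance (r : ℝ) : IsFiniteMeasure (arcLength r) := by
  unfold arcLength; infer_instance

theorem circleArcLength_singleton (hr : 0 < r) (x : Plane) : circleArcLength c r {x} = 0 := by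
  rw [circleArcLength_apply c r 0 (measurableSet_singleton x)]
  have : (circ c r ⁻¹' {x} ∩ Set.Ioc 0 (0 + 2 * Real.pi)).Subsingleton := by
    rintro θ ⟨h1, h2⟩ θ' ⟨h1', h2'⟩
    refine circ_injOn hr ?_ (h1.trans h1'.symm)
    rw [abs_lt]; constructor <;> linarith [h2.1, h2.2, h2'.1, h2'.2]
  rw [this.measure_zero, mul_zero]

theorem circleArcLength_finite (hr : 0 < r) {S : Set Plane} (hS : S.Finite) :
    circleArcLength c r S = 0 := by
  rw [← Set.biUnion_of_singleton S]
  exact (measure_biUnion_null_iff hS.countable).2 fun x _ => circleArcLength_singleton hr x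

theorem arcLength_finite (hr : 0 < r) {S : Set Plane} (hS : S.Finite) : arcLength r S = 0 := by
  rw [arcLength, Measure.add_apply, circleArcLength_finite hr hS, circleArcLength_finite hr hS,
    add_zero]

/-- Jordan's inequality turns a bound on chords into a bound on angles. The window of angles is
centred at a point of S, which keeps half differences within π/2. -/
theorem circleArcLength_le_of_diam (hr : 0 < r) {S : Set Plane} (hS : MeasurableSet S) {D : ℝ}
    (hD : ∀ x ∈ S, ∀ y ∈ S, ‖x - y‖ ≤ D) :
    circleArcLength c r S ≤ ENNReal.ofReal (Real.pi * D) := by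
  by_cases hne : (circ c r ⁻¹' S).Nonempty
  swap
  · rw [circleArcLength_apply c r 0 hS, Set.not_nonempty_iff_eq_empty.1 hne]; simp
  obtain ⟨θ₁, hθ₁⟩ := hne
  have hD0 : 0 ≤ D := (norm_nonneg _).trans (hD _ hθ₁ _ hθ₁)
  rw [circleArcLength_apply c r (θ₁ - Real.pi) hS]
  have hsub : circ c r ⁻¹' S ∩ Set.Ioc (θ₁ - Real.pi) (θ₁ - Real.pi + 2 * Real.pi) ⊆
      Set.Icc (θ₁ - Real.pi * D / (2 * r)) (θ₁ + Real.pi * D / (2 * r)) := by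
    rintro θ ⟨h1, h2, h3⟩
    have h4 := hD _ h1 _ hθ₁
    rw [norm_circ_sub hr] at h4
    have h5 : |(θ - θ₁) / 2| ≤ Real.pi / 2 := by
      rw [abs_le]; constructor <;> linarith
    have h6 := Real.mul_abs_le_abs_sin h5
    rw [abs_div, abs_two] at h6
    have hpi := Real.pi_pos
    have h7 : |θ - θ₁| ≤ Real.pi * D / (2 * r) := by
      rw [le_div_iff₀ (by positivity)]
      have h8 : 2 * r * (2 / Real.pi * (|θ - θ₁| / 2)) ≤ D :=
        (mul_le_mul_of_nonneg_left h6 (by positivity)).trans h4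
      have h9 : 2 * r * (2 / Real.pi * (|θ - θ₁| / 2)) = |θ - θ₁| * (2 * r) / Real.pi := by
        field_simp
      rw [h9, div_le_iff₀ hpi] at h8
      linarith
    rw [abs_le] at h7
    exact ⟨by linarith, by linarith⟩
  calc _ ≤ ENNReal.ofReal r * volume (Set.Icc (θ₁ - Real.pi * D / (2 * r))
        (θ₁ + Real.pi * D / (2 * r))) := by gcongr
    _ = ENNReal.ofReal (Real.pi * D) := by
        rw [Real.volume_Icc, ← ENNReal.ofReal_mul hr.le]
        congr 1
        field_simp
        ring

theorem arcLength_real_le_of_diam (hr : 0 < r) {S : Set Plane} (hS : MeasurableSet S) {D : ℝ}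
    (hD0 : 0 ≤ D) (hD : ∀ x ∈ S, ∀ y ∈ S, ‖x - y‖ ≤ D) :
    (arcLength r).real S ≤ 2 * Real.pi * D := by
  have h1 := circleArcLength_le_of_diam (c := siteA) hr hS hD
  have h2 := circleArcLength_le_of_diam (c := siteB) hr hS hD
  rw [measureReal_def, arcLength, Measure.add_apply]
  have hpi := Real.pi_pos
  refine ENNReal.toReal_le_of_le_ofReal (by positivity) ?_
  refine (add_le_add h1 h2).trans_eq ?_
  rw [← ENNReal.ofReal_add (by positivity) (by positivity)]
  congr 1; ring

/-- An arc of angle at most 2π is traversed without repetition, so the parametrized integral is part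
of the integral over S. -/
theorem setIntegral_circ_le {S : Set Plane} (hr : 0 < r) (hS : MeasurableSet S) {u w : ℝ}
    (hw : w ≤ 2 * Real.pi)
    (hsub : ∀ θ ∈ Set.Ioo u (u + w), circ c r θ ∈ S) {g : Plane → ℝ} (hg0 : ∀ x, 0 ≤ g x)
    (hg : IntegrableOn g S (circleArcLength c r)) :
    r * ∫ θ in Set.Ioo u (u + w), g (circ c r θ) ≤ ∫ x in S, g x ∂(circleArcLength c r) := by
  have hle : ENNReal.ofReal r • Measure.map (circ c r) (volume.restrict (Set.Ioo u (u + w))) ≤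
      (circleArcLength c r).restrict S := by
    rw [circleArcLength_eq c r u, Measure.restrict_smul,
      Measure.restrict_map (continuous_circ c r).measurable hS, Measure.restrict_restrict
      ((continuous_circ c r).measurable hS)]
    gcongr
    · exact (continuous_circ c r).measurable
    · intro θ hθ
      exact ⟨hsub θ hθ, hθ.1, by linarith [hθ.2]⟩
  have h1 : r * ∫ θ in Set.Ioo u (u + w), g (circ c r θ) =
      ∫ x, g x ∂(ENNReal.ofReal r • Measure.map (circ c r)
        (volume.restrict (Set.Ioo u (u + w)))) := by
    have hi : Integrable g (ENNReal.ofReal r • Measure.map (circ c r)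
        (volume.restrict (Set.Ioo u (u + w)))) := Integrable.mono_measure hg hle
    have hi' := (integrable_smul_measure (by simpa using hr) ENNReal.ofReal_ne_top).1 hi
    rw [integral_smul_measure, integral_map (continuous_circ c r).measurable.aemeasurable
      hi'.aestronglyMeasurable, ENNReal.toReal_ofReal hr.le, smul_eq_mul]
  rw [h1]
  exact integral_mono_measure hle (Filter.Eventually.of_forall hg0) hg

theorem circleArcLength_real_ge {S : Set Plane} (hr : 0 < r) (hS : MeasurableSet S) {u w : ℝ}
    (hw0 : 0 ≤ w) (hw : w ≤ 2 * Real.pi) (hsub : ∀ θ ∈ Set.Ioo u (u + w), circ c r θ ∈ S) :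
    r * w ≤ (circleArcLength c r).real S := by
  have := setIntegral_circ_le hr hS hw hsub (g := fun _ => 1) (fun _ => zero_le_one)
    (integrableOn_const (measure_ne_top _ _))
  simpa [hw0] using this

/-- `c` is one of the two centres. -/
def IsSite (c : Plane) : Prop := c = siteA ∨ c = siteB

theorem IsSite.le_arcLength (hc : IsSite c) (r : ℝ) : circleArcLength c r ≤ arcLength r := by
  rcases hc with rfl | rfl
  · exact Measure.le_add_right le_rfl
  · exact Measure.le_add_left le_rfl

end UnfittedNitsche
end

noncomputable section
namespace UnfittedNitsche

/-! ## Lattice coordinates -/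

theorem sq_sqrt_three : (√3 : ℝ) ^ 2 = 3 := Real.sq_sqrt (by norm_num)

/-- The lattice coordinate along `v₁`. -/
def coordS (x : Plane) : ℝ := √3 / 3 * x 0 + x 1

/-- The lattice coordinate along `v₂`. -/
def coordT (x : Plane) : ℝ := √3 / 3 * x 0 - x 1

@[simp] theorem v₁_zero : v₁ 0 = √3 / 2 := by simp [v₁]
@[simp] theorem v₁_one : v₁ 1 = 1 / 2 := by simp [v₁]
@[simp] theorem v₂_zero : v₂ 0 = √3 / 2 := by simp [v₂]
@[simp] theorem v₂_one : v₂ 1 = -(1 / 2) := by simp [v₂]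

theorem coordS_comb (s t : ℝ) : coordS (s • v₁ + t • v₂) = s := by
  simp only [coordS, PiLp.add_apply, PiLp.smul_apply, smul_eq_mul, v₁_zero, v₁_one, v₂_zero,
    v₂_one]
  linear_combination (s + t) / 6 * sq_sqrt_three

theorem coordT_comb (s t : ℝ) : coordT (s • v₁ + t • v₂) = t := by
  simp only [coordT, PiLp.add_apply, PiLp.smul_apply, smul_eq_mul, v₁_zero, v₁_one, v₂_zero,
    v₂_one]
  linear_combination (s + t) / 6 * sq_sqrt_three

theorem comb_coord (x : Plane) : coordS x • v₁ + coordT x • v₂ = x := by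
  apply plane_ext
  · simp only [coordS, coordT, PiLp.add_apply, PiLp.smul_apply, smul_eq_mul, v₁_zero, v₂_zero]
    linear_combination x 0 / 3 * sq_sqrt_three
  · simp only [coordS, coordT, PiLp.add_apply, PiLp.smul_apply, smul_eq_mul, v₁_one, v₂_one]
    ring

theorem coordS_add_smul (a b e : ℝ) (x y z : Plane) :
    coordS (a • x + b • y + e • z) = a * coordS x + b * coordS y + e * coordS z := by
  simp only [coordS, PiLp.add_apply, PiLp.smul_apply, smul_eq_mul]; ring

theorem coordT_add_smul (a b e : ℝ) (x y z : Plane) :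
    coordT (a • x + b • y + e • z) = a * coordT x + b * coordT y + e * coordT z := by
  simp only [coordT, PiLp.add_apply, PiLp.smul_apply, smul_eq_mul]; ring

/-- The basis vectors are unit vectors with inner product 1/2. -/
theorem normSq_coord (x y : Plane) : ‖x - y‖ ^ 2 = (coordS x - coordS y) ^ 2 +
    (coordT x - coordT y) ^ 2 + (coordS x - coordS y) * (coordT x - coordT y) := by
  rw [normSq_eq]
  simp only [coordS, coordT, PiLp.sub_apply]
  linear_combination -((x 0 - y 0) ^ 2 / 3) * sq_sqrt_three

theorem det2_coord (x y z : Plane) : det2 (y - x) (z - x) = -(√3 / 2) *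
    ((coordS y - coordS x) * (coordT z - coordT x) -
      (coordT y - coordT x) * (coordS z - coordS x)) := by
  simp only [det2, coordS, coordT, PiLp.sub_apply]
  linear_combination -((y 0 - x 0) * (z 1 - x 1) - (y 1 - x 1) * (z 0 - x 0)) / 3 * sq_sqrt_three

theorem coord_ext {x y : Plane} (h1 : coordS x = coordS y) (h2 : coordT x = coordT y) : x = y := by
  rw [← comb_coord x, ← comb_coord y, h1, h2]

theorem continuous_coordS : Continuous coordS := by unfold coordS; fun_prop

theorem continuous_coordT : Continuous coordT := by unfold coordT; fun_prop

theorem mem_cell_iff (x : Plane) :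
    x ∈ cell ↔ (0 ≤ coordS x ∧ coordS x ≤ 1) ∧ (0 ≤ coordT x ∧ coordT x ≤ 1) := by
  constructor
  · rintro ⟨s, hs, t, ht, rfl⟩
    rw [coordS_comb, coordT_comb]; exact ⟨hs, ht⟩
  · rintro ⟨hs, ht⟩
    exact ⟨_, hs, _, ht, (comb_coord x).symm⟩

theorem isClosed_cell : IsClosed cell := by
  have : cell = (coordS ⁻¹' Set.Icc 0 1) ∩ (coordT ⁻¹' Set.Icc 0 1) := by
    ext x; rw [mem_cell_iff]; rfl
  rw [this]
  exact (isClosed_Icc.preimage continuous_coordS).inter (isClosed_Icc.preimage continuous_coordT)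

/-! ## The sites -/

theorem coordS_siteA : coordS siteA = 1 / 3 := by
  rw [siteA, smul_add, coordS_comb]

theorem coordT_siteA : coordT siteA = 1 / 3 := by
  rw [siteA, smul_add, coordT_comb]

theorem coordS_siteB : coordS siteB = 2 / 3 := by
  rw [siteB, smul_add, coordS_comb]

theorem coordT_siteB : coordT siteB = 2 / 3 := by
  rw [siteB, smul_add, coordT_comb]

theorem site_one {c : Plane} (hc : IsSite c) : c 1 = 0 := by
  rcases hc with rfl | rfl <;> simp [siteA, siteB]

theorem dist_sites_sq : dist siteA siteB ^ 2 = 1 / 3 := by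
  rw [dist_eq_norm, normSq_coord, coordS_siteA, coordS_siteB, coordT_siteA, coordT_siteB]
  norm_num

/-- The admissible radii. -/
def RadiusOK (r : ℝ) : Prop := 0 < r ∧ r < dist siteA siteB / 2

theorem RadiusOK.sq_lt {r : ℝ} (hr : RadiusOK r) : r ^ 2 < 1 / 12 := by
  have := dist_sites_sq
  have h0 := hr.1
  have h1 := hr.2
  nlinarith

/-- From s² + st + t² ≥ 3s²/4 and r² < 1/12 follows s² < 1/9. As the sites have coordinates 1/3 and
2/3, the closed discs stay in the open cell. -/
theorem abs_coord_sub_le {x c : Plane} {r : ℝ} (hr : RadiusOK r) (hx : x ∈ Metric.closedBall c r) :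
    |coordS x - coordS c| < 1 / 3 ∧ |coordT x - coordT c| < 1 / 3 := by
  have h1 := (power_nonpos_iff hr.1).2 hx
  rw [power, normSq_coord] at h1
  have h2 := hr.sq_lt
  constructor
  · refine abs_lt_of_sq_lt_sq ?_ (by norm_num)
    nlinarith [sq_nonneg (coordS x - coordS c + 2 * (coordT x - coordT c))]
  · refine abs_lt_of_sq_lt_sq ?_ (by norm_num)
    nlinarith [sq_nonneg (2 * (coordS x - coordS c) + (coordT x - coordT c))]

theorem coord_mem_Ioo {x c : Plane} {r : ℝ} (hr : RadiusOK r) (hc : IsSite c)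
    (hx : x ∈ Metric.closedBall c r) :
    (0 < coordS x ∧ coordS x < 1) ∧ (0 < coordT x ∧ coordT x < 1) := by
  obtain ⟨h1, h2⟩ := abs_coord_sub_le hr hx
  rw [abs_lt] at h1 h2
  rcases hc with rfl | rfl
  · rw [coordS_siteA] at h1; rw [coordT_siteA] at h2
    refine ⟨⟨?_, ?_⟩, ?_, ?_⟩ <;> linarith
  · rw [coordS_siteB] at h1; rw [coordT_siteB] at h2
    refine ⟨⟨?_, ?_⟩, ?_, ?_⟩ <;> linarith

theorem closedBall_site_subset_cell {c : Plane} {r : ℝ} (hr : RadiusOK r) (hc : IsSite c) :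
    Metric.closedBall c r ⊆ cell := by
  intro x hx
  obtain ⟨⟨h1, h2⟩, h3, h4⟩ := coord_mem_Ioo hr hc hx
  exact (mem_cell_iff x).2 ⟨⟨h1.le, h2.le⟩, h3.le, h4.le⟩

/-- The other centre. -/
def otherSite (c : Plane) : Plane := siteA + siteB - c

theorem IsSite.other {c : Plane} (hc : IsSite c) : IsSite (otherSite c) := by
  rcases hc with rfl | rfl
  · right; simp [otherSite]
  · left; simp [otherSite]

theorem otherSite_otherSite (c : Plane) : otherSite (otherSite c) = c := by
  simp [otherSite]

theorem otherSite_siteA : otherSite siteA = siteB := by simp [otherSite]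

theorem otherSite_siteB : otherSite siteB = siteA := by simp [otherSite]

theorem disjoint_closedBall_sites {c : Plane} {r : ℝ} (hr : RadiusOK r) (hc : IsSite c) :
    Disjoint (Metric.closedBall c r) (Metric.closedBall (otherSite c) r) := by
  have h := hr.2
  apply Metric.closedBall_disjoint_closedBall
  rcases hc with rfl | rfl
  · rw [otherSite_siteA]; linarith
  · rw [otherSite_siteB, dist_comm]; linarith

theorem interface_eq {c : Plane} (hc : IsSite c) (r : ℝ) :
    interface r = Metric.sphere c r ∪ Metric.sphere (otherSite c) r := by
  rcases hc with rfl | rfl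
  · rw [otherSite_siteA]; rfl
  · rw [otherSite_siteB, Set.union_comm]; rfl

theorem subdomain_zero_eq {c : Plane} (hc : IsSite c) (r : ℝ) :
    subdomain r 0 = Metric.ball c r ∪ Metric.ball (otherSite c) r := by
  rcases hc with rfl | rfl
  · rw [otherSite_siteA]; rfl
  · rw [otherSite_siteB, Set.union_comm]; rfl

theorem subdomain_one_eq {c : Plane} (hc : IsSite c) (r : ℝ) :
    subdomain r 1 = cell \ (Metric.ball c r ∪ Metric.ball (otherSite c) r) := by
  rw [← subdomain_zero_eq hc]; rfl

/-! ## Elements in lattice coordinates -/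

theorem meshSize_eq (N : ℕ) : meshSize N = 1 / N := by
  have : ‖v₁‖ ^ 2 = 1 := by
    rw [normSq_eq, v₁_zero, v₁_one]
    linear_combination 1 / 4 * sq_sqrt_three
  have h1 : ‖v₁‖ = 1 := by
    rwa [pow_eq_one_iff_of_nonneg (norm_nonneg _) two_ne_zero] at this
  rw [meshSize, h1]

theorem meshSize_pos {N : ℕ} (hN : 0 < N) : 0 < meshSize N := by
  rw [meshSize_eq]; positivity

theorem coordS_node (N i j : ℕ) : coordS (node N i j) = i / N := coordS_comb _ _

theorem coordT_node (N i j : ℕ) : coordT (node N i j) = j / N := coordT_comb _ _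

/-- The integer coordinates of the vertices of an element. -/
def vidx (d : Diagonal) {N : ℕ} (τ : ElemIndex N) : Fin 3 → ℕ × ℕ :=
  let i : ℕ := τ.1.1
  let j : ℕ := τ.1.2
  match d with
  | .short => ![![(i, j), (i + 1, j + 1)] τ.2, (i + 1, j), (i, j + 1)]
  | .long => ![(i, j), ![(i + 1, j), (i, j + 1)] τ.2, (i + 1, j + 1)]

theorem vertex_eq (d : Diagonal) (N : ℕ) (τ : ElemIndex N) (m : Fin 3) :
    vertex d N τ m = node N (vidx d τ m).1 (vidx d τ m).2 := by
  obtain ⟨⟨i, j⟩, ε⟩ := τ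
  cases d <;> fin_cases ε <;> fin_cases m <;> rfl

theorem elem_eq_tri (d : Diagonal) (N : ℕ) (τ : ElemIndex N) :
    elem d N τ = tri (vertex d N τ 0) (vertex d N τ 1) (vertex d N τ 2) :=
  convexHull_range_eq_tri _

theorem vidx_bounds (d : Diagonal) {N : ℕ} (τ : ElemIndex N) (m : Fin 3) :
    ((vidx d τ m).1 = τ.1.1 ∨ (vidx d τ m).1 = τ.1.1 + 1) ∧
    ((vidx d τ m).2 = τ.1.2 ∨ (vidx d τ m).2 = τ.1.2 + 1) := by
  obtain ⟨⟨i, j⟩, ε⟩ := τ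
  cases d <;> fin_cases ε <;> fin_cases m <;> simp [vidx]

/-- Both triangulations fall under one shape class: short diagonals give sides h, h, h and long ones
h, h, √3 h, with equal areas. In lattice units the squared sides are 1 or 3 and the determinant is
±1. -/
theorem regularTri_nodes {N : ℕ} (hN : 0 < N) {p q p' q' p'' q'' : ℕ}
    (s1 : ((p' : ℝ) - p) ^ 2 + ((q' : ℝ) - q) ^ 2 + ((p' : ℝ) - p) * ((q' : ℝ) - q) = 1 ∨
      ((p' : ℝ) - p) ^ 2 + ((q' : ℝ) - q) ^ 2 + ((p' : ℝ) - p) * ((q' : ℝ) - q) = 3)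
    (s2 : ((p'' : ℝ) - p') ^ 2 + ((q'' : ℝ) - q') ^ 2 + ((p'' : ℝ) - p') * ((q'' : ℝ) - q') = 1 ∨
      ((p'' : ℝ) - p') ^ 2 + ((q'' : ℝ) - q') ^ 2 + ((p'' : ℝ) - p') * ((q'' : ℝ) - q') = 3)
    (s3 : ((p'' : ℝ) - p) ^ 2 + ((q'' : ℝ) - q) ^ 2 + ((p'' : ℝ) - p) * ((q'' : ℝ) - q) = 1 ∨
      ((p'' : ℝ) - p) ^ 2 + ((q'' : ℝ) - q) ^ 2 + ((p'' : ℝ) - p) * ((q'' : ℝ) - q) = 3)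
    (hd : (((p' : ℝ) - p) * ((q'' : ℝ) - q) - ((q' : ℝ) - q) * ((p'' : ℝ) - p)) ^ 2 = 1) :
    RegularTri (meshSize N) (node N p q) (node N p' q') (node N p'' q'') := by
  have hN' : (0 : ℝ) < N := by exact_mod_cast hN
  have hh : (0 : ℝ) < (1 / N) ^ 2 := by positivity
  have hs : ∀ p q p' q' : ℕ, ‖node N p' q' - node N p q‖ ^ 2 =
      (((p' : ℝ) - p) ^ 2 + ((q' : ℝ) - q) ^ 2 + ((p' : ℝ) - p) * ((q' : ℝ) - q)) *
        (1 / N) ^ 2 := by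
    intro p q p' q'
    rw [normSq_coord]; simp only [coordS_node, coordT_node]; ring
  refine ⟨meshSize_pos hN, ?_, ?_, ?_, ?_, ?_, ?_, ?_⟩ <;> rw [meshSize_eq]
  · rw [hs]; rcases s1 with s1 | s1 <;> rw [s1] <;> linarith
  · rw [hs]; rcases s1 with s1 | s1 <;> rw [s1] <;> linarith
  · rw [hs]; rcases s2 with s1 | s1 <;> rw [s1] <;> linarith
  · rw [hs]; rcases s2 with s1 | s1 <;> rw [s1] <;> linarith
  · rw [hs]; rcases s3 with s1 | s1 <;> rw [s1] <;> linarith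
  · rw [hs]; rcases s3 with s1 | s1 <;> rw [s1] <;> linarith
  · rw [det2_coord]; simp only [coordS_node, coordT_node]
    rw [mul_pow, neg_sq, div_pow, sq_sqrt_three]
    linear_combination 3 / 4 * (1 / N) ^ 4 * hd

theorem regularTri_vertex (d : Diagonal) {N : ℕ} (hN : 0 < N) (τ : ElemIndex N) :
    RegularTri (meshSize N) (vertex d N τ 0) (vertex d N τ 1) (vertex d N τ 2) := by
  rw [vertex_eq, vertex_eq, vertex_eq]
  obtain ⟨⟨i, j⟩, ε⟩ := τ
  cases d <;> fin_cases ε <;> simp only [vidx] <;> apply regularTri_nodes hN <;>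
    simp <;> norm_num

/-- The closed inequalities that describe an element in (scaled) lattice coordinates. -/
def ElemIneq (d : Diagonal) {N : ℕ} (τ : ElemIndex N) (a b : ℝ) : Prop :=
  let i : ℝ := (τ.1.1 : ℕ)
  let j : ℝ := (τ.1.2 : ℕ)
  match d with
  | .short => ![i ≤ a ∧ j ≤ b ∧ a + b ≤ i + j + 1,
      a ≤ i + 1 ∧ b ≤ j + 1 ∧ i + j + 1 ≤ a + b] τ.2
  | .long => ![j ≤ b ∧ b - j ≤ a - i ∧ a ≤ i + 1, i ≤ a ∧ a - i ≤ b - j ∧ b ≤ j + 1] τ.2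

theorem mem_tri_nodes {N : ℕ} (hN : 0 < N) {p q p' q' p'' q'' : ℕ} (x : Plane) :
    x ∈ tri (node N p q) (node N p' q') (node N p'' q'') ↔
      ∃ a b e : ℝ, 0 ≤ a ∧ 0 ≤ b ∧ 0 ≤ e ∧ a + b + e = 1 ∧
        N * coordS x = a * p + b * p' + e * p'' ∧ N * coordT x = a * q + b * q' + e * q'' := by
  have hN' : (N : ℝ) ≠ 0 := by positivity
  constructor
  · rintro ⟨a, b, e, ha, hb, he, hs, rfl⟩
    refine ⟨a, b, e, ha, hb, he, hs, ?_, ?_⟩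
    · rw [coordS_add_smul]; simp only [coordS_node]; field_simp
    · rw [coordT_add_smul]; simp only [coordT_node]; field_simp
  · rintro ⟨a, b, e, ha, hb, he, hs, h1, h2⟩
    refine ⟨a, b, e, ha, hb, he, hs, coord_ext ?_ ?_⟩
    · rw [coordS_add_smul]; simp only [coordS_node]; field_simp; linarith
    · rw [coordT_add_smul]; simp only [coordT_node]; field_simp; linarith

theorem mem_elem_iff (d : Diagonal) {N : ℕ} (hN : 0 < N) (τ : ElemIndex N) (x : Plane) :
    x ∈ elem d N τ ↔ ElemIneq d τ (N * coordS x) (N * coordT x) := by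
  rw [elem_eq_tri, vertex_eq, vertex_eq, vertex_eq, mem_tri_nodes hN]
  obtain ⟨⟨i, j⟩, ε⟩ := τ
  generalize N * coordS x = a
  generalize N * coordT x = b
  cases d <;> fin_cases ε <;> simp only [vidx, ElemIneq] <;> simp
  · constructor
    · rintro ⟨u, hu, v, hv, w, hw, hs, rfl, rfl⟩
      refine ⟨?_, ?_, ?_⟩ <;> nlinarith
    · rintro ⟨h1, h2, h3⟩
      exact ⟨1 - (a - i) - (b - j), by linarith, a - i, by linarith, b - j, by linarith, by ring,
        by ring, by ring⟩
  · constructor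
    · rintro ⟨u, hu, v, hv, w, hw, hs, rfl, rfl⟩
      refine ⟨?_, ?_, ?_⟩ <;> nlinarith
    · rintro ⟨h1, h2, h3⟩
      exact ⟨a - i + (b - j) - 1, by linarith, 1 - (b - j), by linarith, 1 - (a - i), by linarith,
        by ring, by ring, by ring⟩
  · constructor
    · rintro ⟨u, hu, v, hv, w, hw, hs, rfl, rfl⟩
      refine ⟨?_, ?_, ?_⟩ <;> nlinarith
    · rintro ⟨h1, h2, h3⟩
      exact ⟨1 - (a - i), by linarith, a - i - (b - j), by linarith, b - j, by linarith,
        by ring, by ring, by ring⟩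
  · constructor
    · rintro ⟨u, hu, v, hv, w, hw, hs, rfl, rfl⟩
      refine ⟨?_, ?_, ?_⟩ <;> nlinarith
    · rintro ⟨h1, h2, h3⟩
      exact ⟨1 - (b - j), by linarith, b - j - (a - i), by linarith, a - i, by linarith,
        by ring, by ring, by ring⟩

end UnfittedNitsche
end

noncomputable section
namespace UnfittedNitsche

/-! ## Elements with labelled vertices -/

/-- `A`, `B`, `C` are the vertices of the element `τ`, in some order. -/
inductive IsElem (d : Diagonal) (N : ℕ) (τ : ElemIndex N) : Plane → Plane → Plane → Prop
  | base : IsElem d N τ (vertex d N τ 0) (vertex d N τ 1) (vertex d N τ 2)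
  | rotate {A B C : Plane} : IsElem d N τ A B C → IsElem d N τ B C A
  | swap {A B C : Plane} : IsElem d N τ A B C → IsElem d N τ A C B

namespace IsElem

variable {d : Diagonal} {N : ℕ} {τ : ElemIndex N} {A B C : Plane}

theorem elem_eq (H : IsElem d N τ A B C) : elem d N τ = tri A B C := by
  induction H with
  | base => exact elem_eq_tri d N τ
  | rotate _ ih => rw [ih, tri_rotate]
  | swap _ ih => rw [ih, tri_swap]

theorem regular (hN : 0 < N) (H : IsElem d N τ A B C) : RegularTri (meshSize N) A B C := by
  induction H with
  | base => exact regularTri_vertex d hN τ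
  | rotate _ ih => exact ih.rotate
  | swap _ ih => exact ih.swap

theorem mem_range (H : IsElem d N τ A B C) : A ∈ Set.range (vertex d N τ) ∧
    B ∈ Set.range (vertex d N τ) ∧ C ∈ Set.range (vertex d N τ) := by
  induction H with
  | base => exact ⟨⟨0, rfl⟩, ⟨1, rfl⟩, ⟨2, rfl⟩⟩
  | rotate _ ih => exact ⟨ih.2.1, ih.2.2, ih.1⟩
  | swap _ ih => exact ⟨ih.1, ih.2.2, ih.2.1⟩

theorem cases_base (H : IsElem d N τ A B C) :
    (A = vertex d N τ 0 ∧ B = vertex d N τ 1 ∧ C = vertex d N τ 2) ∨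
    (A = vertex d N τ 1 ∧ B = vertex d N τ 2 ∧ C = vertex d N τ 0) ∨
    (A = vertex d N τ 2 ∧ B = vertex d N τ 0 ∧ C = vertex d N τ 1) ∨
    (A = vertex d N τ 0 ∧ B = vertex d N τ 2 ∧ C = vertex d N τ 1) ∨
    (A = vertex d N τ 2 ∧ B = vertex d N τ 1 ∧ C = vertex d N τ 0) ∨
    (A = vertex d N τ 1 ∧ B = vertex d N τ 0 ∧ C = vertex d N τ 2) := by
  induction H with
  | base => simp
  | rotate _ ih =>
    rcases ih with h | h | h | h | h | h <;> simp only [h.1, h.2.1, h.2.2, and_self, true_or, or_true]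
  | swap _ ih =>
    rcases ih with h | h | h | h | h | h <;> simp only [h.1, h.2.1, h.2.2, and_self, true_or, or_true]

theorem of_cases (h : (A = vertex d N τ 0 ∧ B = vertex d N τ 1 ∧ C = vertex d N τ 2) ∨
    (A = vertex d N τ 1 ∧ B = vertex d N τ 2 ∧ C = vertex d N τ 0) ∨
    (A = vertex d N τ 2 ∧ B = vertex d N τ 0 ∧ C = vertex d N τ 1)) : IsElem d N τ A B C := by
  rcases h with ⟨rfl, rfl, rfl⟩ | ⟨rfl, rfl, rfl⟩ | ⟨rfl, rfl, rfl⟩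
  · exact .base
  · exact .rotate .base
  · exact .rotate (.rotate .base)

theorem of_range (d : Diagonal) (N : ℕ) (τ : ElemIndex N) {V : Plane}
    (hV : V ∈ Set.range (vertex d N τ)) : ∃ B C, IsElem d N τ V B C := by
  obtain ⟨m, rfl⟩ := hV
  fin_cases m
  · exact ⟨_, _, .base⟩
  · exact ⟨_, _, .rotate .base⟩
  · exact ⟨_, _, .rotate (.rotate .base)⟩

end IsElem

theorem ElemIneq.mem_unit {d : Diagonal} {N : ℕ} {τ : ElemIndex N} {a b : ℝ}
    (h : ElemIneq d τ a b) : ((τ.1.1 : ℕ) : ℝ) ≤ a ∧ a ≤ (τ.1.1 : ℕ) + 1 ∧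
      ((τ.1.2 : ℕ) : ℝ) ≤ b ∧ b ≤ (τ.1.2 : ℕ) + 1 := by
  obtain ⟨⟨i, j⟩, ε⟩ := τ
  cases d <;> fin_cases ε <;> simp [ElemIneq] at h ⊢ <;> refine ⟨?_, ?_, ?_, ?_⟩ <;> linarith

theorem elem_subset_cell (d : Diagonal) {N : ℕ} (hN : 0 < N) (τ : ElemIndex N) :
    elem d N τ ⊆ cell := by
  intro x hx
  have hN' : (0 : ℝ) < N := by exact_mod_cast hN
  obtain ⟨h1, h2, h3, h4⟩ := ((mem_elem_iff d hN τ x).1 hx).mem_unit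
  have hi : ((τ.1.1 : ℕ) : ℝ) + 1 ≤ N := by exact_mod_cast τ.1.1.2
  have hj : ((τ.1.2 : ℕ) : ℝ) + 1 ≤ N := by exact_mod_cast τ.1.2.2
  have hi0 : (0 : ℝ) ≤ (τ.1.1 : ℕ) := Nat.cast_nonneg _
  have hj0 : (0 : ℝ) ≤ (τ.1.2 : ℕ) := Nat.cast_nonneg _
  rw [mem_cell_iff]
  refine ⟨⟨?_, ?_⟩, ?_, ?_⟩
  · exact nonneg_of_mul_nonneg_right (by linarith) hN'
  · exact le_of_mul_le_mul_left (by linarith) hN'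
  · exact nonneg_of_mul_nonneg_right (by linarith) hN'
  · exact le_of_mul_le_mul_left (by linarith) hN'

/-- The reflection of an element in the midpoint of a side that is not contained in the boundary
of the cell is an element. -/
theorem exists_neighbour {d : Diagonal} {N : ℕ} (hN : 0 < N) {τ : ElemIndex N} {A B C : Plane}
    (H : IsElem d N τ A B C) {P : Plane} (hP : P ∈ segment ℝ A B)
    (hS : 0 < coordS P ∧ coordS P < 1) (hT : 0 < coordT P ∧ coordT P < 1) :
    ∃ τ', IsElem d N τ' A B (A + B - C) := by
  have hN' : (0 : ℝ) < N := by exact_mod_cast hN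
  -- Only the three cyclic labellings are treated here. The others arise by exchanging A and B,
  -- which does not change A + B − C. An axis-parallel side (in lattice coordinates) that contains P
  -- cannot lie on the boundary of the cell, so the index shift to the adjacent sub-rhombus is
  -- legitimate.
  have main : ∀ (i j : Fin N) (ε : Fin 2) {A B C : Plane} (hABC :
      (A = vertex d N ((i, j), ε) 0 ∧ B = vertex d N ((i, j), ε) 1 ∧
        C = vertex d N ((i, j), ε) 2) ∨
      (A = vertex d N ((i, j), ε) 1 ∧ B = vertex d N ((i, j), ε) 2 ∧
        C = vertex d N ((i, j), ε) 0) ∨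
      (A = vertex d N ((i, j), ε) 2 ∧ B = vertex d N ((i, j), ε) 0 ∧
        C = vertex d N ((i, j), ε) 1)) (hP : P ∈ segment ℝ A B),
      ∃ τ', IsElem d N τ' A B (A + B - C) := by
    intro i j ε A B C hABC hP
    obtain ⟨a, b, ha, hb, hs, rfl⟩ := hP
    have eS : coordS (a • A + b • B) = a * coordS A + b * coordS B := by
      simpa using coordS_add_smul a b 0 A B 0
    have eT : coordT (a • A + b • B) = a * coordT A + b * coordT B := by
      simpa using coordT_add_smul a b 0 A B 0
    rw [eS] at hS
    rw [eT] at hT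
    have pt : ∀ p q p' q' p'' q'' p₃ q₃ : ℕ, p + p' = p'' + p₃ → q + q' = q'' + q₃ →
        node N p q + node N p' q' - node N p'' q'' = node N p₃ q₃ := by
      intro p q p' q' p'' q'' p₃ q₃ h1 h2
      have h1' : (p : ℝ) + p' = p'' + p₃ := by exact_mod_cast h1
      have h2' : (q : ℝ) + q' = q'' + q₃ := by exact_mod_cast h2
      rw [show node N p q + node N p' q' - node N p'' q'' =
        (1 : ℝ) • node N p q + (1 : ℝ) • node N p' q' + (-1 : ℝ) • node N p'' q'' by module]
      apply coord_ext
      · rw [coordS_add_smul]; simp only [coordS_node]; field_simp; linarith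
      · rw [coordT_add_smul]; simp only [coordT_node]; field_simp; linarith
    simp only [vertex_eq] at hABC
    have hi := i.2
    have hj := j.2
    -- an edge on the line `coordS = p / N` or `coordT = q / N` inside the cell
    have edgeS : ∀ p q q' : ℕ, A = node N p q → B = node N p q' → 0 < p ∧ p < N := by
      rintro p q q' rfl rfl
      simp only [coordS_node] at hS
      rw [← add_mul, hs, one_mul, div_lt_one hN'] at hS
      constructor
      · rcases Nat.eq_zero_or_pos p with h | h
        · subst h; simp at hS
        · exact h
      · exact_mod_cast hS.2
    have edgeT : ∀ q p p' : ℕ, A = node N p q → B = node N p' q → 0 < q ∧ q < N := by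
      rintro q p p' rfl rfl
      simp only [coordT_node] at hT
      rw [← add_mul, hs, one_mul, div_lt_one hN'] at hT
      constructor
      · rcases Nat.eq_zero_or_pos q with h | h
        · subst h; simp at hT
        · exact h
      · exact_mod_cast hT.2
    obtain ⟨i, hi'⟩ := i
    obtain ⟨j, hj'⟩ := j
    cases d <;> fin_cases ε <;> simp only [vidx] at hABC <;> simp at hABC <;>
      rcases hABC with ⟨hA, hB, hC⟩ | ⟨hA, hB, hC⟩ | ⟨hA, hB, hC⟩
    · obtain ⟨h0, h1⟩ := edgeT _ _ _ hA hB
      obtain ⟨j, rfl⟩ := Nat.exists_eq_succ_of_ne_zero h0.ne'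
      refine ⟨((⟨i, by omega⟩, ⟨j, by omega⟩), 1), IsElem.of_cases ?_⟩
      simp only [vertex_eq, vidx]
      rw [hA, hB, hC, pt _ _ _ _ _ _ (i + 1) (j) (by omega) (by omega)]
      right; right
      simp
    · refine ⟨((⟨i, by omega⟩, ⟨j, by omega⟩), 1), IsElem.of_cases ?_⟩
      simp only [vertex_eq, vidx]
      rw [hA, hB, hC, pt _ _ _ _ _ _ (i + 1) (j + 1) (by omega) (by omega)]
      right; left
      simp
    · obtain ⟨h0, h1⟩ := edgeS _ _ _ hA hB
      obtain ⟨i, rfl⟩ := Nat.exists_eq_succ_of_ne_zero h0.ne'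
      refine ⟨((⟨i, by omega⟩, ⟨j, by omega⟩), 1), IsElem.of_cases ?_⟩
      simp only [vertex_eq, vidx]
      rw [hA, hB, hC, pt _ _ _ _ _ _ (i) (j + 1) (by omega) (by omega)]
      left
      simp
    · obtain ⟨h0, h1⟩ := edgeS _ _ _ hA hB
      refine ⟨((⟨i + 1, by omega⟩, ⟨j, by omega⟩), 0), IsElem.of_cases ?_⟩
      simp only [vertex_eq, vidx]
      rw [hA, hB, hC, pt _ _ _ _ _ _ (i + 2) (j) (by omega) (by omega)]
      right; right
      simp
    · refine ⟨((⟨i, by omega⟩, ⟨j, by omega⟩), 0), IsElem.of_cases ?_⟩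
      simp only [vertex_eq, vidx]
      rw [hA, hB, hC, pt _ _ _ _ _ _ (i) (j) (by omega) (by omega)]
      right; left
      simp
    · obtain ⟨h0, h1⟩ := edgeT _ _ _ hA hB
      refine ⟨((⟨i, by omega⟩, ⟨j + 1, by omega⟩), 0), IsElem.of_cases ?_⟩
      simp only [vertex_eq, vidx]
      rw [hA, hB, hC, pt _ _ _ _ _ _ (i) (j + 2) (by omega) (by omega)]
      left
      simp
    · obtain ⟨h0, h1⟩ := edgeT _ _ _ hA hB
      obtain ⟨j, rfl⟩ := Nat.exists_eq_succ_of_ne_zero h0.ne'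
      refine ⟨((⟨i, by omega⟩, ⟨j, by omega⟩), 1), IsElem.of_cases ?_⟩
      simp only [vertex_eq, vidx]
      rw [hA, hB, hC, pt _ _ _ _ _ _ (i) (j) (by omega) (by omega)]
      right; left
      simp
    · obtain ⟨h0, h1⟩ := edgeS _ _ _ hA hB
      refine ⟨((⟨i + 1, by omega⟩, ⟨j, by omega⟩), 1), IsElem.of_cases ?_⟩
      simp only [vertex_eq, vidx]
      rw [hA, hB, hC, pt _ _ _ _ _ _ (i + 2) (j + 1) (by omega) (by omega)]
      left
      simp
    · refine ⟨((⟨i, by omega⟩, ⟨j, by omega⟩), 1), IsElem.of_cases ?_⟩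
      simp only [vertex_eq, vidx]
      rw [hA, hB, hC, pt _ _ _ _ _ _ (i) (j + 1) (by omega) (by omega)]
      right; right
      simp
    · obtain ⟨h0, h1⟩ := edgeS _ _ _ hA hB
      obtain ⟨i, rfl⟩ := Nat.exists_eq_succ_of_ne_zero h0.ne'
      refine ⟨((⟨i, by omega⟩, ⟨j, by omega⟩), 0), IsElem.of_cases ?_⟩
      simp only [vertex_eq, vidx]
      rw [hA, hB, hC, pt _ _ _ _ _ _ (i) (j) (by omega) (by omega)]
      right; left
      simp
    · obtain ⟨h0, h1⟩ := edgeT _ _ _ hA hB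
      refine ⟨((⟨i, by omega⟩, ⟨j + 1, by omega⟩), 0), IsElem.of_cases ?_⟩
      simp only [vertex_eq, vidx]
      rw [hA, hB, hC, pt _ _ _ _ _ _ (i + 1) (j + 2) (by omega) (by omega)]
      left
      simp
    · refine ⟨((⟨i, by omega⟩, ⟨j, by omega⟩), 0), IsElem.of_cases ?_⟩
      simp only [vertex_eq, vidx]
      rw [hA, hB, hC, pt _ _ _ _ _ _ (i + 1) (j) (by omega) (by omega)]
      right; right
      simp
  obtain ⟨⟨i, j⟩, ε⟩ := τ
  rcases H.cases_base with h | h | h | ⟨h1, h2, h3⟩ | ⟨h1, h2, h3⟩ | ⟨h1, h2, h3⟩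
  · exact main i j ε (.inl h) hP
  · exact main i j ε (.inr (.inl h)) hP
  · exact main i j ε (.inr (.inr h)) hP
  all_goals
    rw [segment_symm] at hP
    rw [add_comm]
  · obtain ⟨τ', h⟩ := main i j ε (.inr (.inr ⟨h2, h1, h3⟩)) hP
    exact ⟨τ', h.rotate.swap⟩
  · obtain ⟨τ', h⟩ := main i j ε (.inr (.inl ⟨h2, h1, h3⟩)) hP
    exact ⟨τ', h.rotate.swap⟩
  · obtain ⟨τ', h⟩ := main i j ε (.inl ⟨h2, h1, h3⟩) hP
    exact ⟨τ', h.rotate.swap⟩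

/-! ## Covering and disjointness -/

/-- The floor serves except at the right end a = N, where the last interval must be taken. -/
theorem exists_floor_unit {N : ℕ} (hN : 0 < N) {a : ℝ} (h0 : 0 ≤ a) (h1 : a ≤ N) :
    ∃ i : Fin N, ((i : ℕ) : ℝ) ≤ a ∧ a ≤ (i : ℕ) + 1 := by
  rcases h1.lt_or_eq with h | h
  · have hf : ⌊a⌋₊ < N := (Nat.floor_lt h0).2 h
    exact ⟨⟨_, hf⟩, Nat.floor_le h0, (Nat.lt_floor_add_one a).le⟩
  · obtain ⟨M, rfl⟩ := Nat.exists_eq_succ_of_ne_zero hN.ne'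
    refine ⟨⟨M, by omega⟩, ?_, ?_⟩ <;> rw [h] <;> push_cast <;> linarith

theorem exists_elem_of_mem_cell (d : Diagonal) {N : ℕ} (hN : 0 < N) {x : Plane} (hx : x ∈ cell) :
    ∃ τ : ElemIndex N, x ∈ elem d N τ := by
  have hN' : (0 : ℝ) < N := by exact_mod_cast hN
  obtain ⟨⟨h1, h2⟩, h3, h4⟩ := (mem_cell_iff x).1 hx
  obtain ⟨i, hi1, hi2⟩ := exists_floor_unit hN (a := N * coordS x) (by positivity) (by nlinarith)
  obtain ⟨j, hj1, hj2⟩ := exists_floor_unit hN (a := N * coordT x) (by positivity) (by nlinarith)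
  simp only [mem_elem_iff d hN]
  generalize N * coordS x = a at *
  generalize N * coordT x = b at *
  cases d
  · rcases le_total (a + b) (i + j + 1) with h | h
    · exact ⟨((i, j), 0), hi1, hj1, h⟩
    · exact ⟨((i, j), 1), hi2, hj2, h⟩
  · rcases le_total (b - j) (a - i) with h | h
    · exact ⟨((i, j), 0), hj1, h, hi2⟩
    · exact ⟨((i, j), 1), hi1, h, hj2⟩

/-- The distance h/8 keeps both scaled coordinates within 1/4 of the node. Of the four corners of
the sub-rhombus containing x, only vertices of the triangle containing x are that close. -/
theorem exists_elem_near_node (d : Diagonal) {N : ℕ} (hN : 0 < N) {p q : ℕ} {x : Plane}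
    (hx : x ∈ cell) (hd : ‖x - node N p q‖ ≤ meshSize N / 8) :
    ∃ τ : ElemIndex N, x ∈ elem d N τ ∧ node N p q ∈ Set.range (vertex d N τ) := by
  have hN' : (0 : ℝ) < N := by exact_mod_cast hN
  obtain ⟨⟨h1, h2⟩, h3, h4⟩ := (mem_cell_iff x).1 hx
  obtain ⟨i, hi1, hi2⟩ := exists_floor_unit hN (a := N * coordS x) (by positivity) (by nlinarith)
  obtain ⟨j, hj1, hj2⟩ := exists_floor_unit hN (a := N * coordT x) (by positivity) (by nlinarith)
  have hsq : ‖x - node N p q‖ ^ 2 ≤ (meshSize N / 8) ^ 2 :=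
    pow_le_pow_left₀ (norm_nonneg _) hd 2
  rw [normSq_coord, coordS_node, coordT_node, meshSize_eq] at hsq
  simp only [mem_elem_iff d hN]
  have hsq' : (N * coordS x - p) ^ 2 + (N * coordT x - q) ^ 2 +
      (N * coordS x - p) * (N * coordT x - q) ≤ 1 / 64 := by
    have := mul_le_mul_of_nonneg_left hsq (by positivity : (0 : ℝ) ≤ N ^ 2)
    field_simp at this ⊢
    linarith
  generalize N * coordS x = a at *
  generalize N * coordT x = b at *
  have ha : |a - p| < 1 / 4 := by
    refine abs_lt_of_sq_lt_sq ?_ (by norm_num)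
    nlinarith [sq_nonneg (a - p + 2 * (b - q))]
  have hb : |b - q| < 1 / 4 := by
    refine abs_lt_of_sq_lt_sq ?_ (by norm_num)
    nlinarith [sq_nonneg (2 * (a - p) + (b - q))]
  rw [abs_lt] at ha hb
  have hp : p = i ∨ p = i + 1 := by
    have e1 : (p : ℝ) < (i : ℕ) + 2 := by linarith
    have e2 : ((i : ℕ) : ℝ) < p + 1 := by linarith
    have e1' : p < (i : ℕ) + 2 := by exact_mod_cast e1
    have e2' : (i : ℕ) < p + 1 := by exact_mod_cast e2
    omega
  have hq : q = j ∨ q = j + 1 := by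
    have e1 : (q : ℝ) < (j : ℕ) + 2 := by linarith
    have e2 : ((j : ℕ) : ℝ) < q + 1 := by linarith
    have e1' : q < (j : ℕ) + 2 := by exact_mod_cast e1
    have e2' : (j : ℕ) < q + 1 := by exact_mod_cast e2
    omega
  cases d
  · rcases le_total (a + b) (i + j + 1) with h | h
    · refine ⟨((i, j), 0), ⟨hi1, hj1, h⟩, ?_⟩
      rcases hp with rfl | rfl <;> rcases hq with rfl | rfl
      · exact ⟨0, rfl⟩
      · exact ⟨2, rfl⟩
      · exact ⟨1, rfl⟩
      · push_cast at *; linarith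
    · refine ⟨((i, j), 1), ⟨hi2, hj2, h⟩, ?_⟩
      rcases hp with rfl | rfl <;> rcases hq with rfl | rfl
      · linarith
      · exact ⟨2, rfl⟩
      · exact ⟨1, rfl⟩
      · exact ⟨0, rfl⟩
  · rcases le_total (b - j) (a - i) with h | h
    · refine ⟨((i, j), 0), ⟨hj1, h, hi2⟩, ?_⟩
      rcases hp with rfl | rfl <;> rcases hq with rfl | rfl
      · exact ⟨0, rfl⟩
      · push_cast at *; linarith
      · exact ⟨1, rfl⟩
      · exact ⟨2, rfl⟩
    · refine ⟨((i, j), 1), ⟨hi1, h, hj2⟩, ?_⟩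
      rcases hp with rfl | rfl <;> rcases hq with rfl | rfl
      · exact ⟨0, rfl⟩
      · exact ⟨1, rfl⟩
      · push_cast at *; linarith
      · exact ⟨2, rfl⟩

/-- Interiors of distinct elements are disjoint. -/
theorem disjoint_interior_elem (d : Diagonal) {N : ℕ} (hN : 0 < N) {τ τ' : ElemIndex N}
    (hne : τ ≠ τ') : Disjoint (interior (elem d N τ)) (interior (elem d N τ')) := by
  have strict : ∀ (τ : ElemIndex N) (x : Plane), x ∈ interior (elem d N τ) →
      ((τ.1.1 : ℕ) : ℝ) < N * coordS x ∧ N * coordS x < (τ.1.1 : ℕ) + 1 ∧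
      ((τ.1.2 : ℕ) : ℝ) < N * coordT x ∧ N * coordT x < (τ.1.2 : ℕ) + 1 ∧
      (match d with
        | .short => ![N * coordS x + N * coordT x < (τ.1.1 : ℕ) + (τ.1.2 : ℕ) + 1,
            ((τ.1.1 : ℕ) : ℝ) + (τ.1.2 : ℕ) + 1 < N * coordS x + N * coordT x] τ.2
        | .long => ![N * coordT x - (τ.1.2 : ℕ) < N * coordS x - (τ.1.1 : ℕ),
            N * coordS x - (τ.1.1 : ℕ) < N * coordT x - (τ.1.2 : ℕ)] τ.2) := by
    intro τ x hx
    have T := regularTri_vertex d hN τ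
    rw [elem_eq_tri, T.mem_interior_iff] at hx
    have hN' : (N : ℝ) ≠ 0 := by positivity
    have hrec := T.bary_rec x
    have hsum := T.bary_sum x
    obtain ⟨ha, hb, he⟩ := hx
    generalize bary (vertex d N τ 1) (vertex d N τ 2) (vertex d N τ 0) x = a at *
    generalize bary (vertex d N τ 2) (vertex d N τ 0) (vertex d N τ 1) x = b at *
    generalize bary (vertex d N τ 0) (vertex d N τ 1) (vertex d N τ 2) x = e at *
    have hS : N * coordS x = a * (vidx d τ 0).1 + b * (vidx d τ 1).1 + e * (vidx d τ 2).1 := by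
      rw [hrec, coordS_add_smul, vertex_eq, vertex_eq, vertex_eq]
      simp only [coordS_node]; field_simp
    have hT : N * coordT x = a * (vidx d τ 0).2 + b * (vidx d τ 1).2 + e * (vidx d τ 2).2 := by
      rw [hrec, coordT_add_smul, vertex_eq, vertex_eq, vertex_eq]
      simp only [coordT_node]; field_simp
    rw [hS, hT]
    clear hS hT hrec T
    obtain ⟨⟨i, j⟩, ε⟩ := τ
    obtain rfl : a = 1 - b - e := by linarith
    cases d <;> fin_cases ε <;> simp [vidx] <;> refine ⟨?_, ?_, ?_, ?_, ?_⟩ <;> nlinarith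
  rw [Set.disjoint_left]
  intro x hx hx'
  obtain ⟨a1, a2, a3, a4, a5⟩ := strict τ x hx
  obtain ⟨b1, b2, b3, b4, b5⟩ := strict τ' x hx'
  obtain ⟨⟨i, j⟩, ε⟩ := τ
  obtain ⟨⟨i', j'⟩, ε'⟩ := τ'
  have hi : i = i' := by
    have e1 : ((i : ℕ) : ℝ) < (i' : ℕ) + 1 := by simp at *; linarith
    have e2 : ((i' : ℕ) : ℝ) < (i : ℕ) + 1 := by simp at *; linarith
    have e1' : (i : ℕ) < i' + 1 := by exact_mod_cast e1
    have e2' : (i' : ℕ) < i + 1 := by exact_mod_cast e2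
    exact Fin.ext (by omega)
  have hj : j = j' := by
    have e1 : ((j : ℕ) : ℝ) < (j' : ℕ) + 1 := by simp at *; linarith
    have e2 : ((j' : ℕ) : ℝ) < (j : ℕ) + 1 := by simp at *; linarith
    have e1' : (j : ℕ) < j' + 1 := by exact_mod_cast e1
    have e2' : (j' : ℕ) < j + 1 := by exact_mod_cast e2
    exact Fin.ext (by omega)
  subst hi hj
  have hε : ε ≠ ε' := fun h => hne (by rw [h])
  cases d <;> fin_cases ε <;> fin_cases ε' <;> simp at hε a5 b5 <;> linarith

open Classical in
/-- The elements around a point. -/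
def vertexStar (d : Diagonal) (N : ℕ) (V : Plane) : Finset (ElemIndex N) :=
  Finset.univ.filter fun τ => V ∈ Set.range (vertex d N τ)

theorem mem_vertexStar {d : Diagonal} {N : ℕ} {V : Plane} {τ : ElemIndex N} :
    τ ∈ vertexStar d N V ↔ V ∈ Set.range (vertex d N τ) := by simp [vertexStar]

theorem card_vertexStar_le (d : Diagonal) {N : ℕ} (hN : 0 < N) (V : Plane) :
    (vertexStar d N V).card ≤ 8 := by
  by_cases hne : (vertexStar d N V).Nonempty
  swap
  · rw [Finset.not_nonempty_iff_eq_empty.1 hne]; simp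
  obtain ⟨τ₀, h₀⟩ := hne
  obtain ⟨m₀, rfl⟩ := mem_vertexStar.1 h₀
  rw [vertex_eq]
  generalize (vidx d τ₀ m₀).1 = p
  generalize (vidx d τ₀ m₀).2 = q
  have key : ∀ τ ∈ vertexStar d N (node N p q), ((τ.1.1 : ℕ) = p ∨ (τ.1.1 : ℕ) + 1 = p) ∧
      ((τ.1.2 : ℕ) = q ∨ (τ.1.2 : ℕ) + 1 = q) := by
    intro τ hτ
    obtain ⟨m, hm⟩ := mem_vertexStar.1 hτ
    rw [vertex_eq] at hm
    have hN' : (N : ℝ) ≠ 0 := by positivity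
    have e1 := congrArg coordS hm
    have e2 := congrArg coordT hm
    rw [coordS_node, coordS_node, div_left_inj' hN', Nat.cast_inj] at e1
    rw [coordT_node, coordT_node, div_left_inj' hN', Nat.cast_inj] at e2
    have := vidx_bounds d τ m
    rw [e1, e2] at this
    omega
  -- An element at the node is determined by which corner of its sub-rhombus the node is and by the
  -- choice of triangle: 2 · 2 · 2 codes.
  let φ : ElemIndex N → (Bool × Bool) × Fin 2 :=
    fun τ => ((decide ((τ.1.1 : ℕ) = p), decide ((τ.1.2 : ℕ) = q)), τ.2)
  have hinj : Set.InjOn φ (vertexStar d N (node N p q)) := by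
    rintro ⟨⟨i, j⟩, ε⟩ h1 ⟨⟨i', j'⟩, ε'⟩ h2 he
    have k1 := key _ h1
    have k2 := key _ h2
    simp only [φ, Prod.mk.injEq, decide_eq_decide] at he
    simp only at k1 k2
    have e1 : i = i' := Fin.ext (by omega)
    have e2 : j = j' := Fin.ext (by omega)
    rw [e1, e2, he.2]
  have := Finset.card_le_card_of_injOn φ (fun τ _ => Finset.mem_univ (φ τ)) hinj
  simpa using this

end UnfittedNitsche
end

noncomputable section
namespace UnfittedNitsche

/-! ## The circles and the elements -/

/-- If s avoided the frontier, the interior of K would be relatively open and closed in s. -/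
theorem exists_frontier_of_preconnected {K s : Set Plane} (hK : IsClosed K)
    (hs : IsPreconnected s) (h1 : (s ∩ interior K).Nonempty) (h2 : ¬ s ⊆ interior K) :
    (s ∩ frontier K).Nonempty := by
  by_contra hcon
  rw [Set.not_nonempty_iff_eq_empty] at hcon
  refine h2 (hs.subset_of_closure_inter_subset isOpen_interior h1 ?_)
  rintro x ⟨hx, hxs⟩
  by_contra hxi
  have : x ∈ s ∩ frontier K := by
    refine ⟨hxs, ?_⟩
    rw [hK.frontier_eq]
    exact ⟨closure_minimal interior_subset hK hx, hxi⟩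
  rw [hcon] at this
  exact this

/-- An arc of a circle that starts in the interior of a closed set and leaves it hits the
frontier. -/
theorem exists_circ_mem_frontier {K : Set Plane} (hK : IsClosed K) {c : Plane} {r a b : ℝ}
    {t : Set ℝ} (ht : t = Set.uIcc a b) (ha : circ c r a ∈ interior K)
    (hb : circ c r b ∉ interior K) : ∃ θ ∈ t, circ c r θ ∈ frontier K := by
  subst ht
  obtain ⟨_, ⟨θ, hθ, rfl⟩, hf⟩ := exists_frontier_of_preconnected hK
    ((isPreconnected_uIcc (a := a) (b := b)).image (circ c r) (continuous_circ c r).continuousOn)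
    ⟨_, ⟨a, Set.left_mem_uIcc, rfl⟩, ha⟩
    (fun h => hb (h ⟨b, Set.right_mem_uIcc, rfl⟩))
  exact ⟨θ, hθ, hf⟩

/-- The circle meets the horizontal axis through its centre at the multiples of π, and the interior
of K lies strictly on one side of this axis. So the circle leaves K both before and after z within a
half circle. The two exit points coincide only if they equal z, which is interior. -/
theorem two_hits {K : Set Plane} (hK : IsClosed K) {c z : Plane} {r s : ℝ} (hr : 0 < r)
    (hs : s = 1 ∨ s = -1) (hc : c 1 = 0) (hKs : ∀ x ∈ interior K, 0 < s * x 1)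
    (hz : z ∈ interior K) (hzc : z ∈ Metric.sphere c r) :
    ∃ x ∈ frontier K, ∃ y ∈ frontier K, x ≠ y ∧ x ∈ Metric.sphere c r ∧ y ∈ Metric.sphere c r := by
  obtain ⟨θ, hθ, rfl⟩ := exists_circ_eq hr hzc (-Real.pi)
  have hpi := Real.pi_pos
  have hpos := hKs _ hz
  rw [circ_one, hc, zero_add] at hpos
  have hnot : ∀ k : ℤ, circ c r (k * Real.pi) ∉ interior K := by
    intro k hk
    have := hKs _ hk
    rw [circ_one, hc, Real.sin_int_mul_pi] at this
    simp at this
  have main : ∀ k : ℤ, ((k : ℝ) * Real.pi < θ ∧ θ < (k + 1) * Real.pi) →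
    ∃ x ∈ frontier K, ∃ y ∈ frontier K, x ≠ y ∧ x ∈ Metric.sphere c r ∧ y ∈ Metric.sphere c r := by
    rintro k ⟨h1, h2⟩
    obtain ⟨θ₁, ht1, hf1⟩ := exists_circ_mem_frontier hK rfl hz (hnot k)
    have h' := hnot (k + 1)
    push_cast at h'
    obtain ⟨θ₂, ht2, hf2⟩ := exists_circ_mem_frontier hK rfl hz h'
    rw [Set.uIcc_of_ge h1.le] at ht1
    rw [Set.uIcc_of_le h2.le] at ht2
    refine ⟨_, hf1, _, hf2, ?_, circ_mem_sphere hr _, circ_mem_sphere hr _⟩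
    intro he
    have e := circ_injOn hr (by
      rw [abs_lt]; constructor <;> linarith [ht1.1, ht1.2, ht2.1, ht2.2]) he
    have : θ = θ₁ := le_antisymm (by rw [e]; exact ht2.1) ht1.2
    rw [← this] at hf1
    rw [hK.frontier_eq] at hf1
    exact hf1.2 hz
  have hsin : Real.sin θ ≠ 0 := by
    intro h; rw [h] at hpos; simp at hpos
  rcases lt_trichotomy θ 0 with h | h | h
  · refine main (-1) ⟨by push_cast; linarith [hθ.1], by push_cast; linarith⟩
  · rw [h] at hsin; simp at hsin
  · refine main 0 ⟨by push_cast; linarith, ?_⟩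
    push_cast
    have h2 : θ ≤ Real.pi := by linarith [hθ.2]
    rcases h2.lt_or_eq with h3 | h3
    · linarith
    · rw [h3] at hsin; simp at hsin

/-- The sum of the coordinate deviations has square at most 4r²/3 < 1/9. Hence the line s + t = 1, a
mesh line for short diagonals, separates the two discs. -/
theorem siteA_add_lt {r : ℝ} (hr : RadiusOK r) {x : Plane} (hx : x ∈ Metric.closedBall siteA r) :
    coordS x + coordT x < 1 := by
  have h1 := (power_nonpos_iff hr.1).2 hx
  rw [power, normSq_coord, coordS_siteA, coordT_siteA] at h1
  have h2 := hr.sq_lt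
  have : |coordS x - 1 / 3 + (coordT x - 1 / 3)| < 1 / 3 := by
    refine abs_lt_of_sq_lt_sq ?_ (by norm_num)
    nlinarith [sq_nonneg (coordS x - 1 / 3 - (coordT x - 1 / 3))]
  rw [abs_lt] at this
  linarith

theorem siteB_add_gt {r : ℝ} (hr : RadiusOK r) {x : Plane} (hx : x ∈ Metric.closedBall siteB r) :
    1 < coordS x + coordT x := by
  have h1 := (power_nonpos_iff hr.1).2 hx
  rw [power, normSq_coord, coordS_siteB, coordT_siteB] at h1
  have h2 := hr.sq_lt
  have : |coordS x - 2 / 3 + (coordT x - 2 / 3)| < 1 / 3 := by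
    refine abs_lt_of_sq_lt_sq ?_ (by norm_num)
    nlinarith [sq_nonneg (coordS x - 2 / 3 - (coordT x - 2 / 3))]
  rw [abs_lt] at this
  linarith

/-- Short diagonals lie on the lines where the scaled coordinate sum is an integer; s + t = 1 is the
line with value N. -/
theorem elem_short_half {N : ℕ} (hN : 0 < N) (τ : ElemIndex N) :
    (∀ x ∈ elem .short N τ, coordS x + coordT x ≤ 1) ∨
    (∀ x ∈ elem .short N τ, 1 ≤ coordS x + coordT x) := by
  have hN' : (0 : ℝ) < N := by exact_mod_cast hN
  obtain ⟨⟨i, j⟩, ε⟩ := τ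
  rcases lt_or_ge ((i : ℕ) + j + ε) N with h | h
  · left
    intro x hx
    have := (mem_elem_iff .short hN _ x).1 hx
    refine le_of_mul_le_mul_left ?_ hN'
    have h' : ((i : ℕ) : ℝ) + (j : ℕ) + (ε : ℕ) + 1 ≤ N := by exact_mod_cast h
    fin_cases ε <;> simp [ElemIneq] at this h' <;> linarith
  · right
    intro x hx
    have := (mem_elem_iff .short hN _ x).1 hx
    refine le_of_mul_le_mul_left ?_ hN'
    have h' : (N : ℝ) ≤ ((i : ℕ) : ℝ) + (j : ℕ) + (ε : ℕ) := by exact_mod_cast h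
    fin_cases ε <;> simp [ElemIneq] at this h' <;> linarith

/-- Long diagonals lie on the lines where the difference of the scaled coordinates is an integer.
The value 0 is the horizontal axis, which passes through both sites and so does not separate the
discs. -/
theorem elem_long_half {N : ℕ} (hN : 0 < N) (τ : ElemIndex N) :
    ∃ s : ℝ, (s = 1 ∨ s = -1) ∧ ∀ x ∈ elem .long N τ, 0 ≤ s * x 1 := by
  have hN' : (0 : ℝ) < N := by exact_mod_cast hN
  have hx1 : ∀ x : Plane, x 1 = (coordS x - coordT x) / 2 := by
    intro x; simp only [coordS, coordT]; ring
  obtain ⟨⟨i, j⟩, ε⟩ := τ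
  rcases lt_or_ge (i : ℕ) ((j : ℕ) + ε) with h | h
  · refine ⟨-1, .inr rfl, fun x hx => ?_⟩
    have := (mem_elem_iff .long hN _ x).1 hx
    have h' : ((i : ℕ) : ℝ) + 1 ≤ (j : ℕ) + (ε : ℕ) := by exact_mod_cast h
    have : coordS x ≤ coordT x := by
      refine le_of_mul_le_mul_left ?_ hN'
      fin_cases ε
      · have h0 : ((i : ℕ) : ℝ) + 1 ≤ (j : ℕ) + ((0 : ℕ) : ℝ) := h'
        simp [ElemIneq] at this
        push_cast at h0
        linarith
      · have h0 : ((i : ℕ) : ℝ) + 1 ≤ (j : ℕ) + ((1 : ℕ) : ℝ) := h'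
        simp [ElemIneq] at this
        push_cast at h0
        linarith
    rw [hx1]; linarith
  · refine ⟨1, .inl rfl, fun x hx => ?_⟩
    have := (mem_elem_iff .long hN _ x).1 hx
    have h' : ((j : ℕ) : ℝ) + (ε : ℕ) ≤ (i : ℕ) := by exact_mod_cast h
    have : coordT x ≤ coordS x := by
      refine le_of_mul_le_mul_left ?_ hN'
      fin_cases ε
      · have h0 : ((j : ℕ) : ℝ) + ((0 : ℕ) : ℝ) ≤ (i : ℕ) := h'
        simp [ElemIneq] at this
        push_cast at h0
        linarith
      · have h0 : ((j : ℕ) : ℝ) + ((1 : ℕ) : ℝ) ≤ (i : ℕ) := h'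
        simp [ElemIneq] at this
        push_cast at h0
        linarith
    rw [hx1]; linarith

theorem convex_elem (d : Diagonal) (N : ℕ) (τ : ElemIndex N) : Convex ℝ (elem d N τ) :=
  convex_convexHull ℝ _

theorem isCompact_elem (d : Diagonal) (N : ℕ) (τ : ElemIndex N) : IsCompact (elem d N τ) :=
  (Set.finite_range _).isCompact_convexHull ℝ

theorem isClosed_elem (d : Diagonal) (N : ℕ) (τ : ElemIndex N) : IsClosed (elem d N τ) :=
  (isCompact_elem d N τ).isClosed

theorem RegularTri.interior_nonempty {h : ℝ} {A B C : Plane} (T : RegularTri h A B C) :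
    (interior (tri A B C)).Nonempty := by
  refine ⟨(1 / 3 : ℝ) • A + (1 / 3 : ℝ) • B + (1 / 3 : ℝ) • C, (T.mem_interior_iff _).2 ?_⟩
  refine ⟨?_, ?_, ?_⟩
  · rw [show (1 / 3 : ℝ) • A + (1 / 3 : ℝ) • B + (1 / 3 : ℝ) • C =
      (1 / 3 : ℝ) • B + (1 / 3 : ℝ) • C + (1 / 3 : ℝ) • A by abel, T.rotate.bary_comb (by norm_num)]
    norm_num
  · rw [show (1 / 3 : ℝ) • A + (1 / 3 : ℝ) • B + (1 / 3 : ℝ) • C =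
      (1 / 3 : ℝ) • C + (1 / 3 : ℝ) • A + (1 / 3 : ℝ) • B by abel,
      T.rotate.rotate.bary_comb (by norm_num)]
    norm_num
  · rw [T.bary_comb (by norm_num)]; norm_num

theorem interior_elem_nonempty (d : Diagonal) {N : ℕ} (hN : 0 < N) (τ : ElemIndex N) :
    (interior (elem d N τ)).Nonempty := by
  rw [elem_eq_tri]; exact (regularTri_vertex d hN τ).interior_nonempty

theorem closure_interior_elem (d : Diagonal) {N : ℕ} (hN : 0 < N) (τ : ElemIndex N) :
    closure (interior (elem d N τ)) = elem d N τ := by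
  rw [(convex_elem d N τ).closure_interior_eq_closure_of_nonempty_interior
    (interior_elem_nonempty d hN τ), (isClosed_elem d N τ).closure_eq]

/-- The standing assumptions on the interface and on the mesh. -/
structure Admissible (d : Diagonal) (r : ℝ) (N : ℕ) : Prop where
  radius : RadiusOK r
  N_pos : 0 < N
  hits : InterfaceAssumption d r N

namespace Admissible

variable {d : Diagonal} {r : ℝ} {N : ℕ} {τ : ElemIndex N} {c : Plane}

theorem mem_cutElems {x : Plane} (hx : x ∈ interface r) (hxτ : x ∈ elem d N τ) :
    τ ∈ cutElems d r N := by
  simp only [cutElems, Finset.mem_filter, Finset.mem_univ, true_and]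
  exact ⟨x, hx, hxτ⟩

theorem sphere_subset_interface (hc : IsSite c) : Metric.sphere c r ⊆ interface r := by
  rw [interface_eq hc]; exact Set.subset_union_left

theorem three_hits (H : Admissible d r N) {x y z : Plane} (hx : x ∈ interface r)
    (hy : y ∈ interface r) (hz : z ∈ interface r) (hx' : x ∈ frontier (elem d N τ))
    (hy' : y ∈ frontier (elem d N τ)) (hz' : z ∈ frontier (elem d N τ)) :
    x = y ∨ y = z ∨ x = z := by
  have hcut : τ ∈ cutElems d r N :=
    mem_cutElems hx ((isClosed_elem d N τ).frontier_subset hx')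
  have h2 := (H.hits τ hcut).1
  by_contra! hne
  have hsub : ({x, y, z} : Set Plane) ⊆ interface r ∩ frontier (elem d N τ) := by
    rintro w (rfl | rfl | rfl)
    · exact ⟨hx, hx'⟩
    · exact ⟨hy, hy'⟩
    · exact ⟨hz, hz'⟩
  have hfin : (interface r ∩ frontier (elem d N τ)).Finite :=
    Set.finite_of_ncard_ne_zero (by rw [h2]; norm_num)
  have := Set.ncard_le_ncard hsub hfin
  rw [h2, Set.ncard_eq_three.2 ⟨x, y, z, hne.1, hne.2.2, hne.2.1, rfl⟩] at this
  omega

theorem finite_hits (H : Admissible d r N) (τ : ElemIndex N) :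
    (interface r ∩ frontier (elem d N τ)).Finite ∧
      (interface r ∩ frontier (elem d N τ)).ncard ≤ 2 := by
  by_cases hcut : τ ∈ cutElems d r N
  · have h2 := (H.hits τ hcut).1
    exact ⟨Set.finite_of_ncard_ne_zero (by rw [h2]; norm_num), h2.le⟩
  · have : interface r ∩ frontier (elem d N τ) = ∅ := by
      rw [Set.eq_empty_iff_forall_notMem]
      rintro x ⟨h1, h2⟩
      exact hcut (mem_cutElems h1 ((isClosed_elem d N τ).frontier_subset h2))
    rw [this]; simp

theorem edge_unique (H : Admissible d r N) {A B C x y : Plane} (hE : IsElem d N τ A B C)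
    (hx : x ∈ openSegment ℝ A B) (hy : y ∈ openSegment ℝ A B) (hx' : x ∈ interface r)
    (hy' : y ∈ interface r) : x = y := by
  have hxt : x ∈ elem d N τ := by
    have T := hE.regular H.N_pos
    rw [hE.elem_eq]
    exact T.isClosed_tri.frontier_subset (T.seg_mem_frontier (openSegment_subset_segment ℝ _ _ hx))
  have hcut := mem_cutElems hx' hxt
  have h2 := (H.hits τ hcut).2
  rcases hE.cases_base with ⟨rfl, rfl, -⟩ | ⟨rfl, rfl, -⟩ | ⟨rfl, rfl, -⟩ | ⟨rfl, rfl, -⟩ |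
    ⟨rfl, rfl, -⟩ | ⟨rfl, rfl, -⟩ <;> exact h2 _ _ (by decide) ⟨hx', hx⟩ ⟨hy', hy⟩

theorem cutsRegularly (H : Admissible d r N) (hc : IsSite c) {A B C : Plane}
    (hE : IsElem d N τ A B C) : CutsRegularly c r A B C := by
  have hi : ∀ {x}, power c r x = 0 → x ∈ interface r := fun h =>
    sphere_subset_interface hc ((power_eq_zero_iff H.radius.1).1 h)
  refine ⟨?_, ?_, ?_, ?_⟩
  · exact fun x hx y hy px py => H.edge_unique hE hx hy (hi px) (hi py)
  · exact fun x hx y hy px py => H.edge_unique hE.rotate hx hy (hi px) (hi py)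
  · exact fun x hx y hy px py => H.edge_unique hE.rotate.rotate hx hy (hi px) (hi py)
  · intro x hx y hy z hz px py pz
    rw [← hE.elem_eq] at hx hy hz
    exact H.three_hits (hi px) (hi py) (hi pz) hx hy hz

theorem interior_inter_ball (H : Admissible d r N) (h : (elem d N τ ∩ Metric.ball c r).Nonempty) :
    (interior (elem d N τ) ∩ Metric.ball c r).Nonempty := by
  obtain ⟨x, hx, hxb⟩ := h
  rw [← closure_interior_elem d H.N_pos τ] at hx
  obtain ⟨y, h1, h2⟩ := mem_closure_iff.1 hx _ Metric.isOpen_ball hxb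
  exact ⟨y, h2, h1⟩

/-- An element meets at most one of the two discs. -/
theorem inter_other_eq_empty (H : Admissible d r N) (hc : IsSite c)
    (h : (elem d N τ ∩ Metric.ball c r).Nonempty) :
    elem d N τ ∩ Metric.ball (otherSite c) r = ∅ := by
  by_contra hne
  have hne := Set.nonempty_iff_ne_empty.2 hne
  cases d with
  | short =>
    -- With short diagonals the mesh line s + t = 1 separates the discs.
    have key : ∀ x ∈ elem .short N τ, ∀ y ∈ elem .short N τ, x ∈ Metric.ball siteA r →
        y ∈ Metric.ball siteB r → False := by
      intro x hx y hy hxA hyB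
      have h1 := siteA_add_lt H.radius (Metric.ball_subset_closedBall hxA)
      have h2 := siteB_add_gt H.radius (Metric.ball_subset_closedBall hyB)
      rcases elem_short_half H.N_pos τ with h | h
      · linarith [h y hy]
      · linarith [h x hx]
    obtain ⟨x, hx, hx'⟩ := h
    obtain ⟨y, hy, hy'⟩ := hne
    rcases hc with rfl | rfl
    · rw [otherSite_siteA] at hy'; exact key x hx y hy hx' hy'
    · rw [otherSite_siteB] at hy'; exact key y hy x hx hy' hx'
  | long =>
    -- With long diagonals the element lies on one side of the axis through both centres. If it met
    -- both discs, each circle would pass through its interior and hit its boundary twice. The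
    -- circles are disjoint, so already three of these hits contradict the assumption.
    obtain ⟨s, hs, hhalf⟩ := elem_long_half H.N_pos τ
    have hint : ∀ x ∈ interior (elem .long N τ), 0 < s * x 1 := by
      intro x hx
      have hs0 : s ≠ 0 := by rcases hs with rfl | rfl <;> norm_num
      have hnh := mem_interior_iff_mem_nhds.1 hx
      have ht : Filter.Tendsto (fun ε : ℝ => x - ε • (!₂[0, s] : Plane)) (nhds 0) (nhds x) := by
        have : Continuous (fun ε : ℝ => x - ε • (!₂[0, s] : Plane)) := by fun_prop
        simpa using this.tendsto 0
      obtain ⟨ε, hε, hε0⟩ := (((ht.eventually hnh).filter_mono nhdsWithin_le_nhds).and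
        (self_mem_nhdsWithin : Set.Ioi (0 : ℝ) ∈ nhdsWithin 0 (Set.Ioi 0))).exists
      have := hhalf _ hε
      simp only [PiLp.sub_apply, PiLp.smul_apply, smul_eq_mul] at this
      have hε0' : (0 : ℝ) < ε := hε0
      have hss : 0 < s * s := mul_self_pos.2 hs0
      simp at this
      nlinarith
    have hsph : ∀ c' : Plane, IsSite c' → (elem .long N τ ∩ Metric.ball c' r).Nonempty →
        (elem .long N τ ∩ Metric.ball (otherSite c') r).Nonempty →
        ∃ z ∈ interior (elem .long N τ), z ∈ Metric.sphere c' r := by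
      intro c' hc' h1 h2
      obtain ⟨x, hx, hxb⟩ := H.interior_inter_ball h1
      obtain ⟨y, hy, hyb⟩ := H.interior_inter_ball h2
      have hy2 : 0 < power c' r y := by
        by_contra! hcon
        exact Set.disjoint_left.1 (disjoint_closedBall_sites H.radius hc')
          ((power_nonpos_iff H.radius.1).1 hcon) (Metric.ball_subset_closedBall hyb)
      obtain ⟨z, hz, pz⟩ := exists_power_eq_zero ((power_neg_iff H.radius.1).2 hxb) hy2
      exact ⟨z, ((convex_elem _ _ _).interior.segment_subset hx hy)
        (openSegment_subset_segment ℝ _ _ hz), (power_eq_zero_iff H.radius.1).1 pz⟩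
    obtain ⟨z, hz, hzs⟩ := hsph c hc h hne
    obtain ⟨z', hz', hzs'⟩ := hsph (otherSite c) hc.other hne (by rwa [otherSite_otherSite])
    obtain ⟨x, hx, y, hy, hxy, hxs, hys⟩ := two_hits (isClosed_elem _ _ _) H.radius.1 hs
      (site_one hc) hint hz hzs
    obtain ⟨x', hx', -, -, -, hxs', -⟩ := two_hits (isClosed_elem _ _ _) H.radius.1 hs
      (site_one hc.other) hint hz' hzs'
    have hdis : ∀ w, w ∈ Metric.sphere c r → w ≠ x' := by
      rintro w hw rfl
      exact Set.disjoint_left.1 (disjoint_closedBall_sites H.radius hc)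
        (Metric.sphere_subset_closedBall hw) (Metric.sphere_subset_closedBall hxs')
    rcases H.three_hits (sphere_subset_interface hc hxs) (sphere_subset_interface hc hys)
      (sphere_subset_interface hc.other hxs') hx hy hx' with h | h | h
    · exact hxy h
    · exact hdis _ hys h
    · exact hdis _ hxs h

end Admissible

end UnfittedNitsche
end

noncomputable section
namespace UnfittedNitsche

/-! ### The Bloch gradient of a finite element function on one element -/

/-- `G` is the affine extension to the plane of the Bloch gradient of `v` on `K`. -/
structure IsBlochGrad (k : Plane) (v : Plane → ℂ) (K : Set Plane)
    (G : Plane → EuclideanSpace ℂ (Fin 2)) : Prop where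
  line : PreservesLine G
  cont : Continuous G
  transport : ∀ x ∈ K, ∀ y ∈ K,
    v x * (1 + Complex.I * ((∑ j, k j * (x - y) j : ℝ) : ℂ)) - v y = ∑ j, G x j * ((x - y) j : ℂ)
  eq : ∀ x ∈ interior K, ∀ j, blochGrad k v x j = G x j

/-- If v has gradient g on K, then G = g + i k v is again affine. Taking its product with x − y
produces the factor 1 + i k·(x−y). Values are thus transported by the Bloch gradient alone, which is
what the energy controls. -/
theorem exists_isBlochGrad (k : Plane) {v : Plane → ℂ} {K : Set Plane} (hv : IsAffineOn v K) :
    ∃ G, IsBlochGrad k v K G := by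
  obtain ⟨c, g, hg⟩ := hv
  refine ⟨fun x => WithLp.toLp 2 fun j =>
    g j + Complex.I * (k j : ℂ) * (c + ∑ j, g j * (x j : ℂ)), ?_, ?_, ?_, ?_⟩
  · intro x y t
    ext j
    simp only [Fin.sum_univ_two, PiLp.add_apply, PiLp.smul_apply, smul_eq_mul,
      Complex.real_smul]
    push_cast
    ring
  · refine (PiLp.continuous_toLp 2 _).comp (continuous_pi fun j => ?_)
    simp only [Fin.sum_univ_two]
    fun_prop
  · intro x hx y hy
    rw [hg x hx, hg y hy]
    simp only [Fin.sum_univ_two, PiLp.sub_apply]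
    push_cast
    ring
  · intro x hx j
    let L : Plane →L[ℝ] ℂ :=
      ∑ j, g j • (Complex.ofRealCLM.comp (EuclideanSpace.proj j : Plane →L[ℝ] ℝ))
    have hL : ∀ y, L y = ∑ j, g j * (y j : ℂ) := by
      intro y
      simp [L, Fin.sum_univ_two]
    have hev : v =ᶠ[nhds x] fun y => c + L y := by
      filter_upwards [mem_interior_iff_mem_nhds.1 hx] with y hy
      rw [hg y hy, hL]
    have hd : fderiv ℝ v x = L := by
      rw [hev.fderiv_eq]
      exact (L.hasFDerivAt.const_add c).fderiv
    simp only [blochGrad, hd, hL, hg x (interior_subset hx)]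
    congr 1
    fin_cases j <;> simp [Fin.sum_univ_two]

theorem normSq_sum_mul_le (a : EuclideanSpace ℂ (Fin 2)) (b : Plane) :
    ‖∑ j, a j * (b j : ℂ)‖ ^ 2 ≤ ‖a‖ ^ 2 * ‖b‖ ^ 2 := by
  rw [EuclideanSpace.norm_sq_eq, EuclideanSpace.norm_sq_eq]
  calc ‖∑ j, a j * (b j : ℂ)‖ ^ 2 ≤ (∑ j, ‖a j‖ * ‖b j‖) ^ 2 := by
        gcongr
        refine (norm_sum_le _ _).trans (le_of_eq ?_)
        simp
    _ ≤ _ := Finset.sum_mul_sq_le_sq_mul_sq _ _ _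

/-- The energy of `q i` on the part of an element in the `i`-th subdomain. -/
def elemEnergy (k : Plane) (d : Diagonal) (r : ℝ) (N : ℕ) (q : Fin 2 → Plane → ℂ) (i : Fin 2)
    (τ : ElemIndex N) : ℝ :=
  ∫ x in elem d N τ ∩ subdomain r i, ∑ j, ‖blochGrad k (q i) x j‖ ^ 2

theorem elemEnergy_nonneg (k : Plane) (d : Diagonal) (r : ℝ) (N : ℕ) (q : Fin 2 → Plane → ℂ)
    (i : Fin 2) (τ : ElemIndex N) : 0 ≤ elemEnergy k d r N q i τ :=
  integral_nonneg fun _ => Finset.sum_nonneg fun _ _ => sq_nonneg _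

theorem measurableSet_subdomain (r : ℝ) (i : Fin 2) : MeasurableSet (subdomain r i) := by
  have hb : MeasurableSet (Metric.ball siteA r ∪ Metric.ball siteB r) :=
    (Metric.isOpen_ball.union Metric.isOpen_ball).measurableSet
  fin_cases i
  · exact hb
  · exact isClosed_cell.measurableSet.diff hb

theorem measurableSet_elem (d : Diagonal) (N : ℕ) (τ : ElemIndex N) :
    MeasurableSet (elem d N τ) := (isClosed_elem d N τ).measurableSet

/-- Derivatives of finite element functions are only known inside the elements; boundaries of convex
sets are null. -/
theorem ae_mem_interior_elem (d : Diagonal) (N : ℕ) (τ : ElemIndex N) (S : Set Plane)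
    (hS : MeasurableSet S) :
    ∀ᵐ x ∂(volume.restrict (elem d N τ ∩ S)), x ∈ interior (elem d N τ) := by
  have h0 : volume (frontier (elem d N τ)) = 0 := (convex_elem d N τ).addHaar_frontier _
  rw [ae_restrict_iff' ((measurableSet_elem d N τ).inter hS)]
  have : ∀ᵐ x ∂(volume : Measure Plane), x ∉ frontier (elem d N τ) := measure_eq_zero_iff_ae_notMem.1 h0
  filter_upwards [this] with x hx hxm
  by_contra hcon
  exact hx ⟨subset_closure hxm.1, hcon⟩

theorem IsBlochGrad.sum_eq {k : Plane} {v : Plane → ℂ} {K : Set Plane}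
    {G : Plane → EuclideanSpace ℂ (Fin 2)} (hG : IsBlochGrad k v K G) {x : Plane}
    (hx : x ∈ interior K) : ∑ j, ‖blochGrad k v x j‖ ^ 2 = ‖G x‖ ^ 2 := by
  rw [EuclideanSpace.norm_sq_eq]
  exact Finset.sum_congr rfl fun j _ => by rw [hG.eq x hx j]

theorem elemEnergy_eq {k : Plane} {d : Diagonal} {r : ℝ} {N : ℕ} {q : Fin 2 → Plane → ℂ}
    {i : Fin 2} {τ : ElemIndex N} {G : Plane → EuclideanSpace ℂ (Fin 2)}
    (hG : IsBlochGrad k (q i) (elem d N τ) G) :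
    elemEnergy k d r N q i τ = ∫ x in elem d N τ ∩ subdomain r i, ‖G x‖ ^ 2 := by
  refine integral_congr_ae ?_
  filter_upwards [ae_mem_interior_elem d N τ _ (measurableSet_subdomain r i)] with x hx
  exact hG.sum_eq hx

namespace Admissible

variable {d : Diagonal} {r : ℝ} {N : ℕ} {τ : ElemIndex N} {c : Plane}

theorem sphere_mem_subdomain_one (H : Admissible d r N) (hc : IsSite c) {x : Plane}
    (hx : x ∈ Metric.sphere c r) : x ∈ subdomain r 1 := by
  rw [subdomain_one_eq hc]
  refine ⟨closedBall_site_subset_cell H.radius hc (Metric.sphere_subset_closedBall hx), ?_⟩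
  rintro (h | h)
  · exact absurd (Metric.mem_sphere.1 hx) (ne_of_lt (Metric.mem_ball.1 h))
  · exact Set.disjoint_left.1 (disjoint_closedBall_sites H.radius hc)
      (Metric.sphere_subset_closedBall hx) (Metric.ball_subset_closedBall h)

theorem mem_subdomainElems (H : Admissible d r N) {x : Plane} (hx : x ∈ interface r)
    (hxτ : x ∈ elem d N τ) (i : Fin 2) : τ ∈ subdomainElems d r N i := by
  simp only [subdomainElems, Finset.mem_filter, Finset.mem_univ, true_and]
  refine ⟨x, ?_, hxτ⟩
  obtain ⟨c, hc, hxc⟩ : ∃ c, IsSite c ∧ x ∈ Metric.sphere c r := by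
    rcases hx with h | h
    · exact ⟨siteA, .inl rfl, h⟩
    · exact ⟨siteB, .inr rfl, h⟩
  fin_cases i
  · have : Metric.closedBall c r ⊆ closure (subdomain r 0) := by
      rw [← closure_ball c H.radius.1.ne', subdomain_zero_eq hc]
      exact closure_mono Set.subset_union_left
    exact this (Metric.sphere_subset_closedBall hxc)
  · exact subset_closure (H.sphere_mem_subdomain_one hc hxc)

theorem inter_subdomain_zero (H : Admissible d r N) (hc : IsSite c)
    (hne : (elem d N τ ∩ Metric.ball c r).Nonempty) :
    elem d N τ ∩ subdomain r 0 = elem d N τ ∩ Metric.ball c r := by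
  rw [subdomain_zero_eq hc, Set.inter_union_distrib_left, H.inter_other_eq_empty hc hne,
    Set.union_empty]

theorem inter_subdomain_one (H : Admissible d r N) (hc : IsSite c)
    (hne : (elem d N τ ∩ Metric.ball c r).Nonempty) :
    elem d N τ ∩ subdomain r 1 = elem d N τ \ Metric.ball c r := by
  have h0 := H.inter_other_eq_empty hc hne
  rw [subdomain_one_eq hc]
  ext x
  constructor
  · rintro ⟨h1, -, h2⟩
    exact ⟨h1, fun h => h2 (.inl h)⟩
  · rintro ⟨h1, h2⟩
    refine ⟨h1, elem_subset_cell d H.N_pos τ h1, ?_⟩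
    rintro (h | h)
    · exact h2 h
    · exact Set.eq_empty_iff_forall_notMem.1 h0 x ⟨h1, h⟩

/-- The inverse estimate at a point of the interface. -/
theorem inverse_energy (H : Admissible d r N) (hc : IsSite c)
    (hne : (elem d N τ ∩ Metric.ball c r).Nonempty) {k : Plane} {q : Fin 2 → Plane → ℂ} {i : Fin 2}
    {G : Plane → EuclideanSpace ℂ (Fin 2)} (hG : IsBlochGrad k (q i) (elem d N τ) G) {x : Plane}
    (hx : x ∈ elem d N τ) (hxc : x ∈ Metric.sphere c r) :
    ‖G x‖ ^ 2 * partArea d r N τ i ≤ invConst * elemEnergy k d r N q i τ := by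
  rw [elemEnergy_eq hG, partArea]
  have T := regularTri_vertex d H.N_pos τ
  have Hc := H.cutsRegularly hc (.base (d := d) (N := N) (τ := τ))
  have hxt : x ∈ tri (vertex d N τ 0) (vertex d N τ 1) (vertex d N τ 2) := by
    rwa [← elem_eq_tri]
  fin_cases i
  · have := inside_estimate hG.line hG.cont (r := r) T hxt (Metric.sphere_subset_closedBall hxc)
    rw [← elem_eq_tri, ← H.inter_subdomain_zero hc hne] at this
    exact this
  · have := outside_estimate hG.line hG.cont H.radius.1 T Hc (x := x)
      ⟨hxt, fun h => absurd (Metric.mem_sphere.1 hxc) (ne_of_lt (Metric.mem_ball.1 h))⟩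
    rw [← elem_eq_tri, ← H.inter_subdomain_one hc hne] at this
    exact this

end Admissible

end UnfittedNitsche
end

noncomputable section
namespace UnfittedNitsche

/-! ### Jumps at a vertex and at a nearby point of the interface on a side -/

theorem volume_real_ball (x : Plane) {ρ : ℝ} (hρ : 0 ≤ ρ) :
    volume.real (Metric.ball x ρ) = Real.pi * ρ ^ 2 := by
  rw [measureReal_def, EuclideanSpace.volume_ball_fin_two, ENNReal.toReal_mul, ENNReal.toReal_pow,
    ENNReal.toReal_ofReal hρ]
  simp [mul_comm, Real.pi_pos.le]

/-- A ball centred on a circle contains a ball of half its radius inside the disc and another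
one outside. -/
theorem half_ball_volume {c P : Plane} {r ρ : ℝ} (hr : 0 < r) (hP : P ∈ Metric.sphere c r)
    (hρ : 0 ≤ ρ) (hρr : ρ ≤ r) {S : Set Plane} (hS : volume S ≠ ⊤)
    (hsub : Metric.ball P ρ ⊆ S) :
    Real.pi * ρ ^ 2 / 4 ≤ volume.real (S ∩ Metric.ball c r) ∧
      Real.pi * ρ ^ 2 / 4 ≤ volume.real (S \ Metric.ball c r) := by
  have hPn : ‖P - c‖ = r := by rw [← dist_eq_norm]; exact hP
  have hm : ∀ s : ℝ, ‖(P + s • (P - c)) - P‖ = |s| * r := by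
    intro s
    rw [add_sub_cancel_left, norm_smul, Real.norm_eq_abs, hPn]
  have hmc : ∀ s : ℝ, ‖(P + s • (P - c)) - c‖ = |1 + s| * r := by
    intro s
    rw [show (P + s • (P - c)) - c = (1 + s) • (P - c) by module, norm_smul, Real.norm_eq_abs, hPn]
  have hs0 : 0 ≤ ρ / 2 / r := by positivity
  have hsr : ρ / 2 / r * r = ρ / 2 := by field_simp
  have hs1 : ρ / 2 / r ≤ 1 := by rw [div_le_one hr]; linarith
  have hv : ∀ x : Plane, volume.real (Metric.ball x (ρ / 2)) = Real.pi * ρ ^ 2 / 4 := by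
    intro x; rw [volume_real_ball _ (by linarith)]; ring
  constructor
  -- The centre is shifted by ρ/2 along the radius, inwards here and outwards below. The ball of
  -- radius ρ/2 about it stays in the given ball and on one side of the circle.
  · rw [← hv (P + (-(ρ / 2 / r)) • (P - c))]
    refine measureReal_mono (fun y hy => ⟨hsub ?_, ?_⟩)
      (measure_ne_top_of_subset Set.inter_subset_left hS)
    · rw [mem_ball_iff_norm] at hy ⊢
      have := norm_sub_le_norm_sub_add_norm_sub y (P + (-(ρ / 2 / r)) • (P - c)) P
      rw [hm, abs_neg, abs_of_nonneg hs0, hsr] at this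
      linarith
    · rw [mem_ball_iff_norm] at hy ⊢
      have := norm_sub_le_norm_sub_add_norm_sub y (P + (-(ρ / 2 / r)) • (P - c)) c
      rw [hmc, abs_of_nonneg (by linarith), add_mul, neg_mul, hsr] at this
      linarith
  · rw [← hv (P + (ρ / 2 / r) • (P - c))]
    refine measureReal_mono (fun y hy => ⟨hsub ?_, fun hyc => ?_⟩)
      (measure_ne_top_of_subset Set.sdiff_subset hS)
    · rw [mem_ball_iff_norm] at hy ⊢
      have := norm_sub_le_norm_sub_add_norm_sub y (P + (ρ / 2 / r) • (P - c)) P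
      rw [hm, abs_of_nonneg hs0, hsr] at this
      linarith
    · rw [mem_ball_iff_norm] at hy hyc
      have := norm_sub_le_norm_sub_add_norm_sub (P + (ρ / 2 / r) • (P - c)) y c
      rw [hmc, abs_of_nonneg (by linarith), add_mul, hsr, norm_sub_rev _ y] at this
      linarith

/-- By the Gram bound, the coordinates of x belonging to B and T differ from t and 0 by less than
t/2, since 8/36 < 1/4. With t ≤ 1/2 only the coordinate of T can be negative, and its sign selects
the triangle or its reflection. -/
theorem ball_subset_tri_union {h t : ℝ} {V B T : Plane} (R : RegularTri h V B T) (ht : 0 < t)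
    (ht2 : t ≤ 1 / 2) :
    Metric.ball (V + t • (B - V)) (t * h / 6) ⊆ tri V B T ∪ tri V B (V + B - T) := by
  intro x hx
  have hh := R.pos
  rw [mem_ball_iff_norm] at hx
  have hrec := R.bary_rec x
  have hsum := R.bary_sum x
  set u := bary B T V x
  set v := bary T V B x
  set w := bary V B T x
  have hu : u = 1 - v - w := by linarith
  have hx' : x - (V + t • (B - V)) = (v - t) • (B - V) + w • (T - V) := by
    rw [hrec, hu]; module
  have h1 := R.norm_comb_ge (v - t) w
  rw [← hx'] at h1
  have h2 : ‖x - (V + t • (B - V))‖ ^ 2 < (t * h / 6) ^ 2 := by gcongr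
  have h3 : h ^ 2 * ((v - t) ^ 2 + w ^ 2) < h ^ 2 * (2 / 9 * t ^ 2) := by nlinarith
  have h4 : (v - t) ^ 2 + w ^ 2 < 2 / 9 * t ^ 2 := lt_of_mul_lt_mul_left h3 (by positivity)
  have hv1 : |v - t| < t / 2 := by
    refine abs_lt_of_sq_lt_sq ?_ (by linarith); nlinarith [sq_nonneg w]
  have hw1 : |w| < t / 2 := by
    refine abs_lt_of_sq_lt_sq ?_ (by linarith); nlinarith [sq_nonneg (v - t)]
  rw [abs_lt] at hv1 hw1
  rcases le_total 0 w with h0 | h0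
  · left
    exact ⟨u, v, w, by linarith, by linarith, h0, by linarith, hrec⟩
  · right
    refine ⟨u + w, v + w, -w, by linarith, by linarith, by linarith, by linarith, ?_⟩
    rw [hrec]; module

theorem power_add (c : Plane) (r : ℝ) (x y : Plane) :
    power c r (x + y) = power c r x + 2 * ((x 0 - c 0) * y 0 + (x 1 - c 1) * y 1) + ‖y‖ ^ 2 := by
  simp only [power, normSq_eq, PiLp.sub_apply, PiLp.add_apply]
  ring

theorem nonpos_of_forall_quadratic {D E t : ℝ} (ht : 0 < t) (hE : 0 < E)
    (h : ∀ s, 0 ≤ s → s ≤ t → 0 ≤ -(s * (2 * D)) + s ^ 2 * E) : D ≤ 0 := by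
  by_contra! hD
  have hm : 0 < min t (D / E) := lt_min ht (by positivity)
  have h1 := h (min t (D / E)) hm.le (min_le_left _ _)
  have h2 : min t (D / E) * E ≤ D := by
    calc min t (D / E) * E ≤ D / E * E := by gcongr; exact min_le_right _ _
      _ = D := by field_simp
  nlinarith

namespace Admissible

variable {d : Diagonal} {r : ℝ} {N : ℕ} {τ : ElemIndex N} {c : Plane}

/-- With the disc tangent at P on the side of T, the vector T − V points into the disc so steeply
that V + t(T − V) is inside, while V and B are outside. The circle therefore crosses VT near V
besides touching VB. One more crossing follows: on VT if T is outside, on TB if T is inside, at T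
otherwise. -/
theorem no_tangency_of_side (H : Admissible d r N) (hc : IsSite c) {V B T : Plane}
    (hE : IsElem d N τ V B T) {t : ℝ} (ht : 0 < t) (ht2 : t ≤ 1 / 2) (htr : t * meshSize N ≤ r / 4)
    (hP : power c r (V + t • (B - V)) = 0)
    (htan : ((V + t • (B - V)) 0 - c 0) * (B - V) 0 + ((V + t • (B - V)) 1 - c 1) * (B - V) 1 = 0)
    (hside : ((V + t • (B - V)) 0 - c 0) * (T - V) 0 +
      ((V + t • (B - V)) 1 - c 1) * (T - V) 1 ≤ 0) : False := by
  have hr := H.radius.1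
  have R := hE.regular H.N_pos
  have hh := R.pos
  set h := meshSize N
  set P : Plane := V + t • (B - V) with hPdef
  set w := (P 0 - c 0) * (T - V) 0 + (P 1 - c 1) * (T - V) 1 with hw
  have hBpos : 0 < ‖B - V‖ ^ 2 := lt_of_lt_of_le (by positivity) R.AB_ge
  have hPn : (P 0 - c 0) ^ 2 + (P 1 - c 1) ^ 2 = r ^ 2 := by
    have := hP
    simp only [power, normSq_eq, PiLp.sub_apply] at this
    linarith
  -- P − c has length r and is orthogonal to VB, so up to sign w is r times the height of T over
  -- that side.
  have hid : w ^ 2 * ‖B - V‖ ^ 2 = det2 (B - V) (T - V) ^ 2 * r ^ 2 := by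
    rw [← hPn, normSq_eq, hw, det2]
    linear_combination (2 * ((P 0 - c 0) * (T - V) 0 + (P 1 - c 1) * (T - V) 1) *
      ((T - V) 0 * (B - V) 0 + (T - V) 1 * (B - V) 1) - ((T - V) 0 ^ 2 + (T - V) 1 ^ 2) *
      ((P 0 - c 0) * (B - V) 0 + (P 1 - c 1) * (B - V) 1)) * htan
  have hw2 : (h * r / 2) ^ 2 ≤ w ^ 2 := by
    rw [R.det_sq] at hid
    have h3 : w ^ 2 * ‖B - V‖ ^ 2 ≤ w ^ 2 * (3 * h ^ 2) := by
      gcongr; exact R.AB_le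
    have : (3 * h ^ 2) * (h * r / 2) ^ 2 ≤ (3 * h ^ 2) * w ^ 2 := by nlinarith
    exact le_of_mul_le_mul_left this (by positivity)
  have hw3 : w ≤ -(h * r / 2) := by
    have := sq_le_sq.1 hw2
    rw [abs_of_nonneg (by positivity), abs_of_nonpos hside] at this
    linarith
  have hVP : V = P + (-t) • (B - V) := by rw [hPdef]; module
  have hBP : B = P + (1 - t) • (B - V) := by rw [hPdef]; module
  have sm : ∀ (s : ℝ) (x : Plane) (i : Fin 2), (s • x) i = s * x i := fun _ _ _ => rfl
  have hV : 0 < power c r V := by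
    rw [hVP, power_add, hP, norm_smul, mul_pow, Real.norm_eq_abs, sq_abs, sm, sm,
      show 2 * ((P 0 - c 0) * (-t * (B - V) 0) + (P 1 - c 1) * (-t * (B - V) 1)) = 0 by
        linear_combination (-2 * t) * htan]
    have : 0 < (-t) ^ 2 := by rw [neg_sq]; positivity
    linarith [mul_pos this hBpos]
  have hB : 0 < power c r B := by
    rw [hBP, power_add, hP, norm_smul, mul_pow, Real.norm_eq_abs, sq_abs, sm, sm,
      show 2 * ((P 0 - c 0) * ((1 - t) * (B - V) 0) + (P 1 - c 1) * ((1 - t) * (B - V) 1)) = 0 by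
        linear_combination (2 * (1 - t)) * htan]
    have : 0 < (1 - t) ^ 2 := by have : 0 < 1 - t := by linarith
                                 positivity
    linarith [mul_pos this hBpos]
  have hX : power c r (V + t • (T - V)) < 0 := by
    rw [show V + t • (T - V) = P + t • (T - B) by rw [hPdef]; module, power_add, hP, norm_smul,
      mul_pow, Real.norm_eq_abs, sq_abs, sm, sm]
    have e1 : 2 * ((P 0 - c 0) * (t * (T - B) 0) + (P 1 - c 1) * (t * (T - B) 1)) = 2 * t * w := by
      rw [hw]
      simp only [PiLp.sub_apply] at htan ⊢
      linear_combination (-2 * t) * htan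
    rw [e1]
    have e2 : t ^ 2 * ‖T - B‖ ^ 2 ≤ t ^ 2 * (3 * h ^ 2) := by gcongr; exact R.BC_le
    have e3 : t * w ≤ t * (-(h * r / 2)) := by gcongr
    have e4 : t * h * (t * h) ≤ t * h * (r / 4) := by gcongr
    have e5 : 0 < t * h * r := by positivity
    have e6 : t ^ 2 * (3 * h ^ 2) = 3 * (t * h * (t * h)) := by ring
    linarith
  have hXseg : V + t • (T - V) ∈ segment ℝ V T := by
    rw [segment_eq_image']
    exact ⟨t, ⟨ht.le, by linarith⟩, rfl⟩
  have hXopen : V + t • (T - V) ∈ openSegment ℝ V T := by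
    rw [openSegment_eq_image']
    exact ⟨t, ⟨ht, by linarith⟩, rfl⟩
  have hPopen : P ∈ openSegment ℝ V B := by
    rw [openSegment_eq_image']
    exact ⟨t, ⟨ht, by linarith⟩, rfl⟩
  have hVT : V ≠ T := by
    rintro rfl
    have := R.AC_ge
    simp at this
    nlinarith
  have Hc := H.cutsRegularly hc hE
  rcases lt_or_ge 0 (power c r T) with hT | hT
  · exact no_two_zeros_on_side hVT hXseg hX hV hT Hc.swap.AB
  · obtain ⟨Z, hZ, pZ⟩ := exists_power_eq_zero hX hV
    have hZ' : Z ∈ openSegment ℝ V T := by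
      rw [openSegment_symm] at hZ
      obtain ⟨a, b, ha, hb, hab, rfl⟩ := hZ
      obtain ⟨a', b', ha', hb', hab', he⟩ := hXopen
      rw [← he]
      refine ⟨a + b * a', b * b', by positivity, by positivity, ?_, by module⟩
      linear_combination hab + b * hab'
    rcases hT.lt_or_eq with hT | hT
    · obtain ⟨Z', hZB, pZ'⟩ := exists_power_eq_zero hT hB
      rw [openSegment_symm] at hZB
      exact Hc.no_three R hPopen hZ' (openSegment_subset_segment ℝ _ _ hZB) hP pZ pZ'
    · exact Hc.no_three R hPopen hZ' (right_mem_segment ℝ _ _) hP pZ hT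

/-- A side cannot be tangent to the interface near one of its ends. -/
theorem exists_neg_on_side (H : Admissible d r N) (hc : IsSite c) {V B T : Plane}
    (hE : IsElem d N τ V B T) {τ' : ElemIndex N} (hE' : IsElem d N τ' V B (V + B - T)) {t : ℝ}
    (ht : 0 < t) (ht2 : t ≤ 1 / 2)
    (htr : t * meshSize N ≤ r / 4) (hP : power c r (V + t • (B - V)) = 0) :
    ∃ y ∈ segment ℝ V B, power c r y < 0 := by
  by_contra! hseg
  have R := hE.regular H.N_pos
  have hh := R.pos
  have hBpos : 0 < ‖B - V‖ ^ 2 := lt_of_lt_of_le (by positivity) R.AB_ge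
  set P : Plane := V + t • (B - V) with hPdef
  set D := (P 0 - c 0) * (B - V) 0 + (P 1 - c 1) * (B - V) 1 with hD
  have sm : ∀ (s : ℝ) (x : Plane) (i : Fin 2), (s • x) i = s * x i := fun _ _ _ => rfl
  -- If the side avoids the open disc, P minimises the power along it. As t ≤ 1/2, a neighbourhood
  -- of P on both sides belongs to the segment, so the derivative vanishes and the side is tangent.
  have key : ∀ s, -t ≤ s → s ≤ t → 0 ≤ s * (2 * D) + s ^ 2 * ‖B - V‖ ^ 2 := by
    intro s h1 h2
    have hm : P + s • (B - V) ∈ segment ℝ V B := by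
      rw [segment_eq_image']
      exact ⟨t + s, ⟨by linarith, by linarith⟩, by simp only [hPdef]; module⟩
    have := hseg _ hm
    rw [power_add, hP, norm_smul, mul_pow, Real.norm_eq_abs, sq_abs, sm, sm] at this
    rw [hD]
    nlinarith
  have hD0 : D = 0 := by
    apply le_antisymm
    · refine nonpos_of_forall_quadratic ht hBpos fun s h0 h1 => ?_
      have := key (-s) (by linarith) (by linarith)
      nlinarith
    · have : -D ≤ 0 := by
        refine nonpos_of_forall_quadratic ht hBpos fun s h0 h1 => ?_
        have := key s (by linarith) (by linarith)
        nlinarith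
      linarith
  -- The disc lies on one side of the tangent; the element on that side, given or reflected, yields
  -- the contradiction.
  rcases le_total ((P 0 - c 0) * (T - V) 0 + (P 1 - c 1) * (T - V) 1) 0 with hs | hs
  · exact H.no_tangency_of_side hc hE ht ht2 htr hP hD0 hs
  · refine H.no_tangency_of_side hc hE' ht ht2 htr hP hD0 ?_
    rw [← hPdef]
    have e : (P 0 - c 0) * (V + B - T - V) 0 + (P 1 - c 1) * (V + B - T - V) 1 =
      D - ((P 0 - c 0) * (T - V) 0 + (P 1 - c 1) * (T - V) 1) := by
      rw [hD]; simp only [PiLp.sub_apply, PiLp.add_apply]; ring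
    rw [e, hD0]; linarith

end Admissible

/-- The defect in transporting the value of `v` from `P` to `V`. -/
def transportDefect (k : Plane) (v : Plane → ℂ) (P V : Plane) : ℂ :=
  v P * (1 + Complex.I * ((∑ j, k j * (P - V) j : ℝ) : ℂ)) - v V

theorem IsBlochGrad.normSq_transportDefect_le {k : Plane} {v : Plane → ℂ} {K : Set Plane}
    {G : Plane → EuclideanSpace ℂ (Fin 2)} (hG : IsBlochGrad k v K G) {x y : Plane} (hx : x ∈ K)
    (hy : y ∈ K) : ‖transportDefect k v x y‖ ^ 2 ≤ ‖G x‖ ^ 2 * ‖x - y‖ ^ 2 := by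
  rw [transportDefect, hG.transport x hx y hy]
  exact normSq_sum_mul_le _ _

theorem invConst_pos : 0 < invConst := lt_of_lt_of_le (by norm_num) invConst_ge

/-- Moving from P to V costs |P − V|²/|K_i| with |P − V|² ≤ 3t²h², and |K_i| in the given element
may be far smaller. But the ball of radius th/6 about P is covered by the two elements at VB, and
each subdomain takes up at least a quarter of its area there. One of the two elements holds half of
that, at least t²h²/96, whence 288 = 3 · 96. It may be used for the transport because P and V belong
to both. -/
theorem Admissible.normSq_transportDefect_le {d : Diagonal} {r : ℝ} {N : ℕ} {τ : ElemIndex N}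
    {c : Plane} (H : Admissible d r N) (hc : IsSite c) {k : Plane} {q : Fin 2 → Plane → ℂ}
    (hq : q ∈ femSpace d r N) (i : Fin 2) {V B T : Plane} (hE : IsElem d N τ V B T) {t : ℝ}
    (ht : 0 ≤ t) (ht2 : t ≤ 1 / 2) (htr : t * meshSize N ≤ r / 4)
    (hP : power c r (V + t • (B - V)) = 0) :
    ‖transportDefect k (q i) (V + t • (B - V)) V‖ ^ 2 ≤
      288 * invConst * ∑ τ' ∈ vertexStar d N V, elemEnergy k d r N q i τ' := by
  have hsum0 : 0 ≤ ∑ τ' ∈ vertexStar d N V, elemEnergy k d r N q i τ' :=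
    Finset.sum_nonneg fun _ _ => elemEnergy_nonneg _ _ _ _ _ _ _
  have hI := invConst_pos
  rcases ht.eq_or_lt with rfl | ht
  · simp only [transportDefect, zero_smul, add_zero, sub_self]
    simp
    positivity
  have hr := H.radius.1
  have R := hE.regular H.N_pos
  have hh := R.pos
  set h := meshSize N
  set P : Plane := V + t • (B - V) with hPdef
  have hPs : P ∈ Metric.sphere c r := (power_eq_zero_iff hr).1 hP
  have hPseg : P ∈ segment ℝ V B := by
    rw [segment_eq_image']; exact ⟨t, ⟨ht.le, by linarith⟩, rfl⟩
  obtain ⟨hS, hT⟩ := coord_mem_Ioo H.radius hc (Metric.sphere_subset_closedBall hPs)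
  -- The closed discs lie in the open cell, so a side through P has an element on either side.
  obtain ⟨τ', hE'⟩ := exists_neighbour H.N_pos hE hPseg hS hT
  have R' := hE'.regular H.N_pos
  -- A point of the open disc on the common side lies in both elements. That both meet the disc is
  -- needed for the inverse estimate and for identifying their parts.
  obtain ⟨y, hy, py⟩ := H.exists_neg_on_side hc hE hE' ht ht2 htr hP
  have hyb : y ∈ Metric.ball c r := (power_neg_iff hr).1 py
  have hseg_sub : ∀ {σ : ElemIndex N} {T' : Plane}, IsElem d N σ V B T' →
      segment ℝ V B ⊆ elem d N σ := by
    intro σ T' h x hx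
    have hR := h.regular H.N_pos
    rw [h.elem_eq]
    exact hR.isClosed_tri.frontier_subset (hR.seg_mem_frontier hx)
  -- the estimate on an element that contains a large part of the subdomain
  have main : ∀ {σ : ElemIndex N} {T' : Plane}, IsElem d N σ V B T' →
      Real.pi * (t * h / 6) ^ 2 / 8 ≤ partArea d r N σ i →
      ‖transportDefect k (q i) P V‖ ^ 2 ≤
        288 * invConst * ∑ τ' ∈ vertexStar d N V, elemEnergy k d r N q i τ' := by
    intro σ T' hσ hA
    have hPσ := hseg_sub hσ hPseg
    obtain ⟨G, hG⟩ := exists_isBlochGrad k ((hq i).2.1 σ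
      (H.mem_subdomainElems (Admissible.sphere_subset_interface hc hPs) hPσ i))
    have h1 := hG.normSq_transportDefect_le hPσ (hseg_sub hσ (left_mem_segment ℝ V B))
    have h2 := H.inverse_energy hc ⟨y, hseg_sub hσ hy, hyb⟩ hG hPσ hPs
    have h3 : ‖P - V‖ ^ 2 ≤ t ^ 2 * (3 * h ^ 2) := by
      rw [hPdef, add_sub_cancel_left, norm_smul, mul_pow, Real.norm_eq_abs, sq_abs]
      gcongr
      exact (hσ.regular H.N_pos).AB_le
    have h4 : elemEnergy k d r N q i σ ≤ ∑ τ' ∈ vertexStar d N V, elemEnergy k d r N q i τ' :=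
      Finset.single_le_sum (f := fun τ' => elemEnergy k d r N q i τ')
        (fun _ _ => elemEnergy_nonneg _ _ _ _ _ _ _) (mem_vertexStar.2 hσ.mem_range.1)
    have hpi := Real.pi_gt_three
    have h5 : t ^ 2 * h ^ 2 / 96 ≤ partArea d r N σ i := by
      refine le_trans ?_ hA
      have : 0 < (t * h) ^ 2 := by positivity
      nlinarith
    have h6 : ‖G P‖ ^ 2 * (t ^ 2 * h ^ 2 / 96) ≤ invConst * elemEnergy k d r N q i σ :=
      le_trans (by gcongr) h2
    calc ‖transportDefect k (q i) P V‖ ^ 2 ≤ ‖G P‖ ^ 2 * (t ^ 2 * (3 * h ^ 2)) :=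
          h1.trans (by gcongr)
      _ = 288 * (‖G P‖ ^ 2 * (t ^ 2 * h ^ 2 / 96)) := by ring
      _ ≤ 288 * (invConst * elemEnergy k d r N q i σ) := by gcongr
      _ ≤ 288 * (invConst * ∑ τ' ∈ vertexStar d N V, elemEnergy k d r N q i τ') := by gcongr
      _ = _ := by ring
  have hsubU : Metric.ball P (t * h / 6) ⊆ elem d N τ ∪ elem d N τ' := by
    rw [hE.elem_eq, hE'.elem_eq]
    exact ball_subset_tri_union R ht ht2
  have hUfin : volume (elem d N τ ∪ elem d N τ') ≠ ⊤ :=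
    ((isCompact_elem d N τ).union (isCompact_elem d N τ')).measure_ne_top
  obtain ⟨v0, v1⟩ := half_ball_volume hr hPs (ρ := t * h / 6) (by positivity) (by linarith) hUfin hsubU
  have hne : (elem d N τ ∩ Metric.ball c r).Nonempty := ⟨y, hseg_sub hE hy, hyb⟩
  have hne' : (elem d N τ' ∩ Metric.ball c r).Nonempty := ⟨y, hseg_sub hE' hy, hyb⟩
  have hsplit : Real.pi * (t * h / 6) ^ 2 / 4 ≤ partArea d r N τ i + partArea d r N τ' i := by
    fin_cases i
    · refine v0.trans ?_
      rw [Set.union_inter_distrib_right, ← H.inter_subdomain_zero hc hne,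
        ← H.inter_subdomain_zero hc hne']
      exact measureReal_union_le _ _
    · refine v1.trans ?_
      rw [Set.union_sdiff_distrib, ← H.inter_subdomain_one hc hne,
        ← H.inter_subdomain_one hc hne']
      exact measureReal_union_le _ _
  rcases le_total (Real.pi * (t * h / 6) ^ 2 / 8) (partArea d r N τ i) with hA | hA
  · exact main hE hA
  · exact main hE' (by linarith)

end UnfittedNitsche
end

noncomputable section
namespace UnfittedNitsche

/-! ### Short arcs -/

/-- A trigonometric polynomial that vanishes at the left end of an interval on which it is
nonnegative is large at the midpoint. -/
theorem trig_mid_ge {β A B a w : ℝ} (hw : 0 < w) (hw1 : w < Real.pi / 2)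
    (h0 : β + A * Real.cos a + B * Real.sin a = 0)
    (hnn : ∀ θ, a ≤ θ → θ ≤ a + 2 * w → 0 ≤ β + A * Real.cos θ + B * Real.sin θ) :
    0 ≤ β + A * Real.cos (a + w) + B * Real.sin (a + w) ∧
    (1 - Real.cos w) ^ 2 * (A ^ 2 + B ^ 2) ≤
      (β + A * Real.cos (a + w) + B * Real.sin (a + w)) ^ 2 := by
  -- For f with f(a) = 0, sum-to-product formulas give f(a + 2s) = 2 sin s · f'(a + s), so f' is
  -- nonnegative on (a, a + w].
  have hder : ∀ s, 0 < s → s ≤ w → 0 ≤ -A * Real.sin (a + s) + B * Real.cos (a + s) := by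
    intro s hs hsw
    have h1 := hnn (a + 2 * s) (by linarith) (by linarith)
    have hsin : 0 < Real.sin s := Real.sin_pos_of_pos_of_lt_pi hs (by linarith)
    have e : β + A * Real.cos (a + 2 * s) + B * Real.sin (a + 2 * s) =
        2 * Real.sin s * (-A * Real.sin (a + s) + B * Real.cos (a + s)) := by
      rw [Real.cos_add, Real.sin_add, Real.cos_add, Real.sin_add, Real.cos_two_mul,
        Real.sin_two_mul]
      linear_combination h0 + 2 * (A * Real.cos a + B * Real.sin a) * Real.sin_sq_add_cos_sq s
    rw [e] at h1
    exact nonneg_of_mul_nonneg_right h1 (by positivity)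
  have hder0 : 0 ≤ -A * Real.sin a + B * Real.cos a := by
    have ht : Filter.Tendsto (fun s => -A * Real.sin (a + s) + B * Real.cos (a + s))
        (nhdsWithin 0 (Set.Ioi 0)) (nhds (-A * Real.sin (a + 0) + B * Real.cos (a + 0))) := by
      have : Continuous (fun s => -A * Real.sin (a + s) + B * Real.cos (a + s)) := by fun_prop
      exact (this.tendsto 0).mono_left nhdsWithin_le_nhds
    rw [add_zero] at ht
    refine ge_of_tendsto ht ?_
    filter_upwards [Ioc_mem_nhdsGT hw] with s hs
    exact hder s hs.1 hs.2
  have hY := hder w hw le_rfl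
  set X := A * Real.cos (a + w) + B * Real.sin (a + w) with hX
  set Y := -A * Real.sin (a + w) + B * Real.cos (a + w) with hYd
  set S := Real.sin (w / 2)
  set K := Real.cos (w / 2)
  have hS : 0 < S := Real.sin_pos_of_pos_of_lt_pi (by linarith) (by linarith)
  have hK : 0 < K := Real.cos_pos_of_mem_Ioo ⟨by linarith, by linarith⟩
  have hSK : S ^ 2 + K ^ 2 = 1 := Real.sin_sq_add_cos_sq _
  have hcw : Real.cos w = K ^ 2 - S ^ 2 := by
    rw [show w = 2 * (w / 2) by ring, Real.cos_two_mul']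
  have hsw : Real.sin w = 2 * S * K := by
    rw [show w = 2 * (w / 2) by ring, Real.sin_two_mul]
  have ea : a = (a + w) - w := by ring
  have e1 : -A * Real.sin a + B * Real.cos a = X * (2 * S * K) + Y * (K ^ 2 - S ^ 2) := by
    rw [← hsw, ← hcw, hX, hYd]
    conv_lhs => rw [ea, Real.sin_sub, Real.cos_sub]
    ring
  have e2 : β + X = 2 * S * (X * S + Y * K) := by
    have : β = -(X * Real.cos w - Y * Real.sin w) := by
      rw [hX, hYd]
      rw [ea, Real.sin_sub, Real.cos_sub] at h0
      linear_combination h0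
    rw [this, hcw, hsw]
    linear_combination -X * hSK
  have e3 : β + A * Real.cos (a + w) + B * Real.sin (a + w) = β + X := by rw [hX]; ring
  have e4 : A ^ 2 + B ^ 2 = X ^ 2 + Y ^ 2 := by
    rw [hX, hYd]
    linear_combination -(A ^ 2 + B ^ 2) * Real.sin_sq_add_cos_sq (a + w)
  have e5 : 1 - Real.cos w = 2 * S ^ 2 := by rw [hcw]; linear_combination -hSK
  rw [e1] at hder0
  have hD : 0 ≤ X * S + Y * K := by
    have : 0 ≤ 2 * K * (X * S + Y * K) := by
      have : 2 * K * (X * S + Y * K) = (X * (2 * S * K) + Y * (K ^ 2 - S ^ 2)) + Y := by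
        linear_combination Y * hSK
      rw [this]; positivity
    exact nonneg_of_mul_nonneg_right this (by positivity)
  rw [e3, e2, e4, e5]
  refine ⟨by positivity, ?_⟩
  -- The difference is the product of the derivatives of f at the midpoint and at a, both
  -- nonnegative. In geometric terms, the midpoint of an arc starting on a line and staying on one
  -- side is at least the sagitta away from the line.
  have : (X * S + Y * K) ^ 2 - S ^ 2 * (X ^ 2 + Y ^ 2) =
      Y * (X * (2 * S * K) + Y * (K ^ 2 - S ^ 2)) := by ring
  have h6 : 0 ≤ Y * (X * (2 * S * K) + Y * (K ^ 2 - S ^ 2)) := mul_nonneg hY hder0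
  have h7 : (2 * S ^ 2) ^ 2 * (X ^ 2 + Y ^ 2) = (2 * S) ^ 2 * (S ^ 2 * (X ^ 2 + Y ^ 2)) := by ring
  rw [h7, mul_pow (2 * S)]
  exact mul_le_mul_of_nonneg_left (by linarith) (sq_nonneg _)

/-- The gradient of the barycentric coordinate of the third vertex. -/
def baryGrad (A B C : Plane) : Plane :=
  (det2 (B - A) (C - A))⁻¹ • !₂[-(B - A) 1, (B - A) 0]

theorem bary_sub (A B C x y : Plane) :
    bary A B C y - bary A B C x =
      baryGrad A B C 0 * (y 0 - x 0) + baryGrad A B C 1 * (y 1 - x 1) := by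
  simp [bary, baryGrad, det2]
  ring

theorem bary_nonneg_of_sq_le {A B C x y : Plane} {ρ : ℝ} (hy : ‖y - x‖ ≤ ρ)
    (h0 : 0 ≤ bary A B C x) (h : ρ ^ 2 * ‖baryGrad A B C‖ ^ 2 ≤ bary A B C x ^ 2) :
    0 ≤ bary A B C y := by
  have e := bary_sub A B C x y
  rw [normSq_eq] at h
  have h1 : ‖y - x‖ ^ 2 ≤ ρ ^ 2 := by gcongr
  rw [normSq_eq, PiLp.sub_apply, PiLp.sub_apply] at h1
  set n0 := baryGrad A B C 0
  set n1 := baryGrad A B C 1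
  have h2 : (n0 * (y 0 - x 0) + n1 * (y 1 - x 1)) ^ 2 ≤ bary A B C x ^ 2 := by
    refine le_trans ?_ h
    have : (n0 * (y 0 - x 0) + n1 * (y 1 - x 1)) ^ 2 ≤
        ((y 0 - x 0) ^ 2 + (y 1 - x 1) ^ 2) * (n0 ^ 2 + n1 ^ 2) := by
      nlinarith [sq_nonneg (n0 * (y 1 - x 1) - n1 * (y 0 - x 0))]
    exact this.trans (by gcongr)
  have := abs_le_of_sq_le_sq' h2 h0
  linarith [this.1]

theorem bary_circ (A B C c : Plane) (r θ : ℝ) :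
    bary A B C (circ c r θ) = bary A B C c + r * baryGrad A B C 0 * Real.cos θ +
      r * baryGrad A B C 1 * Real.sin θ := by
  have := bary_sub A B C c (circ c r θ)
  rw [circ_zero, circ_one] at this
  linarith

/-- Along the circle the coordinate is a trigonometric polynomial whose amplitude is r times the
length of its gradient. The lower bound at the midpoint is therefore a distance to the side, and the
ball of that radius does not cross it. -/
theorem bary_nonneg_of_left {A B C c : Plane} {r a w : ℝ} (hw : 0 < w)
    (hw1 : w < Real.pi / 2) (h0 : bary A B C (circ c r a) = 0)
    (hnn : ∀ θ, a ≤ θ → θ ≤ a + 2 * w → 0 ≤ bary A B C (circ c r θ)) {y : Plane}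
    (hy : ‖y - circ c r (a + w)‖ ≤ r * (1 - Real.cos w)) : 0 ≤ bary A B C y := by
  obtain ⟨h1, h2⟩ := trig_mid_ge hw hw1 (β := bary A B C c) (A := r * baryGrad A B C 0)
    (B := r * baryGrad A B C 1) (by rw [← bary_circ]; exact h0)
    (fun θ h1 h2 => by rw [← bary_circ]; exact hnn θ h1 h2)
  rw [← bary_circ] at h1 h2
  refine bary_nonneg_of_sq_le hy h1 (le_trans (le_of_eq ?_) h2)
  rw [normSq_eq]; ring

/-- Reversing the angle interchanges the two ends of the arc. -/
theorem bary_nonneg_of_right {A B C c : Plane} {r a w : ℝ} (hw : 0 < w)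
    (hw1 : w < Real.pi / 2) (h0 : bary A B C (circ c r (a + 2 * w)) = 0)
    (hnn : ∀ θ, a ≤ θ → θ ≤ a + 2 * w → 0 ≤ bary A B C (circ c r θ)) {y : Plane}
    (hy : ‖y - circ c r (a + w)‖ ≤ r * (1 - Real.cos w)) : 0 ≤ bary A B C y := by
  have hcirc : ∀ θ, bary A B C (circ c r θ) = bary A B C c + r * baryGrad A B C 0 * Real.cos (-θ) +
      -(r * baryGrad A B C 1) * Real.sin (-θ) := by
    intro θ; rw [bary_circ, Real.cos_neg, Real.sin_neg]; ring
  obtain ⟨h1, h2⟩ := trig_mid_ge hw hw1 (a := -(a + 2 * w)) (β := bary A B C c)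
    (A := r * baryGrad A B C 0) (B := -(r * baryGrad A B C 1)) (by rw [← hcirc]; exact h0)
    (fun θ h1 h2 => by
      have := hnn (-θ) (by linarith) (by linarith)
      rwa [hcirc, neg_neg] at this)
  rw [show -(a + 2 * w) + w = -(a + w) by ring, ← hcirc] at h1 h2
  refine bary_nonneg_of_sq_le hy h1 (le_trans (le_of_eq ?_) h2)
  rw [normSq_eq]; ring

/-- The Gram bound gives s² + t² ≤ 8D², and 8 < 9. -/
theorem RegularTri.param_le {h : ℝ} {V B T : Plane} (R : RegularTri h V B T) {s t D : ℝ}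
    (hD : 0 ≤ D)
    (h1 : ‖(V + s • (B - V)) - (V + t • (T - V))‖ ≤ D * h) : s ≤ 3 * D ∧ t ≤ 3 * D := by
  have hh := R.pos
  have h2 := R.norm_comb_ge s (-t)
  rw [show s • (B - V) + (-t) • (T - V) = (V + s • (B - V)) - (V + t • (T - V)) by module] at h2
  have h3 : ‖(V + s • (B - V)) - (V + t • (T - V))‖ ^ 2 ≤ (D * h) ^ 2 := by gcongr
  have h4 : h ^ 2 * (s ^ 2 + t ^ 2) ≤ h ^ 2 * (8 * D ^ 2) := by nlinarith
  have h5 := le_of_mul_le_mul_left h4 (by positivity)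
  constructor
  · refine le_of_sq_le_sq ?_ (by positivity); nlinarith
  · refine le_of_sq_le_sq ?_ (by positivity); nlinarith

theorem RegularTri.bary_sub_sq_le {h : ℝ} {V B T : Plane} (R : RegularTri h V B T) (x y : Plane) :
    h ^ 2 * (bary B T V y - bary B T V x) ^ 2 ≤ 16 * ‖y - x‖ ^ 2 := by
  have hx := R.bary_rec x
  have hy := R.bary_rec y
  have sx := R.bary_sum x
  have sy := R.bary_sum y
  set u := bary B T V x
  set v := bary T V B x
  set w := bary V B T x
  set u' := bary B T V y
  set v' := bary T V B y
  set w' := bary V B T y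
  have e : y - x = (v' - v) • (B - V) + (w' - w) • (T - V) := by
    rw [hx, hy, show u = 1 - v - w by linarith, show u' = 1 - v' - w' by linarith]; module
  have h2 := R.norm_comb_ge (v' - v) (w' - w)
  rw [← e] at h2
  have e2 : u' - u = -((v' - v) + (w' - w)) := by linarith
  rw [e2]
  have : 0 ≤ h ^ 2 * ((v' - v) - (w' - w)) ^ 2 := by positivity
  nlinarith

theorem one_sub_cos_le {w : ℝ} (hw0 : 0 ≤ w) (hw2 : w ≤ 2) : 1 - Real.cos w ≤ w := by
  have := Real.one_sub_sq_div_two_le_cos (x := w)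
  nlinarith

/-- The triangle contains a ball around the midpoint of a short arc between two of its sides. -/
theorem RegularTri.closedBall_mid_subset {h : ℝ} {V B T c : Plane} (R : RegularTri h V B T)
    {r a w s t : ℝ} (hr : 0 < r) (hw : 0 < w) (hw1 : w ≤ 1)
    (hP : circ c r a = V + s • (B - V)) (hQ : circ c r (a + 2 * w) = V + t • (T - V))
    (harc : ∀ θ, a ≤ θ → θ ≤ a + 2 * w → circ c r θ ∈ tri V B T) (hshort : r * (2 * w) ≤ h / 8) :
    Metric.closedBall (circ c r (a + w)) (r * (1 - Real.cos w)) ⊆ tri V B T := by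
  intro y hy
  rw [mem_closedBall_iff_norm] at hy
  have hh := R.pos
  have hwpi : w < Real.pi / 2 := by linarith [Real.pi_gt_three]
  have hPQ : ‖circ c r a - circ c r (a + 2 * w)‖ ≤ 1 / 8 * h := by
    refine (norm_circ_sub_le hr _ _).trans ?_
    rw [show a - (a + 2 * w) = -(2 * w) by ring, abs_neg, abs_of_nonneg (by linarith)]
    linarith
  rw [hP, hQ] at hPQ
  have hst := R.param_le (by norm_num) hPQ
  rw [R.mem_tri_iff]
  refine ⟨?_, ?_, ?_⟩
  -- The side opposite V is far: P has V-coordinate 1 − s ≥ 5/8, and y is within h/8 of P, which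
  -- changes the coordinate by at most 1/2.
  · have h1 : bary B T V (circ c r a) = 1 - s := by
      rw [hP]
      have e : V + s • (B - V) = s • B + (0 : ℝ) • T + (1 - s) • V := by module
      rw [e, R.rotate.bary_comb (by ring)]
    have h2 := R.bary_sub_sq_le (circ c r a) y
    have h3 : ‖y - circ c r a‖ ≤ h / 8 := by
      have h4 := norm_sub_le_norm_sub_add_norm_sub y (circ c r (a + w)) (circ c r a)
      have h5 := norm_circ_sub_le hr (c := c) (a + w) a
      rw [show a + w - a = w by ring, abs_of_pos hw] at h5
      have h6 := one_sub_cos_le hw.le (by linarith)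
      have h7 : r * (1 - Real.cos w) ≤ r * w := by gcongr
      linarith
    have h4 : ‖y - circ c r a‖ ^ 2 ≤ (h / 8) ^ 2 := by gcongr
    have h5 : h ^ 2 * (bary B T V y - bary B T V (circ c r a)) ^ 2 ≤ h ^ 2 * (1 / 2) ^ 2 := by
      nlinarith
    have h6 := abs_le_of_sq_le_sq' (le_of_mul_le_mul_left h5 (by positivity)) (by norm_num)
    rw [h1] at h6
    linarith [h6.1, hst.1]
  -- The other two sides contain the ends of the arc, each treated from its own end.
  · refine bary_nonneg_of_right hw hwpi ?_ (fun θ h1 h2 => ?_) hy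
    · rw [hQ, show V + t • (T - V) = t • T + (1 - t) • V + (0 : ℝ) • B by module,
        R.rotate.rotate.bary_comb (by ring)]
    · exact ((R.mem_tri_iff _).1 (harc θ h1 h2)).2.1
  · refine bary_nonneg_of_left hw hwpi ?_ (fun θ h1 h2 => ?_) hy
    · rw [hP, show V + s • (B - V) = (1 - s) • V + s • B + (0 : ℝ) • T by module,
        R.bary_comb (by ring)]
    · exact ((R.mem_tri_iff _).1 (harc θ h1 h2)).2.2

/-- A point of a circular arc lies near the chord of the arc. -/
theorem exists_chord_point {c : Plane} {r m w δ : ℝ} (hr : 0 < r) (hw1 : w ≤ 1)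
    (hδ : |δ| < w) :
    ∃ α : ℝ, 0 ≤ α ∧ α ≤ 1 ∧
      ‖circ c r (m + δ) - (α • circ c r (m - w) + (1 - α) • circ c r (m + w))‖ ≤
        r * (1 - Real.cos w) := by
  have hpi := Real.pi_gt_three
  rw [abs_lt] at hδ
  have hw : 0 < w := by linarith
  have hA : 0 < Real.sin (w - δ) := Real.sin_pos_of_pos_of_lt_pi (by linarith) (by linarith)
  have hB : 0 < Real.sin (w + δ) := Real.sin_pos_of_pos_of_lt_pi (by linarith) (by linarith)
  have hCw : 0 < Real.cos w := Real.cos_pos_of_mem_Ioo ⟨by linarith, by linarith⟩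
  have hSw : 0 < Real.sin w := Real.sin_pos_of_pos_of_lt_pi (by linarith) (by linarith)
  have hCδ : 0 < Real.cos δ := Real.cos_pos_of_mem_Ioo ⟨by linarith, by linarith⟩
  have hle : Real.cos w ≤ Real.cos δ := by
    rw [← Real.cos_abs δ]
    exact Real.cos_le_cos_of_nonneg_of_le_pi (abs_nonneg _) (by linarith)
      (abs_le.2 ⟨by linarith, by linarith⟩)
  have hsum : Real.sin (w - δ) + Real.sin (w + δ) = 2 * Real.sin w * Real.cos δ := by
    rw [Real.sin_sub, Real.sin_add]; ring
  -- This is the point where the radius through the arc point meets the chord; its distance from the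
  -- centre is r cos w / cos δ.
  refine ⟨Real.sin (w - δ) / (2 * Real.sin w * Real.cos δ), by positivity, ?_, ?_⟩
  · rw [div_le_one (by positivity)]; linarith
  have hα : 1 - Real.sin (w - δ) / (2 * Real.sin w * Real.cos δ) =
      Real.sin (w + δ) / (2 * Real.sin w * Real.cos δ) := by
    rw [eq_div_iff (by positivity), sub_mul, div_mul_cancel₀ _ (by positivity)]; linarith
  have e : circ c r (m + δ) - ((Real.sin (w - δ) / (2 * Real.sin w * Real.cos δ)) • circ c r (m - w) +
      (1 - Real.sin (w - δ) / (2 * Real.sin w * Real.cos δ)) • circ c r (m + w)) =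
      (1 - Real.cos w / Real.cos δ) • (circ c r (m + δ) - c) := by
    have e0 : Real.sin (w - δ) * Real.cos (m - w) + Real.sin (w + δ) * Real.cos (m + w) =
        2 * Real.sin w * Real.cos w * Real.cos (m + δ) := by
      simp only [Real.sin_sub, Real.sin_add, Real.cos_sub, Real.cos_add]; ring
    have e1 : Real.sin (w - δ) * Real.sin (m - w) + Real.sin (w + δ) * Real.sin (m + w) =
        2 * Real.sin w * Real.cos w * Real.sin (m + δ) := by
      simp only [Real.sin_sub, Real.sin_add]; ring
    have hsum' : Real.sin (w - δ) = 2 * Real.sin w * Real.cos δ - Real.sin (w + δ) := by linarith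
    rw [hα]
    refine plane_ext ?_ ?_
    · simp only [PiLp.sub_apply, PiLp.add_apply, PiLp.smul_apply, smul_eq_mul, circ_zero]
      field_simp
      linear_combination -c 0 * hsum - r * e0
    · simp only [PiLp.sub_apply, PiLp.add_apply, PiLp.smul_apply, smul_eq_mul, circ_one]
      field_simp
      linear_combination -c 1 * hsum - r * e1
  rw [e, norm_smul, ← dist_eq_norm (circ c r (m + δ)) c, (circ_mem_sphere hr (m + δ) :
    dist (circ c r (m + δ)) c = r), Real.norm_eq_abs, abs_of_nonneg, mul_comm]
  · gcongr
    rw [le_div_iff₀ hCδ]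
    nlinarith [Real.cos_le_one δ]
  · rw [sub_nonneg, div_le_one hCδ]; exact hle

/-! ### Transport of jumps and the estimate on a short arc -/

theorem norm_one_add_I_mul_sq (s : ℝ) : ‖1 + Complex.I * (s : ℂ)‖ ^ 2 = 1 + s ^ 2 := by
  rw [Complex.sq_norm, Complex.normSq_apply]; simp; ring

theorem normSq_add_three_le (a b c : ℂ) :
    ‖a + b - c‖ ^ 2 ≤ 3 * (‖a‖ ^ 2 + ‖b‖ ^ 2 + ‖c‖ ^ 2) := by
  have h : ‖a + b - c‖ ≤ ‖a‖ + ‖b‖ + ‖c‖ := (norm_sub_le _ _).trans (by gcongr; exact norm_add_le _ _)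
  have h2 : ‖a + b - c‖ ^ 2 ≤ (‖a‖ + ‖b‖ + ‖c‖) ^ 2 := by gcongr
  nlinarith [sq_nonneg (‖a‖ - ‖b‖), sq_nonneg (‖b‖ - ‖c‖), sq_nonneg (‖a‖ - ‖c‖)]

/-- The factor 1 + i k·(x−y) has modulus at least 1, so this direction involves no constant
depending on k. -/
theorem normSq_jump_le (k : Plane) (q : Fin 2 → Plane → ℂ) (x y : Plane) :
    ‖jump q x‖ ^ 2 ≤ 3 * (‖jump q y‖ ^ 2 + ‖transportDefect k (q 0) x y‖ ^ 2 +
      ‖transportDefect k (q 1) x y‖ ^ 2) := by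
  have e : jump q x * (1 + Complex.I * ((∑ j, k j * (x - y) j : ℝ) : ℂ)) =
      jump q y + transportDefect k (q 0) x y - transportDefect k (q 1) x y := by
    simp only [jump, transportDefect]; ring
  refine le_trans ?_ (normSq_add_three_le _ _ _)
  rw [← e, norm_mul, mul_pow, norm_one_add_I_mul_sq]
  nlinarith [sq_nonneg ‖jump q x‖, sq_nonneg (∑ j, k j * (x - y) j),
    mul_nonneg (sq_nonneg ‖jump q x‖) (sq_nonneg (∑ j, k j * (x - y) j))]

/-- In the reverse direction the modulus of 1 + i k·(x−y) has to be bounded above. -/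
theorem normSq_jump_le' (k : Plane) (q : Fin 2 → Plane → ℂ) (x y : Plane) :
    ‖jump q y‖ ^ 2 ≤ 3 * ((1 + ‖k‖ ^ 2 * ‖x - y‖ ^ 2) * ‖jump q x‖ ^ 2 +
      ‖transportDefect k (q 0) x y‖ ^ 2 + ‖transportDefect k (q 1) x y‖ ^ 2) := by
  have e : jump q y = jump q x * (1 + Complex.I * ((∑ j, k j * (x - y) j : ℝ) : ℂ)) +
      transportDefect k (q 1) x y - transportDefect k (q 0) x y := by
    simp only [jump, transportDefect]; ring
  have h := normSq_add_three_le (jump q x * (1 + Complex.I * ((∑ j, k j * (x - y) j : ℝ) : ℂ)))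
    (transportDefect k (q 1) x y) (transportDefect k (q 0) x y)
  rw [← e, norm_mul, mul_pow, norm_one_add_I_mul_sq] at h
  have hcs : (∑ j, k j * (x - y) j) ^ 2 ≤ ‖k‖ ^ 2 * ‖x - y‖ ^ 2 := by
    rw [EuclideanSpace.real_norm_sq_eq, EuclideanSpace.real_norm_sq_eq]
    exact Finset.sum_mul_sq_le_sq_mul_sq _ _ _
  have h3 : ‖jump q x‖ ^ 2 * (1 + (∑ j, k j * (x - y) j) ^ 2) ≤
      ‖jump q x‖ ^ 2 * (1 + ‖k‖ ^ 2 * ‖x - y‖ ^ 2) := by gcongr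
  linarith

theorem IsAffineOn.convex_comb {v : Plane → ℂ} {K : Set Plane} (hv : IsAffineOn v K) {x y : Plane}
    (hx : x ∈ K) (hy : y ∈ K) {α : ℝ} (hm : α • x + (1 - α) • y ∈ K) :
    v (α • x + (1 - α) • y) = α * v x + (1 - α) * v y := by
  obtain ⟨c, g, hg⟩ := hv
  rw [hg _ hm, hg x hx, hg y hy]
  simp only [Fin.sum_univ_two, PiLp.add_apply, PiLp.smul_apply, smul_eq_mul]
  push_cast
  ring

theorem IsAffineOn.jump {q : Fin 2 → Plane → ℂ} {K : Set Plane} (h0 : IsAffineOn (q 0) K)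
    (h1 : IsAffineOn (q 1) K) : IsAffineOn (jump q) K := by
  obtain ⟨c, g, hg⟩ := h0
  obtain ⟨c', g', hg'⟩ := h1
  refine ⟨c - c', g - g', fun x hx => ?_⟩
  rw [UnfittedNitsche.jump, hg x hx, hg' x hx]
  simp only [Fin.sum_univ_two, Pi.sub_apply]
  ring

theorem normSq_convex_comb_le {α : ℝ} (h0 : 0 ≤ α) (h1 : α ≤ 1) (z w : ℂ) :
    ‖(α : ℂ) * z + (1 - α) * w‖ ^ 2 ≤ ‖z‖ ^ 2 + ‖w‖ ^ 2 := by
  have h : ‖(α : ℂ) * z + (1 - α) * w‖ ≤ α * ‖z‖ + (1 - α) * ‖w‖ := by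
    refine (norm_add_le _ _).trans (le_of_eq ?_)
    rw [norm_mul, norm_mul, Complex.norm_real, Real.norm_of_nonneg h0,
      show (1 - α : ℂ) = ((1 - α : ℝ) : ℂ) by push_cast; rfl, Complex.norm_real,
      Real.norm_of_nonneg (by linarith)]
  have h2 : ‖(α : ℂ) * z + (1 - α) * w‖ ^ 2 ≤ (α * ‖z‖ + (1 - α) * ‖w‖) ^ 2 := by gcongr
  have h3 : 0 ≤ α * (1 - α) * (‖z‖ - ‖w‖) ^ 2 :=
    mul_nonneg (mul_nonneg h0 (by linarith)) (sq_nonneg _)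
  nlinarith [mul_nonneg h0 (sq_nonneg ‖w‖), mul_nonneg (sub_nonneg.2 h1) (sq_nonneg ‖z‖)]

namespace Admissible

variable {d : Diagonal} {r : ℝ} {N : ℕ} {τ : ElemIndex N} {c : Plane}

theorem inter_ball_nonempty (H : Admissible d r N) {x : Plane} (hx : x ∈ interior (elem d N τ))
    (hxc : x ∈ Metric.sphere c r) : (elem d N τ ∩ Metric.ball c r).Nonempty := by
  have : x ∈ closure (Metric.ball c r) := by
    rw [closure_ball c H.radius.1.ne']; exact Metric.sphere_subset_closedBall hxc
  obtain ⟨y, h1, h2⟩ := mem_closure_iff.1 this _ isOpen_interior hx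
  exact ⟨y, interior_subset h1, h2⟩

theorem isAffineOn_jump (H : Admissible d r N) {q : Fin 2 → Plane → ℂ} (hq : q ∈ femSpace d r N)
    {x : Plane} (hx : x ∈ interface r) (hxτ : x ∈ elem d N τ) :
    IsAffineOn (jump q) (elem d N τ) :=
  .jump ((hq 0).2.1 τ (H.mem_subdomainElems hx hxτ 0)) ((hq 1).2.1 τ (H.mem_subdomainElems hx hxτ 1))

/-- On a short arc the jump is controlled by the jumps at the ends and the energy. -/
theorem normSq_jump_le_of_short_arc (H : Admissible d r N) (hc : IsSite c) (k : Plane)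
    {q : Fin 2 → Plane → ℂ} (hq : q ∈ femSpace d r N) {V B T : Plane} (hE : IsElem d N τ V B T)
    {m w δ s t : ℝ} (hw1 : w ≤ 1) (hδ : |δ| < w)
    (hP : circ c r (m - w) = V + s • (B - V)) (hQ : circ c r (m + w) = V + t • (T - V))
    (harc : ∀ θ, m - w ≤ θ → θ ≤ m + w → circ c r θ ∈ elem d N τ)
    (hx : circ c r (m + δ) ∈ interior (elem d N τ)) (hshort : r * (2 * w) ≤ meshSize N / 8) :
    ‖jump q (circ c r (m + δ))‖ ^ 2 ≤
      3 * (‖jump q (circ c r (m - w))‖ ^ 2 + ‖jump q (circ c r (m + w))‖ ^ 2 +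
        2 * invConst * (elemEnergy k d r N q 0 τ + elemEnergy k d r N q 1 τ)) := by
  have hr := H.radius.1
  have hw : 0 < w := (abs_nonneg δ).trans_lt hδ
  have R := hE.regular H.N_pos
  have hball : Metric.closedBall (circ c r m) (r * (1 - Real.cos w)) ⊆ elem d N τ := by
    have := R.closedBall_mid_subset (c := c) (a := m - w) hr hw hw1 hP
      (by rw [show m - w + 2 * w = m + w by ring]; exact hQ)
      (fun θ h1 h2 => by rw [← hE.elem_eq]; exact harc θ h1 (by linarith)) hshort
    rwa [show m - w + w = m by ring, ← hE.elem_eq] at this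
  have hcw : 0 < 1 - Real.cos w := by
    have := Real.cos_lt_cos_of_nonneg_of_le_pi le_rfl (by linarith [Real.pi_gt_three]) hw
    rw [Real.cos_zero] at this
    linarith
  have hcw1 : 1 - Real.cos w ≤ 1 := by
    have := Real.cos_nonneg_of_mem_Icc (x := w)
      ⟨by linarith [Real.pi_gt_three], by linarith [Real.pi_gt_three]⟩
    linarith
  set ρ := r * (1 - Real.cos w) with hρ
  have hρ0 : 0 < ρ := by positivity
  have hne := H.inter_ball_nonempty hx (circ_mem_sphere hr _)
  -- Both parts of the element have area at least πρ²/4, where ρ is the sagitta. The arc is within ρ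
  -- of its chord, so transport to the chord costs a fixed multiple of the energy, however short the
  -- arc.
  have hvol := half_ball_volume hr (circ_mem_sphere hr m) hρ0.le (by nlinarith)
    (isCompact_elem d N τ).measure_ne_top (Metric.ball_subset_closedBall.trans hball)
  rw [← H.inter_subdomain_zero hc hne, ← H.inter_subdomain_one hc hne] at hvol
  obtain ⟨α, hα0, hα1, hα⟩ := exists_chord_point (c := c) (m := m) hr hw1 hδ
  have hPτ := harc (m - w) le_rfl (by linarith)
  have hQτ := harc (m + w) (by linarith) le_rfl
  have hxτ := interior_subset hx
  have hmem : α • circ c r (m - w) + (1 - α) • circ c r (m + w) ∈ elem d N τ :=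
    convex_elem d N τ hPτ hQτ hα0 (by linarith) (by ring)
  have hxi : circ c r (m + δ) ∈ interface r := sphere_subset_interface hc (circ_mem_sphere hr _)
  have hJ := normSq_convex_comb_le hα0 hα1 (jump q (circ c r (m - w))) (jump q (circ c r (m + w)))
  rw [← (H.isAffineOn_jump hq hxi hxτ).convex_comb hPτ hQτ hmem] at hJ
  have hdef : ∀ i, ‖transportDefect k (q i) (circ c r (m + δ))
      (α • circ c r (m - w) + (1 - α) • circ c r (m + w))‖ ^ 2 ≤
      2 * invConst * elemEnergy k d r N q i τ := by
    intro i
    obtain ⟨G, hG⟩ := exists_isBlochGrad k ((hq i).2.1 τ (H.mem_subdomainElems hxi hxτ i))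
    have h1 := hG.normSq_transportDefect_le hxτ hmem
    have h2 := H.inverse_energy hc hne hG hxτ (circ_mem_sphere hr _)
    have h3 : ρ ^ 2 ≤ 2 * partArea d r N τ i := by
      have : Real.pi * ρ ^ 2 / 4 ≤ partArea d r N τ i := by
        fin_cases i
        · exact hvol.1
        · exact hvol.2
      nlinarith [Real.pi_gt_three, sq_nonneg ρ]
    calc _ ≤ _ := h1
      _ ≤ ‖G (circ c r (m + δ))‖ ^ 2 * ρ ^ 2 := by gcongr
      _ ≤ ‖G (circ c r (m + δ))‖ ^ 2 * (2 * partArea d r N τ i) := by gcongr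
      _ ≤ _ := by linarith
  refine (normSq_jump_le k q _ (α • circ c r (m - w) + (1 - α) • circ c r (m + w))).trans ?_
  have h0 := hdef 0
  have h1 := hdef 1
  linarith

end Admissible

end UnfittedNitsche
end

noncomputable section
namespace UnfittedNitsche

/-! ### Size of the elements and of the stabilization weights -/

theorem RegularTri.dist_vertex_le {h : ℝ} {A B C x : Plane} (R : RegularTri h A B C)
    (hx : x ∈ tri A B C) : ‖x - A‖ ≤ 2 * h := by
  obtain ⟨a, b, e, ha, hb, he, hs, rfl⟩ := hx
  have hh := R.pos
  have h1 : ‖B - A‖ ≤ 2 * h := le_of_sq_le_sq (by nlinarith [R.AB_le]) (by positivity)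
  have h2 : ‖C - A‖ ≤ 2 * h := le_of_sq_le_sq (by nlinarith [R.AC_le]) (by positivity)
  have e1 : a • A + b • B + e • C - A = b • (B - A) + e • (C - A) := by
    rw [show a = 1 - b - e by linarith]; module
  rw [e1]
  refine (norm_add_le _ _).trans ?_
  rw [norm_smul, norm_smul, Real.norm_of_nonneg hb, Real.norm_of_nonneg he]
  have h3 : b * ‖B - A‖ ≤ b * (2 * h) := by gcongr
  have h4 : e * ‖C - A‖ ≤ e * (2 * h) := by gcongr
  nlinarith

theorem norm_sub_le_of_mem_elem {d : Diagonal} {N : ℕ} (hN : 0 < N) {τ : ElemIndex N} {x y : Plane}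
    (hx : x ∈ elem d N τ) (hy : y ∈ elem d N τ) : ‖x - y‖ ≤ 4 * meshSize N := by
  have R := regularTri_vertex d hN τ
  rw [elem_eq_tri] at hx hy
  have h1 := R.dist_vertex_le hx
  have h2 := R.dist_vertex_le hy
  have h3 := norm_sub_le_norm_sub_add_norm_sub x (vertex d N τ 0) y
  rw [norm_sub_rev (vertex d N τ 0) y] at h3
  linarith

theorem volume_elem_le {d : Diagonal} {N : ℕ} (hN : 0 < N) (τ : ElemIndex N) :
    volume.real (elem d N τ) ≤ 64 * meshSize N ^ 2 := by
  have R := regularTri_vertex d hN τ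
  have hh := R.pos
  have hsub : elem d N τ ⊆ Metric.ball (vertex d N τ 0) (4 * meshSize N) := by
    intro x hx
    rw [elem_eq_tri] at hx
    rw [mem_ball_iff_norm]
    linarith [R.dist_vertex_le hx]
  have h1 := measureReal_mono (μ := volume) hsub Metric.isBounded_ball.measure_lt_top.ne
  rw [volume_real_ball _ (by positivity)] at h1
  refine h1.trans ?_
  nlinarith [Real.pi_le_four, sq_nonneg (meshSize N)]

theorem RegularTri.ball_centroid_subset {h : ℝ} {A B C : Plane} (R : RegularTri h A B C) :
    Metric.ball ((1 / 3 : ℝ) • A + (1 / 3 : ℝ) • B + (1 / 3 : ℝ) • C) (h / 12) ⊆ tri A B C := by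
  intro y hy
  rw [mem_ball_iff_norm] at hy
  have hh := R.pos
  have key : ∀ {A B C : Plane}, RegularTri h A B C →
      ‖y - ((1 / 3 : ℝ) • A + (1 / 3 : ℝ) • B + (1 / 3 : ℝ) • C)‖ < h / 12 →
      0 ≤ bary B C A y := by
    intro A B C R hy
    have h1 := R.bary_sub_sq_le ((1 / 3 : ℝ) • A + (1 / 3 : ℝ) • B + (1 / 3 : ℝ) • C) y
    rw [show (1 / 3 : ℝ) • A + (1 / 3 : ℝ) • B + (1 / 3 : ℝ) • C =
      (1 / 3 : ℝ) • B + (1 / 3 : ℝ) • C + (1 / 3 : ℝ) • A by abel] at h1 hy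
    rw [R.rotate.bary_comb (by norm_num)] at h1
    have h2 : ‖y - ((1 / 3 : ℝ) • B + (1 / 3 : ℝ) • C + (1 / 3 : ℝ) • A)‖ ^ 2 ≤ (h / 12) ^ 2 := by
      gcongr
    have h3 : h ^ 2 * (bary B C A y - 1 / 3) ^ 2 ≤ h ^ 2 * (1 / 3) ^ 2 := by nlinarith
    have h4 := abs_le_of_sq_le_sq' (le_of_mul_le_mul_left h3 (by positivity)) (by norm_num)
    linarith [h4.1]
  rw [R.mem_tri_iff]
  refine ⟨key R hy, key R.rotate ?_, key R.rotate.rotate ?_⟩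
  · rwa [show (1 / 3 : ℝ) • B + (1 / 3 : ℝ) • C + (1 / 3 : ℝ) • A =
      (1 / 3 : ℝ) • A + (1 / 3 : ℝ) • B + (1 / 3 : ℝ) • C by abel]
  · rwa [show (1 / 3 : ℝ) • C + (1 / 3 : ℝ) • A + (1 / 3 : ℝ) • B =
      (1 / 3 : ℝ) • A + (1 / 3 : ℝ) • B + (1 / 3 : ℝ) • C by abel]

theorem volume_elem_ge {d : Diagonal} {N : ℕ} (hN : 0 < N) (τ : ElemIndex N) :
    meshSize N ^ 2 / 48 ≤ volume.real (elem d N τ) := by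
  have R := regularTri_vertex d hN τ
  have hh := R.pos
  have h1 := measureReal_mono (μ := volume) R.ball_centroid_subset
    (by rw [← elem_eq_tri]; exact (isCompact_elem d N τ).measure_ne_top)
  rw [volume_real_ball _ (by positivity), ← elem_eq_tri] at h1
  refine le_trans ?_ h1
  nlinarith [Real.pi_gt_three, sq_nonneg (meshSize N)]

theorem partArea_add {d : Diagonal} {r : ℝ} {N : ℕ} (hN : 0 < N) (τ : ElemIndex N) :
    partArea d r N τ 0 + partArea d r N τ 1 = volume.real (elem d N τ) := by
  have hm := measurableSet_subdomain r 0
  have e : elem d N τ ∩ subdomain r 1 = elem d N τ \ subdomain r 0 := by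
    ext x
    constructor
    · rintro ⟨h1, -, h2⟩; exact ⟨h1, h2⟩
    · rintro ⟨h1, h2⟩; exact ⟨h1, elem_subset_cell d hN τ h1, h2⟩
  rw [partArea, partArea, e]
  exact measureReal_inter_add_sdiff hm (isCompact_elem d N τ).measure_ne_top

theorem partArea_nonneg (d : Diagonal) (r : ℝ) (N : ℕ) (τ : ElemIndex N) (i : Fin 2) :
    0 ≤ partArea d r N τ i := measureReal_nonneg

theorem matNorm_pos {M : Matrix (Fin 2) (Fin 2) ℂ} (hM : M.PosDef) : 0 < matNorm M := by
  rw [matNorm, norm_pos_iff]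
  intro h0
  have hM0 : M = 0 := by
    have := (Matrix.toEuclideanCLM (n := Fin 2) (𝕜 := ℂ)).injective (h0.trans (map_zero _).symm)
    exact this
  have := hM.isUnit.ne_zero
  exact this hM0

theorem MaterialWeight.supNorm_pos (W : MaterialWeight) (i : Fin 2) : 0 < W.supNorm i := by
  fin_cases i
  · exact lt_of_lt_of_le (matNorm_pos W.posDefA) (le_max_left _ _)
  · exact matNorm_pos W.posDef0

theorem weightDenom_le (W : MaterialWeight) {d : Diagonal} {r : ℝ} {N : ℕ} (hN : 0 < N)
    (τ : ElemIndex N) :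
    weightDenom W d r N τ ≤ max (W.supNorm 0) (W.supNorm 1) * (64 * meshSize N ^ 2) := by
  have hm : 0 < max (W.supNorm 0) (W.supNorm 1) := lt_max_of_lt_left (W.supNorm_pos 0)
  calc weightDenom W d r N τ ≤ max (W.supNorm 0) (W.supNorm 1) * partArea d r N τ 0 +
        max (W.supNorm 0) (W.supNorm 1) * partArea d r N τ 1 := by
        unfold weightDenom
        have h0 := partArea_nonneg d r N τ 0
        have h1 := partArea_nonneg d r N τ 1
        gcongr
        · exact le_max_right _ _
        · exact le_max_left _ _
    _ = max (W.supNorm 0) (W.supNorm 1) * volume.real (elem d N τ) := by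
        rw [← mul_add, partArea_add hN]
    _ ≤ _ := by gcongr; exact volume_elem_le hN τ

theorem weightDenom_ge (W : MaterialWeight) {d : Diagonal} {r : ℝ} {N : ℕ} (hN : 0 < N)
    (τ : ElemIndex N) :
    min (W.supNorm 0) (W.supNorm 1) * (meshSize N ^ 2 / 48) ≤ weightDenom W d r N τ := by
  have hm : 0 < min (W.supNorm 0) (W.supNorm 1) := lt_min (W.supNorm_pos 0) (W.supNorm_pos 1)
  calc min (W.supNorm 0) (W.supNorm 1) * (meshSize N ^ 2 / 48)
      ≤ min (W.supNorm 0) (W.supNorm 1) * volume.real (elem d N τ) := by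
        gcongr; exact volume_elem_ge hN τ
    _ = min (W.supNorm 0) (W.supNorm 1) * partArea d r N τ 0 +
        min (W.supNorm 0) (W.supNorm 1) * partArea d r N τ 1 := by
        rw [← mul_add, partArea_add hN]
    _ ≤ _ := by
        unfold weightDenom
        have h0 := partArea_nonneg d r N τ 0
        have h1 := partArea_nonneg d r N τ 1
        gcongr
        · exact min_le_right _ _
        · exact min_le_left _ _

theorem weightDenom_pos (W : MaterialWeight) {d : Diagonal} {r : ℝ} {N : ℕ} (hN : 0 < N)
    (τ : ElemIndex N) : 0 < weightDenom W d r N τ := by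
  refine lt_of_lt_of_le ?_ (weightDenom_ge W hN τ)
  have := meshSize_pos hN
  have hm : 0 < min (W.supNorm 0) (W.supNorm 1) := lt_min (W.supNorm_pos 0) (W.supNorm_pos 1)
  positivity

theorem lambdaK_nonneg (W : MaterialWeight) {d : Diagonal} {r : ℝ} {N : ℕ} (hN : 0 < N)
    (τ : ElemIndex N) : 0 ≤ lambdaK W d r N τ := by
  have h0 := W.supNorm_pos 0
  have h1 := W.supNorm_pos 1
  have h2 := meshSize_pos hN
  have h3 := weightDenom_pos W (d := d) (r := r) hN τ
  unfold lambdaK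
  positivity

/-- Since D_K is at most of order h², a cut of length comparable to h has a stabilization weight
bounded below. Short cuts have no such bound. -/
theorem lambdaK_ge (W : MaterialWeight) {d : Diagonal} {r : ℝ} {N : ℕ} (hN : 0 < N)
    (τ : ElemIndex N) {s : ℝ} (hs : 0 ≤ s)
    (harc : s * meshSize N ≤ (arcLength r).real (cutArc d r N τ)) :
    W.supNorm 0 * W.supNorm 1 * s / (64 * max (W.supNorm 0) (W.supNorm 1)) ≤
      lambdaK W d r N τ := by
  have h0 := W.supNorm_pos 0
  have h1 := W.supNorm_pos 1
  have hh := meshSize_pos hN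
  have hD := weightDenom_pos W (d := d) (r := r) hN τ
  have hm : 0 < max (W.supNorm 0) (W.supNorm 1) := lt_max_of_lt_left h0
  unfold lambdaK
  rw [div_le_div_iff₀ (by positivity) hD]
  calc W.supNorm 0 * W.supNorm 1 * s * weightDenom W d r N τ
      ≤ W.supNorm 0 * W.supNorm 1 * s *
        (max (W.supNorm 0) (W.supNorm 1) * (64 * meshSize N ^ 2)) := by
        gcongr; exact weightDenom_le W hN τ
    _ = W.supNorm 0 * W.supNorm 1 * meshSize N * (64 * max (W.supNorm 0) (W.supNorm 1)) *
        (s * meshSize N) := by ring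
    _ ≤ W.supNorm 0 * W.supNorm 1 * meshSize N * (64 * max (W.supNorm 0) (W.supNorm 1)) *
        (arcLength r).real (cutArc d r N τ) := by gcongr
    _ = _ := by ring

theorem isCompact_interface (r : ℝ) : IsCompact (interface r) :=
  (isCompact_sphere _ _).union (isCompact_sphere _ _)

theorem isCompact_cutArc (d : Diagonal) (r : ℝ) (N : ℕ) (τ : ElemIndex N) :
    IsCompact (cutArc d r N τ) :=
  (isCompact_interface r).inter (isCompact_elem d N τ)

theorem measurableSet_cutArc (d : Diagonal) (r : ℝ) (N : ℕ) (τ : ElemIndex N) :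
    MeasurableSet (cutArc d r N τ) := (isCompact_cutArc d r N τ).isClosed.measurableSet

theorem arcLength_cutArc_le {d : Diagonal} {r : ℝ} (hr : 0 < r) {N : ℕ} (hN : 0 < N)
    (τ : ElemIndex N) : (arcLength r).real (cutArc d r N τ) ≤ 32 * meshSize N := by
  have hh := meshSize_pos hN
  refine (arcLength_real_le_of_diam hr (measurableSet_cutArc d r N τ) (D := 4 * meshSize N)
    (by positivity) fun x hx y hy => norm_sub_le_of_mem_elem hN hx.2 hy.2).trans ?_
  nlinarith [Real.pi_le_four]

/-- The constant is 1536 = 32 · 48, from |Γ_K| ≤ 32h and |K| ≥ h²/48. -/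
theorem lambdaK_le (W : MaterialWeight) {d : Diagonal} {r : ℝ} (hr : 0 < r) {N : ℕ} (hN : 0 < N)
    (τ : ElemIndex N) :
    lambdaK W d r N τ ≤
      W.supNorm 0 * W.supNorm 1 * 1536 / min (W.supNorm 0) (W.supNorm 1) := by
  have h0 := W.supNorm_pos 0
  have h1 := W.supNorm_pos 1
  have hh := meshSize_pos hN
  have hD := weightDenom_pos W (d := d) (r := r) hN τ
  have hm : 0 < min (W.supNorm 0) (W.supNorm 1) := lt_min h0 h1
  unfold lambdaK
  rw [div_le_div_iff₀ hD hm]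
  calc meshSize N * W.supNorm 0 * W.supNorm 1 * (arcLength r).real (cutArc d r N τ) *
        min (W.supNorm 0) (W.supNorm 1)
      ≤ meshSize N * W.supNorm 0 * W.supNorm 1 * (32 * meshSize N) *
        min (W.supNorm 0) (W.supNorm 1) := by
        gcongr; exact arcLength_cutArc_le hr hN τ
    _ = W.supNorm 0 * W.supNorm 1 * 1536 *
        (min (W.supNorm 0) (W.supNorm 1) * (meshSize N ^ 2 / 48)) := by ring
    _ ≤ _ := by gcongr; exact weightDenom_ge W hN τ

/-- The square of the `L²` norm of the jump on `Γ_K`. -/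
def jumpSq (d : Diagonal) (r : ℝ) (N : ℕ) (q : Fin 2 → Plane → ℂ) (τ : ElemIndex N) : ℝ :=
  ∫ x in cutArc d r N τ, ‖jump q x‖ ^ 2 ∂(arcLength r)

theorem jumpSq_nonneg (d : Diagonal) (r : ℝ) (N : ℕ) (q : Fin 2 → Plane → ℂ) (τ : ElemIndex N) :
    0 ≤ jumpSq d r N q τ := integral_nonneg fun _ => sq_nonneg _

theorem jumpSq_eq_zero {d : Diagonal} {r : ℝ} {N : ℕ} (q : Fin 2 → Plane → ℂ) {τ : ElemIndex N}
    (hτ : τ ∉ cutElems d r N) : jumpSq d r N q τ = 0 := by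
  have : cutArc d r N τ = ∅ := by
    rw [Set.eq_empty_iff_forall_notMem]
    rintro x ⟨h1, h2⟩
    exact hτ (Admissible.mem_cutElems h1 h2)
  rw [jumpSq, this]; simp

theorem Admissible.isAffineOn_jump_of_cut {d : Diagonal} {r : ℝ} {N : ℕ} {τ : ElemIndex N}
    (H : Admissible d r N) {q : Fin 2 → Plane → ℂ} (hq : q ∈ femSpace d r N)
    (hτ : τ ∈ cutElems d r N) : IsAffineOn (jump q) (elem d N τ) := by
  simp only [cutElems, Finset.mem_filter, Finset.mem_univ, true_and] at hτ
  obtain ⟨x, hx, hxτ⟩ := hτ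
  exact H.isAffineOn_jump hq hx hxτ

theorem IsAffineOn.continuousOn {v : Plane → ℂ} {K : Set Plane} (h : IsAffineOn v K) :
    ContinuousOn v K := by
  obtain ⟨c, g, hg⟩ := h
  have hc : Continuous fun x : Plane => c + ∑ j, g j * (x j : ℂ) := by
    simp only [Fin.sum_univ_two]; fun_prop
  exact hc.continuousOn.congr hg

theorem Admissible.continuousOn_jump {d : Diagonal} {r : ℝ} {N : ℕ} {τ : ElemIndex N}
    (H : Admissible d r N) {q : Fin 2 → Plane → ℂ} (hq : q ∈ femSpace d r N)
    (hτ : τ ∈ cutElems d r N) : ContinuousOn (jump q) (cutArc d r N τ) :=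
  (H.isAffineOn_jump_of_cut hq hτ).continuousOn.mono Set.inter_subset_right

/-! ### Extrapolation of trigonometric polynomials -/

/-- Lagrange interpolation of a binary quadratic form. -/
theorem quadratic_lagrange (a b e x y x₀ y₀ x₁ y₁ x₂ y₂ : ℂ) (h01 : x₀ * y₁ - y₀ * x₁ ≠ 0)
    (h02 : x₀ * y₂ - y₀ * x₂ ≠ 0) (h12 : x₁ * y₂ - y₁ * x₂ ≠ 0) :
    a * x ^ 2 + b * (x * y) + e * y ^ 2 =
      (x * y₁ - y * x₁) * (x * y₂ - y * x₂) / ((x₀ * y₁ - y₀ * x₁) * (x₀ * y₂ - y₀ * x₂)) *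
        (a * x₀ ^ 2 + b * (x₀ * y₀) + e * y₀ ^ 2) +
      -((x * y₀ - y * x₀) * (x * y₂ - y * x₂) / ((x₀ * y₁ - y₀ * x₁) * (x₁ * y₂ - y₁ * x₂))) *
        (a * x₁ ^ 2 + b * (x₁ * y₁) + e * y₁ ^ 2) +
      (x * y₀ - y * x₀) * (x * y₁ - y * x₁) / ((x₀ * y₂ - y₀ * x₂) * (x₁ * y₂ - y₁ * x₂)) *
        (a * x₂ ^ 2 + b * (x₂ * y₂) + e * y₂ ^ 2) := by
  obtain ⟨D, hD⟩ : ∃ D, D = x₀ * y₁ - y₀ * x₁ := ⟨_, rfl⟩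
  obtain ⟨D', hD'⟩ : ∃ D, D = x₀ * y₂ - y₀ * x₂ := ⟨_, rfl⟩
  obtain ⟨D'', hD''⟩ : ∃ D, D = x₁ * y₂ - y₁ * x₂ := ⟨_, rfl⟩
  rw [← hD] at h01
  rw [← hD'] at h02
  rw [← hD''] at h12
  rw [← hD, ← hD', ← hD'']
  field_simp
  rw [hD, hD', hD'']
  ring

/-- A trigonometric polynomial of degree one. -/
def trigPoly (a b e : ℂ) (θ : ℝ) : ℂ := a + b * (Real.cos θ : ℂ) + e * (Real.sin θ : ℂ)

/-- In half angles a trigonometric polynomial of degree one is a binary quadratic form, so three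
values determine it, and the determinants in the interpolation formula are sines of half
differences. -/
theorem trigPoly_eq (a b e : ℂ) (θ : ℝ) :
    trigPoly a b e θ = (a + b) * (Real.cos (θ / 2) : ℂ) ^ 2 +
      (2 * e) * ((Real.cos (θ / 2) : ℂ) * (Real.sin (θ / 2) : ℂ)) +
      (a - b) * (Real.sin (θ / 2) : ℂ) ^ 2 := by
  have h1 : Real.cos θ = Real.cos (θ / 2) ^ 2 - Real.sin (θ / 2) ^ 2 := by
    conv_lhs => rw [show θ = 2 * (θ / 2) by ring, Real.cos_two_mul']
  have h2 : Real.sin θ = 2 * Real.sin (θ / 2) * Real.cos (θ / 2) := by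
    conv_lhs => rw [show θ = 2 * (θ / 2) by ring, Real.sin_two_mul]
  have h3 : ((Real.cos (θ / 2) : ℂ)) ^ 2 + (Real.sin (θ / 2) : ℂ) ^ 2 = 1 := by
    have := Real.cos_sq_add_sin_sq (θ / 2)
    exact_mod_cast this
  rw [trigPoly, h1, h2]
  push_cast at h3 ⊢
  linear_combination -a * h3

theorem half_angle_det (s t : ℝ) :
    (Real.cos (s / 2) : ℂ) * (Real.sin (t / 2) : ℂ) - (Real.sin (s / 2) : ℂ) * (Real.cos (t / 2) : ℂ)
      = (Real.sin ((t - s) / 2) : ℂ) := by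
  rw [show (t - s) / 2 = t / 2 - s / 2 by ring, Real.sin_sub]
  push_cast
  ring

theorem sin_half_ge {w x : ℝ} (hw : 0 ≤ w) (hx : w / 3 ≤ x) (hx1 : x ≤ 1) :
    w / 12 ≤ Real.sin (x / 2) := by
  have h := Real.mul_le_sin (x := x / 2) (by linarith) (by linarith [Real.pi_gt_three])
  refine le_trans ?_ h
  have : (1 : ℝ) / 2 ≤ 2 / Real.pi := by
    rw [div_le_div_iff₀ (by norm_num) Real.pi_pos]; linarith [Real.pi_le_four]
  nlinarith

/-- Pointwise extrapolation from three equidistant points. -/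
theorem normSq_trigPoly_le {a b e : ℂ} {u w θ : ℝ} (hw : 0 < w) (hw1 : w ≤ 1) (hθ : θ ≤ u)
    (hθ' : u - 17 * w ≤ θ) {s : ℝ} (hs : u ≤ s) (hs' : s ≤ u + w / 3) :
    ‖trigPoly a b e θ‖ ^ 2 ≤ 3 * 11664 ^ 2 * (‖trigPoly a b e s‖ ^ 2 +
      ‖trigPoly a b e (s + w / 3)‖ ^ 2 + ‖trigPoly a b e (s + 2 * (w / 3))‖ ^ 2) := by
  have d01 := sin_half_ge (w := w) hw.le (x := s + w / 3 - s) (by linarith) (by linarith)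
  have d02 := sin_half_ge (w := w) hw.le (x := s + 2 * (w / 3) - s) (by linarith) (by linarith)
  have d12 := sin_half_ge (w := w) hw.le (x := s + 2 * (w / 3) - (s + w / 3)) (by linarith)
    (by linarith)
  have hw12 : 0 < w / 12 := by positivity
  -- Nodes lie in [u, u + w] and θ ≥ u − 17w, so half differences are at most 9w.
  have hnum : ∀ t, s ≤ t → t ≤ u + w → |Real.sin ((t - θ) / 2)| ≤ 9 * w := by
    intro t h1 h2
    refine (Real.abs_sin_le_abs (x := (t - θ) / 2)).trans ?_
    rw [abs_of_nonneg (by linarith)]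
    linarith
  have key := quadratic_lagrange (a + b) (2 * e) (a - b) (Real.cos (θ / 2)) (Real.sin (θ / 2))
    (Real.cos (s / 2)) (Real.sin (s / 2))
    (Real.cos ((s + w / 3) / 2)) (Real.sin ((s + w / 3) / 2))
    (Real.cos ((s + 2 * (w / 3)) / 2)) (Real.sin ((s + 2 * (w / 3)) / 2))
    (by rw [half_angle_det]; exact_mod_cast (hw12.trans_le d01).ne')
    (by rw [half_angle_det]; exact_mod_cast (hw12.trans_le d02).ne')
    (by rw [half_angle_det]; exact_mod_cast (hw12.trans_le d12).ne')
  simp only [half_angle_det, ← trigPoly_eq] at key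
  -- Numerators are at most 9w and denominators at least w/12 per factor; 11664 = (9 · 12)².
  have hl : ∀ t t' D D' : ℝ, s ≤ t → t ≤ u + w → s ≤ t' → t' ≤ u + w → w / 12 ≤ D → w / 12 ≤ D' →
      ‖((Real.sin ((t - θ) / 2) : ℂ)) * (Real.sin ((t' - θ) / 2) : ℂ) / ((D : ℂ) * (D' : ℂ))‖
        ≤ 11664 := by
    intro t t' D D' h1 h2 h3 h4 h5 h6
    have hD : 0 < D := hw12.trans_le h5
    have hD' : 0 < D' := hw12.trans_le h6
    rw [norm_div, norm_mul, norm_mul, Complex.norm_real, Complex.norm_real, Complex.norm_real,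
      Complex.norm_real, Real.norm_of_nonneg hD.le, Real.norm_of_nonneg hD'.le,
      div_le_iff₀ (by positivity), Real.norm_eq_abs, Real.norm_eq_abs]
    calc |Real.sin ((t - θ) / 2)| * |Real.sin ((t' - θ) / 2)| ≤ (9 * w) * (9 * w) := by
          gcongr
          · exact hnum t h1 h2
          · exact hnum t' h3 h4
      _ = 11664 * ((w / 12) * (w / 12)) := by ring
      _ ≤ 11664 * (D * D') := by gcongr
  rw [key]
  have hb0 := hl (s + w / 3) (s + 2 * (w / 3)) _ _ (by linarith) (by linarith) (by linarith)
    (by linarith) d01 d02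
  have hb1 := hl s (s + 2 * (w / 3)) _ _ (by linarith) (by linarith) (by linarith)
    (by linarith) d01 d12
  have hb2 := hl s (s + w / 3) _ _ (by linarith) (by linarith) (by linarith)
    (by linarith) d02 d12
  rw [← norm_neg] at hb1
  generalize (Real.sin ((s + w / 3 - θ) / 2) : ℂ) * (Real.sin ((s + 2 * (w / 3) - θ) / 2) : ℂ) /
    ((Real.sin ((s + w / 3 - s) / 2) : ℂ) * (Real.sin ((s + 2 * (w / 3) - s) / 2) : ℂ)) = l0 at *
  generalize -((Real.sin ((s - θ) / 2) : ℂ) * (Real.sin ((s + 2 * (w / 3) - θ) / 2) : ℂ) /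
    ((Real.sin ((s + w / 3 - s) / 2) : ℂ) * (Real.sin ((s + 2 * (w / 3) - (s + w / 3)) / 2) : ℂ)))
    = l1 at *
  generalize (Real.sin ((s - θ) / 2) : ℂ) * (Real.sin ((s + w / 3 - θ) / 2) : ℂ) /
    ((Real.sin ((s + 2 * (w / 3) - s) / 2) : ℂ) *
      (Real.sin ((s + 2 * (w / 3) - (s + w / 3)) / 2) : ℂ)) = l2 at *
  generalize trigPoly a b e s = f0
  generalize trigPoly a b e (s + w / 3) = f1
  generalize trigPoly a b e (s + 2 * (w / 3)) = f2
  have hn : ‖l0 * f0 + l1 * f1 + l2 * f2‖ ≤ 11664 * (‖f0‖ + ‖f1‖ + ‖f2‖) := by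
    refine (norm_add₃_le).trans ?_
    rw [norm_mul, norm_mul, norm_mul, mul_add, mul_add]
    gcongr
  calc ‖l0 * f0 + l1 * f1 + l2 * f2‖ ^ 2 ≤ (11664 * (‖f0‖ + ‖f1‖ + ‖f2‖)) ^ 2 := by gcongr
    _ ≤ _ := by
      rw [mul_pow]
      nlinarith [sq_nonneg (‖f0‖ - ‖f1‖), sq_nonneg (‖f1‖ - ‖f2‖), sq_nonneg (‖f0‖ - ‖f2‖)]

theorem continuous_trigPoly (a b e : ℂ) : Continuous (trigPoly a b e) := by
  unfold trigPoly; fun_prop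

/-- Extrapolation in the mean. -/
theorem normSq_trigPoly_le_integral {a b e : ℂ} {u w θ : ℝ} (hw : 0 < w) (hw1 : w ≤ 1)
    (hθ : θ ≤ u) (hθ' : u - 17 * w ≤ θ) :
    w / 3 * ‖trigPoly a b e θ‖ ^ 2 ≤
      3 * 11664 ^ 2 * ∫ s in Set.Ioo u (u + w), ‖trigPoly a b e s‖ ^ 2 := by
  set g : ℝ → ℝ := fun s => ‖trigPoly a b e s‖ ^ 2 with hg
  have hc : Continuous g := (continuous_trigPoly a b e).norm.pow 2
  have hi : ∀ x y, IntervalIntegrable g volume x y := fun x y => hc.intervalIntegrable x y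
  -- The translates of [u, u + w/3] by 0, w/3 and 2w/3 tile [u, u + w].
  have hsum : ∫ s in u..u + w / 3, (g s + g (s + w / 3) + g (s + 2 * (w / 3))) =
      ∫ s in u..u + w, g s := by
    rw [intervalIntegral.integral_add, intervalIntegral.integral_add,
      intervalIntegral.integral_comp_add_right (fun s => g s),
      intervalIntegral.integral_comp_add_right (fun s => g s),
      show u + w / 3 + w / 3 = u + 2 * (w / 3) by ring,
      show u + w / 3 + 2 * (w / 3) = u + w by ring,
      intervalIntegral.integral_add_adjacent_intervals (hi _ _) (hi _ _),
      intervalIntegral.integral_add_adjacent_intervals (hi _ _) (hi _ _)]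
    · exact hi _ _
    · exact (hc.comp (by fun_prop)).intervalIntegrable _ _
    · exact (hc.add (hc.comp (by fun_prop))).intervalIntegrable _ _
    · exact (hc.comp (by fun_prop)).intervalIntegrable _ _
  have hmono : ∫ _ in u..u + w / 3, ‖trigPoly a b e θ‖ ^ 2 ≤
      ∫ s in u..u + w / 3, 3 * 11664 ^ 2 * (g s + g (s + w / 3) + g (s + 2 * (w / 3))) := by
    refine intervalIntegral.integral_mono_on (by linarith) (by simp) ?_ fun s hs =>
      normSq_trigPoly_le hw hw1 hθ hθ' hs.1 hs.2
    exact (continuous_const.mul ((hc.add (hc.comp (by fun_prop))).add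
      (hc.comp (by fun_prop)))).intervalIntegrable _ _
  rw [intervalIntegral.integral_const, intervalIntegral.integral_const_mul, hsum,
    intervalIntegral.integral_of_le (by linarith), integral_Ioc_eq_integral_Ioo] at hmono
  simpa using hmono

theorem IsAffineOn.exists_trigPoly {v : Plane → ℂ} {K : Set Plane} (hv : IsAffineOn v K)
    (c : Plane) (r : ℝ) : ∃ a b e : ℂ, ∀ θ, circ c r θ ∈ K → v (circ c r θ) = trigPoly a b e θ := by
  obtain ⟨z, g, hg⟩ := hv
  refine ⟨z + g 0 * c 0 + g 1 * c 1, g 0 * r, g 1 * r, fun θ hθ => ?_⟩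
  rw [hg _ hθ, Fin.sum_univ_two, circ_zero, circ_one, trigPoly]
  push_cast
  ring

/-- The value of the jump at a point of an element is controlled by its mean on an arc. -/
theorem Admissible.normSq_jump_le_jumpSq {d : Diagonal} {r : ℝ} {N : ℕ} {τ : ElemIndex N}
    (H : Admissible d r N) {c : Plane} (hc : IsSite c) {q : Fin 2 → Plane → ℂ}
    (hq : q ∈ femSpace d r N) {u w θ : ℝ} (hw : 0 < w) (hw1 : w ≤ 1) (hθ : θ ≤ u)
    (hθ' : u - 17 * w ≤ θ) (hmem : circ c r θ ∈ elem d N τ)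
    (harc : ∀ s ∈ Set.Ioo u (u + w), circ c r s ∈ elem d N τ) :
    r * w * ‖jump q (circ c r θ)‖ ^ 2 ≤ 9 * 11664 ^ 2 * jumpSq d r N q τ := by
  have hr := H.radius.1
  have hint : ∀ θ, circ c r θ ∈ interface r := fun θ =>
    sphere_subset_interface hc (circ_mem_sphere hr θ)
  have hcut := mem_cutElems (hint θ) hmem
  have hA := H.isAffineOn_jump_of_cut hq hcut
  obtain ⟨a, b, e, hp⟩ := hA.exists_trigPoly c r
  have h1 := normSq_trigPoly_le_integral (a := a) (b := b) (e := e) hw hw1 hθ hθ'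
  have hcont : ContinuousOn (fun x => ‖jump q x‖ ^ 2) (cutArc d r N τ) :=
    (H.continuousOn_jump hq hcut).norm.pow 2
  have h2 := setIntegral_circ_le (c := c) hr (measurableSet_cutArc d r N τ) (u := u) (w := w)
    (by linarith [Real.pi_gt_three]) (fun s hs => ⟨hint s, harc s hs⟩)
    (g := fun x => ‖jump q x‖ ^ 2) (fun _ => sq_nonneg _)
    (hcont.integrableOn_compact (isCompact_cutArc d r N τ))
  have h3 : ∫ x in cutArc d r N τ, ‖jump q x‖ ^ 2 ∂(circleArcLength c r) ≤ jumpSq d r N q τ :=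
    integral_mono_measure (Measure.restrict_mono le_rfl (hc.le_arcLength r))
      (Filter.Eventually.of_forall fun _ => sq_nonneg _)
      (hcont.integrableOn_compact (isCompact_cutArc d r N τ))
  have h4 : ∫ s in Set.Ioo u (u + w), ‖jump q (circ c r s)‖ ^ 2 =
      ∫ s in Set.Ioo u (u + w), ‖trigPoly a b e s‖ ^ 2 :=
    setIntegral_congr_fun measurableSet_Ioo fun s hs => by simp only [hp s (harc s hs)]
  rw [h4] at h2
  rw [hp θ hmem]
  have h5 : r * (w / 3 * ‖trigPoly a b e θ‖ ^ 2) ≤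
      3 * 11664 ^ 2 * (r * ∫ s in Set.Ioo u (u + w), ‖trigPoly a b e s‖ ^ 2) := by
    have := mul_le_mul_of_nonneg_left h1 hr.le
    linarith
  linarith

end UnfittedNitsche
end

noncomputable section
namespace UnfittedNitsche

/-! ### Control of the jumps by the energy and the stabilization -/

/-- A side vector of a point on the boundary near a vertex. -/
theorem exists_spoke {d : Diagonal} {N : ℕ} (hN : 0 < N) {τ : ElemIndex N} {V x : Plane}
    (hV : V ∈ Set.range (vertex d N τ)) (hx : x ∈ frontier (elem d N τ))
    (hxV : ‖x - V‖ ≤ meshSize N / 8) :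
    ∃ B T : Plane, ∃ t : ℝ, IsElem d N τ V B T ∧ x = V + t • (B - V) ∧ 0 ≤ t ∧ t ≤ 1 / 2 ∧
      t * meshSize N ≤ ‖x - V‖ := by
  obtain ⟨B, T, hE⟩ := IsElem.of_range d N τ hV
  have key : ∀ {B T : Plane}, IsElem d N τ V B T → x ∈ tri V B T → bary V B T x = 0 →
      ∃ t : ℝ, x = V + t • (B - V) ∧ 0 ≤ t ∧ t ≤ 1 / 2 ∧ t * meshSize N ≤ ‖x - V‖ := by
    intro B T hE hxt h0
    have R := hE.regular hN
    have hh := R.pos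
    have hrec := R.bary_rec x
    have hsum := R.bary_sum x
    have hnn := ((R.mem_tri_iff x).1 hxt).2.1
    rw [h0] at hrec hsum
    have e : x = V + bary T V B x • (B - V) := by
      conv_lhs => rw [hrec]
      rw [show bary B T V x = 1 - bary T V B x by linarith]; module
    have h1 : bary T V B x * meshSize N ≤ ‖x - V‖ := by
      have h2 : ‖x - V‖ = bary T V B x * ‖B - V‖ := by
        conv_lhs => rw [e]
        rw [add_sub_cancel_left, norm_smul, Real.norm_of_nonneg hnn]
      rw [h2]
      have : meshSize N ≤ ‖B - V‖ := le_of_sq_le_sq R.AB_ge (norm_nonneg _)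
      gcongr
    refine ⟨_, e, hnn, ?_, h1⟩
    have : bary T V B x * meshSize N ≤ 1 / 2 * meshSize N := by linarith
    exact le_of_mul_le_mul_right this hh
  have R := hE.regular hN
  have hh := R.pos
  rw [hE.elem_eq, R.mem_frontier_iff] at hx
  obtain ⟨hxt, h | h | h⟩ := hx
  -- On the side opposite V the V-coordinate is 0, but within h/8 of V it differs from 1 by at most
  -- 1/2.
  · exfalso
    have h1 := R.bary_sub_sq_le V x
    have h2 : bary B T V V = 1 := by
      conv_lhs => rw [show V = (0 : ℝ) • B + (0 : ℝ) • T + (1 : ℝ) • V by module]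
      conv_lhs => rw [show (0 : ℝ) • B + (0 : ℝ) • T + (1 : ℝ) • V = V by module]
      have := R.rotate.bary_comb (a := 0) (b := 0) (c := 1) (by norm_num)
      simpa using this
    rw [h, h2] at h1
    have h3 : ‖x - V‖ ^ 2 ≤ (meshSize N / 8) ^ 2 := by gcongr
    nlinarith
  · obtain ⟨t, ht⟩ := key hE.swap (by rwa [tri_swap]) (by
      have hr := R.bary_rec x
      have hs := R.bary_sum x
      rw [h] at hr hs
      have : x = bary B T V x • V + bary V B T x • T + (0 : ℝ) • B := by
        conv_lhs => rw [hr]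
        module
      rw [this]
      exact R.swap.bary_comb (by linarith))
    exact ⟨T, B, t, hE.swap, ht⟩
  · obtain ⟨t, ht⟩ := key hE hxt h
    exact ⟨B, T, t, hE, ht⟩

theorem exists_first_exit {U : Set Plane} (hU : IsOpen U) {f : ℝ → Plane} (hf : Continuous f)
    {a b : ℝ} (hab : a ≤ b) (ha : f a ∈ U) (hb : f b ∉ U) :
    ∃ e, a < e ∧ e ≤ b ∧ f e ∉ U ∧ ∀ θ, a ≤ θ → θ < e → f θ ∈ U := by
  have hS : IsCompact (Set.Icc a b ∩ f ⁻¹' Uᶜ) :=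
    isCompact_Icc.inter_right (hU.isClosed_compl.preimage hf)
  have hne : (Set.Icc a b ∩ f ⁻¹' Uᶜ).Nonempty := ⟨b, ⟨hab, le_rfl⟩, hb⟩
  have hmem := hS.sInf_mem hne
  set e := sInf (Set.Icc a b ∩ f ⁻¹' Uᶜ)
  refine ⟨e, lt_of_le_of_ne hmem.1.1 ?_, hmem.1.2, hmem.2, fun θ h1 h2 => ?_⟩
  · intro h
    exact hmem.2 (h ▸ ha)
  · by_contra hcon
    have := csInf_le hS.bddBelow (⟨⟨h1, h2.le.trans hmem.1.2⟩, hcon⟩ :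
      θ ∈ Set.Icc a b ∩ f ⁻¹' Uᶜ)
    exact absurd this (not_le.2 h2)

namespace Admissible

variable {d : Diagonal} {r : ℝ} {N : ℕ} {τ : ElemIndex N} {c : Plane}

/-- One of seventeen equal pieces of a short arc avoids the sides of the elements at a vertex. -/
theorem exists_clear_piece (H : Admissible d r N) (hc : IsSite c) (V : Plane) {a w : ℝ}
    (hw : 17 * w ≤ 1) :
    ∃ j : Fin 17, ∀ θ ∈ Set.Ioo (a + j * w) (a + j * w + w), ∀ τ ∈ vertexStar d N V,
      circ c r θ ∉ frontier (elem d N τ) := by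
  classical
  -- Otherwise each of 17 disjoint pieces contains a boundary hit. At most 8 elements meet at V,
  -- each with at most 2 hits, so two pieces share a point, although their angles differ by less
  -- than 2π.
  by_contra! hcon
  choose θ hθ τ hτ hfr using hcon
  let F : Finset Plane := (vertexStar d N V).biUnion fun τ => (H.finite_hits τ).1.toFinset
  have hcard : F.card ≤ 16 := by
    refine (Finset.card_biUnion_le_card_mul _ _ 2 fun τ _ => ?_).trans ?_
    · rw [← Set.ncard_eq_toFinset_card _ (H.finite_hits τ).1]
      exact (H.finite_hits τ).2
    · have := card_vertexStar_le d H.N_pos V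
      omega
  have hmaps : ∀ j ∈ (Finset.univ : Finset (Fin 17)), circ c r (θ j) ∈ F := by
    intro j _
    rw [Finset.mem_biUnion]
    exact ⟨τ j, hτ j, by
      rw [Set.Finite.mem_toFinset]
      exact ⟨sphere_subset_interface hc (circ_mem_sphere H.radius.1 _), hfr j⟩⟩
  obtain ⟨i, -, j, -, hij, he⟩ := Finset.exists_ne_map_eq_of_card_lt_of_maps_to
    (by simp; omega : F.card < (Finset.univ : Finset (Fin 17)).card) hmaps
  have hb : ∀ i : Fin 17, a < θ i + 0 * (i : ℝ) ∧ θ i < a + 17 * w ∧ 0 < w := by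
    intro i
    have h1 := (hθ i).1
    have h2 := (hθ i).2
    have hw0 : 0 < w := by linarith
    have h3 : ((i : ℕ) : ℝ) + 1 ≤ 17 := by exact_mod_cast i.2
    have h4 : (0 : ℝ) ≤ (i : ℕ) := by positivity
    refine ⟨by nlinarith, by nlinarith, hw0⟩
  have heq := circ_injOn H.radius.1 (by
    have h1 := hb i
    have h2 := hb j
    rw [abs_lt]
    constructor <;> linarith [Real.pi_gt_three, h1.1, h1.2.1, h2.1, h2.2.1]) he
  have hlt : ∀ i j : Fin 17, i < j → θ i < θ j := by
    intro i j h
    have h3 : ((i : ℕ) : ℝ) + 1 ≤ (j : ℕ) := by exact_mod_cast h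
    have := (hb i).2.2
    nlinarith [(hθ i).2, (hθ j).1]
  rcases lt_or_gt_of_ne hij with h | h
  · exact absurd heq (hlt i j h).ne
  · exact absurd heq (hlt j i h).ne'

end Admissible

/-- The contribution of one element to the energy and to the stabilization. -/
def localEnergy (W : MaterialWeight) (k : Plane) (d : Diagonal) (r : ℝ) (N : ℕ)
    (q : Fin 2 → Plane → ℂ) (τ : ElemIndex N) : ℝ :=
  elemEnergy k d r N q 0 τ + elemEnergy k d r N q 1 τ +
    (meshSize N)⁻¹ * (lambdaK W d r N τ * jumpSq d r N q τ)

theorem stab_nonneg (W : MaterialWeight) (d : Diagonal) (r : ℝ) {N : ℕ} (hN : 0 < N)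
    (q : Fin 2 → Plane → ℂ) (τ : ElemIndex N) :
    0 ≤ (meshSize N)⁻¹ * (lambdaK W d r N τ * jumpSq d r N q τ) := by
  have := meshSize_pos hN
  have := lambdaK_nonneg W (d := d) (r := r) hN τ
  have := jumpSq_nonneg d r N q τ
  positivity

theorem localEnergy_nonneg (W : MaterialWeight) (k : Plane) (d : Diagonal) (r : ℝ) {N : ℕ}
    (hN : 0 < N) (q : Fin 2 → Plane → ℂ) (τ : ElemIndex N) : 0 ≤ localEnergy W k d r N q τ := by
  have h1 := elemEnergy_nonneg k d r N q 0 τ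
  have h2 := elemEnergy_nonneg k d r N q 1 τ
  have h3 := stab_nonneg W d r hN q τ
  unfold localEnergy
  linarith

theorem elemEnergy_add_le (W : MaterialWeight) (k : Plane) (d : Diagonal) (r : ℝ) {N : ℕ}
    (hN : 0 < N) (q : Fin 2 → Plane → ℂ) (τ : ElemIndex N) :
    elemEnergy k d r N q 0 τ + elemEnergy k d r N q 1 τ ≤ localEnergy W k d r N q τ := by
  have h3 := stab_nonneg W d r hN q τ
  unfold localEnergy
  linarith

theorem sum_elemEnergy_le (W : MaterialWeight) (k : Plane) (d : Diagonal) (r : ℝ) {N : ℕ}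
    (hN : 0 < N) (q : Fin 2 → Plane → ℂ) (S : Finset (ElemIndex N)) :
    (∑ τ ∈ S, elemEnergy k d r N q 0 τ) + ∑ τ ∈ S, elemEnergy k d r N q 1 τ ≤
      ∑ τ ∈ S, localEnergy W k d r N q τ := by
  rw [← Finset.sum_add_distrib]
  exact Finset.sum_le_sum fun τ _ => elemEnergy_add_le W k d r hN q τ

theorem meshSize_le_one {N : ℕ} (hN : 0 < N) : meshSize N ≤ 1 := by
  rw [meshSize_eq, div_le_one (by exact_mod_cast hN)]
  exact_mod_cast hN

/-- The part of an arc, relative to the mesh size, that is used to find long cuts. -/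
def arcFraction (σ : ℝ) : ℝ := min 1 (1 / σ) / 16

theorem arcFraction_pos {σ : ℝ} (hσ : 0 < σ) : 0 < arcFraction σ := by
  unfold arcFraction; positivity

theorem arcFraction_le (σ : ℝ) : arcFraction σ ≤ 1 / 16 := by
  unfold arcFraction
  have := min_le_left 1 (1 / σ)
  linarith

/-- This is how the resolution condition is used: an arc of length `arcFraction σ` times h turns by
at most 1/16. -/
theorem arcFraction_mul_le {σ : ℝ} (hσ : 0 < σ) {h r : ℝ} (hh : 0 ≤ h)
    (h1 : h ≤ σ * r) : arcFraction σ * h ≤ r / 16 := by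
  have h2 := min_le_right 1 (1 / σ)
  have : arcFraction σ ≤ 1 / σ / 16 := by unfold arcFraction; linarith
  calc arcFraction σ * h ≤ 1 / σ / 16 * (σ * r) := by gcongr
    _ = r / 16 := by field_simp

theorem circleArcLength_real_le {c : Plane} (hc : IsSite c) (r : ℝ) (S : Set Plane) :
    (circleArcLength c r).real S ≤ (arcLength r).real S :=
  ENNReal.toReal_mono (measure_ne_top _ _) (hc.le_arcLength r S)

/-- The squared jump at a vertex near the interface. -/
theorem exists_vertex_bound (W : MaterialWeight) (k : Plane) {σ : ℝ} (hσ : 0 < σ) :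
    ∃ C : ℝ, 0 < C ∧ ∀ {d : Diagonal} {r : ℝ} {N : ℕ}, Admissible d r N → meshSize N ≤ σ * r →
      ∀ {q : Fin 2 → Plane → ℂ}, q ∈ femSpace d r N → ∀ {c : Plane}, IsSite c →
      ∀ {τ : ElemIndex N} {V B T : Plane}, IsElem d N τ V B T → ∀ {a s : ℝ}, 0 ≤ s →
      s ≤ 6 * (arcFraction σ / 100) → circ c r a = V + s • (B - V) →
      ‖jump q V‖ ^ 2 ≤ C * ∑ τ' ∈ vertexStar d N V, localEnergy W k d r N q τ' := by
  have hη := arcFraction_pos hσ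
  have hη1 := arcFraction_le σ
  have hw0 := W.supNorm_pos 0
  have hw1 := W.supNorm_pos 1
  have hI := invConst_pos
  set η := arcFraction σ with hηdef
  set L : ℝ := W.supNorm 0 * W.supNorm 1 * (η / 17) / (64 * max (W.supNorm 0) (W.supNorm 1)) with hL
  have hm : 0 < max (W.supNorm 0) (W.supNorm 1) := lt_max_of_lt_left hw0
  have hLpos : 0 < L := by positivity
  -- The first term comes from extrapolating the jump from a long cut, with the factor for reverse
  -- transport over a distance at most 1; the second is the transport along a side to V.
  refine ⟨3 * ((1 + ‖k‖ ^ 2) * (9 * 11664 ^ 2 * 17 / η / L) + 288 * invConst), by positivity, ?_⟩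
  intro d r N H hσr q hq c hc τ V B T hE a s hs0 hs1 ha
  have hr := H.radius.1
  have hN := H.N_pos
  have R := hE.regular hN
  have hh := R.pos
  have hh1 := meshSize_le_one hN
  set h := meshSize N
  have hηr : η * h ≤ r / 16 := arcFraction_mul_le hσ hh.le hσr
  have hmapsint : ∀ θ, circ c r θ ∈ interface r := fun θ =>
    Admissible.sphere_subset_interface hc (circ_mem_sphere hr θ)
  -- Seventeen pieces of angle w have total length ηh.
  set w : ℝ := η * h / r / 17 with hwdef
  have hw : 0 < w := by positivity
  have hrw : r * (17 * w) = η * h := by rw [hwdef]; field_simp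
  have hw17 : 17 * w ≤ 1 / 16 := by
    have : r * (17 * w) ≤ r * (1 / 16) := by linarith
    exact le_of_mul_le_mul_left this hr
  have hPV : ‖circ c r a - V‖ ≤ 12 / 100 * (η * h) := by
    rw [ha, add_sub_cancel_left, norm_smul, Real.norm_of_nonneg hs0]
    have h2 : ‖B - V‖ ≤ 2 * h := le_of_sq_le_sq (by nlinarith [R.AB_le]) (by positivity)
    calc s * ‖B - V‖ ≤ 6 * (η / 100) * (2 * h) := by gcongr
      _ = _ := by ring
  have hnear : ∀ θ, a ≤ θ → θ ≤ a + 17 * w → ‖circ c r θ - V‖ ≤ 112 / 100 * (η * h) := by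
    intro θ h1 h2
    have h3 := norm_circ_sub_le hr (c := c) θ a
    rw [abs_of_nonneg (by linarith)] at h3
    have h4 : r * (θ - a) ≤ r * (17 * w) := by gcongr; linarith
    have h5 := norm_sub_le_norm_sub_add_norm_sub (circ c r θ) (circ c r a) V
    linarith
  -- The arc stays within h/8 of V, the range in which `exists_elem_near_node` and `exists_spoke`
  -- apply.
  have hη8 : 112 / 100 * (η * h) ≤ h / 8 := by
    have : η * h ≤ 1 / 16 * h := by gcongr
    linarith
  obtain ⟨j, hj⟩ := H.exists_clear_piece hc V (a := a) (w := w) (by linarith)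
  set u := a + j * w with hu
  have hj17 : ((j : ℕ) : ℝ) + 1 ≤ 17 := by exact_mod_cast j.2
  have hj0 : (0 : ℝ) ≤ (j : ℕ) := by positivity
  have hua : a ≤ u := by rw [hu]; nlinarith
  have huw : u + w ≤ a + 17 * w := by rw [hu]; nlinarith
  have hmid : u + w / 2 ∈ Set.Ioo u (u + w) := ⟨by linarith, by linarith⟩
  have hVτ := hE.mem_range.1
  obtain ⟨mV, hmV⟩ := hVτ
  have hVnode : V = node N (vidx d τ mV).1 (vidx d τ mV).2 := by rw [← hmV, vertex_eq]
  -- The element containing the middle of the clear piece has V as a vertex. The piece avoids its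
  -- boundary, hence runs entirely in its interior, which makes its cut long.
  obtain ⟨τ', hmem, hVτ'⟩ := exists_elem_near_node d hN (p := (vidx d τ mV).1)
    (q := (vidx d τ mV).2) (x := circ c r (u + w / 2))
    (closedBall_site_subset_cell H.radius hc
      (Metric.sphere_subset_closedBall (circ_mem_sphere hr _)))
    (by rw [← hVnode]; exact (hnear _ (by linarith) (by linarith)).trans hη8)
  rw [← hVnode] at hVτ'
  have hstar : τ' ∈ vertexStar d N V := mem_vertexStar.2 hVτ'
  have hK := isClosed_elem d N τ'
  have hmidint : circ c r (u + w / 2) ∈ interior (elem d N τ') := by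
    by_contra hcon
    exact hj _ hmid τ' hstar ⟨subset_closure hmem, hcon⟩
  have hpiece : ∀ θ ∈ Set.Ioo u (u + w), circ c r θ ∈ interior (elem d N τ') := by
    intro θ hθ
    by_contra hcon
    obtain ⟨θ', h1, h2⟩ := exists_circ_mem_frontier hK rfl hmidint hcon
    exact hj θ' (Set.OrdConnected.uIcc_subset Set.ordConnected_Ioo hmid hθ h1) τ' hstar h2
  have hlong : η / 17 * h ≤ (arcLength r).real (cutArc d r N τ') := by
    have h1 := circleArcLength_real_ge (c := c) hr (measurableSet_cutArc d r N τ') (u := u) hw.le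
      (by linarith [Real.pi_gt_three]) (fun θ hθ => ⟨hmapsint θ, interior_subset (hpiece θ hθ)⟩)
    have h2 := circleArcLength_real_le hc r (cutArc d r N τ')
    linarith
  have hlam := lambdaK_ge W hN τ' (by positivity) hlong
  rw [← hL] at hlam
  -- a point of the long cut on a spoke of the vertex
  obtain ⟨θ, hθu, hθa, hθmem, σ', B', T', t, hE', hθe, ht0, ht1, htr⟩ :
      ∃ θ, θ ≤ u ∧ a ≤ θ ∧ circ c r θ ∈ elem d N τ' ∧ ∃ (σ' : ElemIndex N) (B' T' : Plane) (t : ℝ),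
        IsElem d N σ' V B' T' ∧ circ c r θ = V + t • (B' - V) ∧ 0 ≤ t ∧ t ≤ 1 / 2 ∧
        t * h ≤ r / 4 := by
    -- Either the starting point already belongs to τ', or going back from the clear piece the
    -- circle leaves τ' through a boundary point near V. Both points lie on sides through V, as the
    -- transport to V requires.
    by_cases hain : circ c r a ∈ elem d N τ'
    · refine ⟨a, hua, le_rfl, hain, τ, B, T, s, hE, ha, hs0, by linarith, ?_⟩
      have : s * h ≤ 6 * (η / 100) * h := by gcongr
      linarith
    · obtain ⟨θ, h1, h2⟩ := exists_circ_mem_frontier hK rfl hmidint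
        (fun hcon => hain (interior_subset hcon))
      rw [Set.uIcc_of_ge (by linarith)] at h1
      have hθu : θ ≤ u := by
        by_contra! hcon
        exact hj θ ⟨hcon, by linarith [h1.2]⟩ τ' hstar h2
      have hd := hnear θ h1.1 (by linarith)
      obtain ⟨B', T', t, hE', he, ht0, ht1, hth⟩ := exists_spoke hN hVτ' h2 (hd.trans hη8)
      exact ⟨θ, hθu, h1.1, hK.frontier_subset h2, τ', B', T', t, hE', he, ht0, ht1, by linarith⟩
  -- At most 16 pieces separate θ from u, within the extrapolation range 17w.
  have hJ := H.normSq_jump_le_jumpSq hc hq hw (by linarith) hθu (by nlinarith) hθmem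
    (fun s hs => interior_subset (hpiece s hs))
  have hpow : power c r (V + t • (B' - V)) = 0 := by rw [← hθe]; exact power_circ c r θ
  have hD : ∀ i, _ := fun i =>
    H.normSq_transportDefect_le (k := k) hc hq i hE' ht0 ht1 htr hpow
  rw [← hθe] at hD
  have hV := normSq_jump_le' k q (circ c r θ) V
  have hdist : ‖circ c r θ - V‖ ^ 2 ≤ 1 := by
    have := (hnear θ hθa (by linarith)).trans hη8
    have h3 : ‖circ c r θ - V‖ ≤ 1 := by linarith
    exact pow_le_one₀ (norm_nonneg _) h3
  set Y := ∑ τ' ∈ vertexStar d N V, localEnergy W k d r N q τ'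
  have hEsum := sum_elemEnergy_le W k d r hN q (vertexStar d N V)
  have hstab : h⁻¹ * (lambdaK W d r N τ' * jumpSq d r N q τ') ≤ Y := by
    have h1 := Finset.single_le_sum (f := fun τ' => localEnergy W k d r N q τ')
      (fun τ _ => localEnergy_nonneg W k d r hN q τ) hstar
    refine le_trans ?_ h1
    have h2 := elemEnergy_nonneg k d r N q 0 τ'
    have h3 := elemEnergy_nonneg k d r N q 1 τ'
    simp only [localEnergy]
    linarith
  have hJY : ‖jump q (circ c r θ)‖ ^ 2 ≤ 9 * 11664 ^ 2 * 17 / η / L * Y := by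
    have h1 : h⁻¹ * (L * jumpSq d r N q τ') ≤ Y := by
      refine le_trans ?_ hstab
      have := jumpSq_nonneg d r N q τ'
      gcongr
    have h2 : L * jumpSq d r N q τ' ≤ h * Y := by
      calc L * jumpSq d r N q τ' = h * (h⁻¹ * (L * jumpSq d r N q τ')) := by field_simp
        _ ≤ h * Y := by gcongr
    have h3 : r * w = η * h / 17 := by rw [hwdef]; field_simp
    rw [h3] at hJ
    have h4 : (η * h / 17 * L) * ‖jump q (circ c r θ)‖ ^ 2 ≤
        (η * h / 17 * L) * (9 * 11664 ^ 2 * 17 / η / L * Y) := by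
      calc (η * h / 17 * L) * ‖jump q (circ c r θ)‖ ^ 2
          = L * (η * h / 17 * ‖jump q (circ c r θ)‖ ^ 2) := by ring
        _ ≤ L * (9 * 11664 ^ 2 * jumpSq d r N q τ') := by gcongr
        _ = 9 * 11664 ^ 2 * (L * jumpSq d r N q τ') := by ring
        _ ≤ 9 * 11664 ^ 2 * (h * Y) := by gcongr
        _ = _ := by field_simp
    exact le_of_mul_le_mul_left h4 (by positivity)
  have h0 := hD 0
  have h1 := hD 1
  have h2 : (1 + ‖k‖ ^ 2 * ‖circ c r θ - V‖ ^ 2) * ‖jump q (circ c r θ)‖ ^ 2 ≤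
      (1 + ‖k‖ ^ 2) * (9 * 11664 ^ 2 * 17 / η / L * Y) := by
    have : ‖k‖ ^ 2 * ‖circ c r θ - V‖ ^ 2 ≤ ‖k‖ ^ 2 * 1 := by gcongr
    have h3 : 1 + ‖k‖ ^ 2 * ‖circ c r θ - V‖ ^ 2 ≤ 1 + ‖k‖ ^ 2 := by linarith
    gcongr
  have h3 : 288 * invConst * ((∑ τ ∈ vertexStar d N V, elemEnergy k d r N q 0 τ) +
      ∑ τ ∈ vertexStar d N V, elemEnergy k d r N q 1 τ) ≤ 288 * invConst * Y := by gcongr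
  calc ‖jump q V‖ ^ 2 ≤ _ := hV
    _ ≤ 3 * ((1 + ‖k‖ ^ 2) * (9 * 11664 ^ 2 * 17 / η / L * Y) + 288 * invConst * Y) := by linarith
    _ = _ := by ring

end UnfittedNitsche
end

/-! ### Short cuts: their end points, the common vertex and the local jump estimate -/

noncomputable section
namespace UnfittedNitsche

/-- Two points of the boundary on different sides lie on two sides with a common vertex. -/
theorem exists_common_vertex {d : Diagonal} {N : ℕ} (hN : 0 < N) {τ : ElemIndex N} {P Q : Plane}
    (hP : P ∈ frontier (elem d N τ)) (hQ : Q ∈ frontier (elem d N τ))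
    (huniq : ∀ {A B C : Plane}, IsElem d N τ A B C → P ∈ openSegment ℝ A B →
      Q ∈ openSegment ℝ A B → False) :
    ∃ V B T : Plane, ∃ s t : ℝ, IsElem d N τ V B T ∧ P = V + s • (B - V) ∧ Q = V + t • (T - V) ∧
      0 ≤ s ∧ 0 ≤ t := by
  have side : ∀ {x : Plane}, x ∈ frontier (elem d N τ) →
      ∃ A B C : Plane, ∃ s : ℝ, IsElem d N τ A B C ∧ 0 ≤ s ∧ s ≤ 1 ∧ x = A + s • (B - A) := by
    intro x hx
    have hE := IsElem.base (d := d) (N := N) (τ := τ)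
    have R := hE.regular hN
    rw [hE.elem_eq, R.mem_frontier_iff] at hx
    obtain ⟨hxt, hz⟩ := hx
    have hrec := R.bary_rec x
    have hsum := R.bary_sum x
    obtain ⟨h1, h2, h3⟩ := (R.mem_tri_iff x).1 hxt
    set u := bary (vertex d N τ 1) (vertex d N τ 2) (vertex d N τ 0) x
    set v := bary (vertex d N τ 2) (vertex d N τ 0) (vertex d N τ 1) x
    set w := bary (vertex d N τ 0) (vertex d N τ 1) (vertex d N τ 2) x
    rcases hz with h | h | h
    · refine ⟨_, _, _, w, hE.rotate, h3, by linarith, ?_⟩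
      rw [hrec, h, show v = 1 - w by linarith]; module
    · refine ⟨_, _, _, u, hE.rotate.rotate, h1, by linarith, ?_⟩
      rw [hrec, h, show w = 1 - u by linarith]; module
    · refine ⟨_, _, _, v, hE, h2, by linarith, ?_⟩
      rw [hrec, h, show u = 1 - v by linarith]; module
  obtain ⟨A, B, C, s, hE, hs0, hs1, hPe⟩ := side hP
  have R := hE.regular hN
  rw [hE.elem_eq, R.mem_frontier_iff] at hQ
  obtain ⟨hQt, hz⟩ := hQ
  have hrec := R.bary_rec Q
  have hsum := R.bary_sum Q
  obtain ⟨h1, h2, h3⟩ := (R.mem_tri_iff Q).1 hQt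
  set u := bary B C A Q
  set v := bary C A B Q
  set w := bary A B C Q
  rcases hz with h | h | h
  · refine ⟨B, A, C, 1 - s, w, hE.rotate.swap, ?_, ?_, by linarith, h3⟩
    · rw [hPe]; module
    · rw [hrec, h, show v = 1 - w by linarith]; module
  · refine ⟨A, B, C, s, w, hE, hPe, ?_, hs0, h3⟩
    rw [hrec, h, show u = 1 - w by linarith]; module
  -- Both points are on AB. If one is an end point it also lies on an adjacent side; otherwise both
  -- are on the open side, which is excluded.
  have hQe : Q = A + v • (B - A) := by
    rw [hrec, h, show u = 1 - v by linarith]; module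
  rcases hs0.eq_or_lt with h0 | hs0'
  · refine ⟨A, C, B, 0, v, hE.swap, ?_, hQe, le_rfl, h2⟩
    rw [hPe, ← h0]; module
  rcases hs1.eq_or_lt with h0 | hs1'
  · refine ⟨B, C, A, 0, 1 - v, hE.rotate, ?_, ?_, le_rfl, by linarith⟩
    · rw [hPe, h0]; module
    · rw [hQe]; module
  rcases h2.eq_or_lt with h0 | hv0
  · refine ⟨A, B, C, s, 0, hE, hPe, ?_, hs0, le_rfl⟩
    rw [hQe, ← h0]; module
  rcases (show v ≤ 1 by linarith).eq_or_lt with h0 | hv1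
  · refine ⟨B, A, C, 1 - s, 0, hE.rotate.swap, ?_, ?_, by linarith, le_rfl⟩
    · rw [hPe]; module
    · rw [hQe, h0]; module
  exfalso
  refine huniq hE ?_ ?_
  · rw [openSegment_eq_image']; exact ⟨s, ⟨hs0', hs1'⟩, hPe.symm⟩
  · rw [openSegment_eq_image']; exact ⟨v, ⟨hv0, hv1⟩, hQe.symm⟩

/-- The elements that share a vertex with a given one. -/
def vertexNbrs (d : Diagonal) (N : ℕ) (τ : ElemIndex N) : Finset (ElemIndex N) :=
  by classical exact Finset.univ.biUnion fun m : Fin 3 => vertexStar d N (vertex d N τ m)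

theorem mem_vertexNbrs {d : Diagonal} {N : ℕ} {τ τ' : ElemIndex N} :
    τ' ∈ vertexNbrs d N τ ↔ ∃ m, vertex d N τ m ∈ Set.range (vertex d N τ') := by
  classical
  simp only [vertexNbrs, Finset.mem_biUnion, Finset.mem_univ, true_and, mem_vertexStar]

theorem mem_vertexNbrs_comm {d : Diagonal} {N : ℕ} {τ τ' : ElemIndex N} :
    τ' ∈ vertexNbrs d N τ ↔ τ ∈ vertexNbrs d N τ' := by
  rw [mem_vertexNbrs, mem_vertexNbrs]
  constructor
  · rintro ⟨m, m', h⟩; exact ⟨m', m, h.symm⟩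
  · rintro ⟨m, m', h⟩; exact ⟨m', m, h.symm⟩

theorem card_vertexNbrs_le (d : Diagonal) {N : ℕ} (hN : 0 < N) (τ : ElemIndex N) :
    (vertexNbrs d N τ).card ≤ 24 := by
  classical
  refine (Finset.card_biUnion_le_card_mul _ _ 8 fun m _ => card_vertexStar_le d hN _).trans ?_
  simp

theorem vertexStar_subset_vertexNbrs {d : Diagonal} {N : ℕ} {τ : ElemIndex N} {V : Plane}
    (hV : V ∈ Set.range (vertex d N τ)) : vertexStar d N V ⊆ vertexNbrs d N τ := by
  obtain ⟨m, rfl⟩ := hV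
  intro τ' h
  exact mem_vertexNbrs.2 ⟨m, mem_vertexStar.1 h⟩

theorem self_mem_vertexNbrs {d : Diagonal} {N : ℕ} (τ : ElemIndex N) : τ ∈ vertexNbrs d N τ :=
  mem_vertexNbrs.2 ⟨0, 0, rfl⟩

/-- Sums over the neighbours of all elements are controlled by sums over all elements. -/
theorem sum_vertexNbrs_le (d : Diagonal) {N : ℕ} (hN : 0 < N) (S : Finset (ElemIndex N))
    {f : ElemIndex N → ℝ} (hf : ∀ τ, 0 ≤ f τ) :
    ∑ τ ∈ S, ∑ τ' ∈ vertexNbrs d N τ, f τ' ≤ 24 * ∑ τ, f τ := by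
  classical
  calc ∑ τ ∈ S, ∑ τ' ∈ vertexNbrs d N τ, f τ' ≤ ∑ τ, ∑ τ' ∈ vertexNbrs d N τ, f τ' :=
        Finset.sum_le_sum_of_subset_of_nonneg (Finset.subset_univ _)
          fun _ _ _ => Finset.sum_nonneg fun τ _ => hf τ
    -- Sharing a vertex is symmetric, so the sums can be exchanged; then each element is counted at
    -- most 24 times.
    _ = ∑ τ', ∑ τ ∈ vertexNbrs d N τ', f τ' :=
        Finset.sum_comm' fun τ τ' => by simp [mem_vertexNbrs_comm (τ := τ)]
    _ ≤ ∑ τ', 24 * f τ' := by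
        refine Finset.sum_le_sum fun τ' _ => ?_
        rw [Finset.sum_const, nsmul_eq_mul]
        have : ((vertexNbrs d N τ').card : ℝ) ≤ 24 := by exact_mod_cast card_vertexNbrs_le d hN τ'
        exact mul_le_mul_of_nonneg_right this (hf τ')
    _ = _ := by rw [Finset.mul_sum]

/-- The ends of a short arc through an interior point of an element. -/
theorem Admissible.exists_arc_ends {d : Diagonal} {r : ℝ} {N : ℕ} {τ : ElemIndex N} {c : Plane}
    (H : Admissible d r N) (hc : IsSite c) {θ ℓ : ℝ} (hℓ : 0 < ℓ) (hℓ1 : ℓ ≤ 1)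
    (hθ : circ c r θ ∈ interior (elem d N τ))
    (hshort : (arcLength r).real (cutArc d r N τ) < r * ℓ) :
    ∃ a b, θ - ℓ ≤ a ∧ a < θ ∧ θ < b ∧ b ≤ θ + ℓ ∧ circ c r a ∈ frontier (elem d N τ) ∧
      circ c r b ∈ frontier (elem d N τ) ∧ ∀ s, a ≤ s → s ≤ b → circ c r s ∈ elem d N τ := by
  have hr := H.radius.1
  -- An arc of angle ℓ inside the element would be longer than its whole cut. So the circle leaves
  -- the element within angle ℓ on either side of θ.
  have hlong : ∀ u, ¬ ∀ s ∈ Set.Ioo u (u + ℓ), circ c r s ∈ elem d N τ := by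
    intro u hcon
    have h1 := circleArcLength_real_ge (c := c) hr (measurableSet_cutArc d r N τ) (u := u) hℓ.le
      (by linarith [Real.pi_gt_three])
      (fun s hs => ⟨sphere_subset_interface hc (circ_mem_sphere hr s), hcon s hs⟩)
    have h2 := circleArcLength_real_le hc r (cutArc d r N τ)
    linarith
  have hK := isClosed_elem d N τ
  have hcc := continuous_circ c r
  have right := hlong θ
  have left := hlong (θ - ℓ)
  push Not at right left
  obtain ⟨s, hs, hsK⟩ := right
  obtain ⟨s', hs', hsK'⟩ := left
  obtain ⟨b, hb1, hb2, hb3, hb4⟩ := exists_first_exit isOpen_interior hcc hs.1.le hθ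
    (fun h => hsK (interior_subset h))
  obtain ⟨a', ha1, ha2, ha3, ha4⟩ := exists_first_exit (f := fun t => circ c r (-t)) (a := -θ)
    (b := -s') isOpen_interior (hcc.comp continuous_neg) (by linarith [hs'.2])
    (by simpa using hθ) (by simpa using fun h => hsK' (interior_subset h))
  have hb5 : ∀ t ∈ Set.Icc θ b, circ c r t ∈ elem d N τ := by
    have hm : Set.MapsTo (circ c r) (Set.Ico θ b) (elem d N τ) := fun t ht =>
      interior_subset (hb4 t ht.1 ht.2)
    have := hm.closure hcc
    rwa [closure_Ico hb1.ne, hK.closure_eq] at this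
  have ha5 : ∀ t ∈ Set.Icc (-θ) a', circ c r (-t) ∈ elem d N τ := by
    have hm : Set.MapsTo (fun t => circ c r (-t)) (Set.Ico (-θ) a') (elem d N τ) := fun t ht =>
      interior_subset (ha4 t ht.1 ht.2)
    have := hm.closure (hcc.comp continuous_neg)
    rwa [closure_Ico ha1.ne, hK.closure_eq] at this
  refine ⟨-a', b, by linarith [hs'.1], by linarith, hb1, by linarith [hs.2], ?_, ?_, ?_⟩
  · exact ⟨subset_closure (ha5 a' ⟨ha1.le, le_rfl⟩), ha3⟩
  · exact ⟨subset_closure (hb5 b ⟨hb1.le, le_rfl⟩), hb3⟩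
  · intro t h1 h2
    rcases le_total θ t with h | h
    · exact hb5 t ⟨h, h2⟩
    · have := ha5 (-t) ⟨by linarith, by linarith⟩
      rwa [neg_neg] at this

/-- The jump on one element is controlled by the energy and the stabilization nearby. -/
theorem exists_jumpSq_le (W : MaterialWeight) (k : Plane) {σ : ℝ} (hσ : 0 < σ) :
    ∃ C : ℝ, 0 < C ∧ ∀ {d : Diagonal} {r : ℝ} {N : ℕ}, Admissible d r N → meshSize N ≤ σ * r →
      ∀ {q : Fin 2 → Plane → ℂ}, q ∈ femSpace d r N → ∀ τ ∈ cutElems d r N,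
      (meshSize N)⁻¹ * jumpSq d r N q τ ≤
        C * ∑ τ' ∈ vertexNbrs d N τ, localEnergy W k d r N q τ' := by
  obtain ⟨C₁, hC₁, hvertex⟩ := exists_vertex_bound W k hσ
  have hη := arcFraction_pos hσ
  have hη1 := arcFraction_le σ
  have hw0 := W.supNorm_pos 0
  have hw1 := W.supNorm_pos 1
  have hI := invConst_pos
  set η := arcFraction σ with hηdef
  set L : ℝ := W.supNorm 0 * W.supNorm 1 * (η / 100) / (64 * max (W.supNorm 0) (W.supNorm 1)) with hL
  have hm : 0 < max (W.supNorm 0) (W.supNorm 1) := lt_max_of_lt_left hw0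
  have hLpos : 0 < L := by positivity
  -- Each of the two ends is reached from V, at cost C₁ for the jump at V and 288 `invConst` for the
  -- side; the remaining 2 `invConst` is the passage between chord and arc.
  set C₂ : ℝ := 3 * (2 * (3 * (C₁ + 288 * invConst)) + 2 * invConst) with hC₂
  have hC₂pos : 0 < C₂ := by positivity
  refine ⟨32 * C₂ + 1 / L, by positivity, ?_⟩
  intro d r N H hσr q hq τ hτ
  have hr := H.radius.1
  have hN := H.N_pos
  have hh := meshSize_pos hN
  set h := meshSize N with hhdef
  have hηr : η * h ≤ r / 16 := arcFraction_mul_le hσ hh.le hσr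
  set Y := ∑ τ' ∈ vertexNbrs d N τ, localEnergy W k d r N q τ' with hY
  have hY0 : 0 ≤ Y := Finset.sum_nonneg fun _ _ => localEnergy_nonneg W k d r hN q _
  have hlocY : localEnergy W k d r N q τ ≤ Y :=
    Finset.single_le_sum (f := fun τ' => localEnergy W k d r N q τ')
      (fun _ _ => localEnergy_nonneg W k d r hN q _) (self_mem_vertexNbrs τ)
  have hEY := (elemEnergy_add_le W k d r hN q τ).trans hlocY
  -- The threshold is far below the length ηh of the arc followed around V, so that the ends of a
  -- short cut are close enough to V.
  rcases le_or_gt (η / 100 * h) ((arcLength r).real (cutArc d r N τ)) with hlong | hshort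
  · have hlam := lambdaK_ge W hN τ (by positivity) hlong
    rw [← hL] at hlam
    have hj0 := jumpSq_nonneg d r N q τ
    have h1 : h⁻¹ * (L * jumpSq d r N q τ) ≤ Y := by
      have h2 : h⁻¹ * (L * jumpSq d r N q τ) ≤ h⁻¹ * (lambdaK W d r N τ * jumpSq d r N q τ) := by
        gcongr
      have h3 := elemEnergy_nonneg k d r N q 0 τ
      have h4 := elemEnergy_nonneg k d r N q 1 τ
      have h5 : h⁻¹ * (lambdaK W d r N τ * jumpSq d r N q τ) ≤ localEnergy W k d r N q τ := by
        rw [localEnergy]; linarith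
      linarith
    calc h⁻¹ * jumpSq d r N q τ = 1 / L * (h⁻¹ * (L * jumpSq d r N q τ)) := by field_simp
      _ ≤ 1 / L * Y := by gcongr
      _ ≤ _ := by
        have : 0 ≤ 32 * C₂ * Y := by positivity
        linarith
  · have hpt : ∀ x ∈ cutArc d r N τ, x ∈ interior (elem d N τ) → ‖jump q x‖ ^ 2 ≤ C₂ * Y := by
      intro x hx hxint
      obtain ⟨c, hc, hxc⟩ : ∃ c, IsSite c ∧ x ∈ Metric.sphere c r := by
        rcases hx.1 with h | h
        · exact ⟨siteA, .inl rfl, h⟩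
        · exact ⟨siteB, .inr rfl, h⟩
      obtain ⟨θ, -, rfl⟩ := exists_circ_eq hr hxc 0
      set ℓ := η / 100 * h / r with hℓdef
      have hrℓ : r * ℓ = η / 100 * h := by rw [hℓdef]; field_simp
      have hℓ : 0 < ℓ := by positivity
      have hℓ1 : ℓ ≤ 1 := by
        have : r * ℓ ≤ r * 1 := by rw [hrℓ]; linarith
        exact le_of_mul_le_mul_left this hr
      obtain ⟨a, b, ha1, ha2, hb1, hb2, haf, hbf, harc⟩ :=
        H.exists_arc_ends hc hℓ hℓ1 hxint (by rw [hrℓ]; exact hshort)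
      have hi : ∀ θ, circ c r θ ∈ interface r := fun θ =>
        Admissible.sphere_subset_interface hc (circ_mem_sphere hr θ)
      -- The ends are distinct points of the circle, so they cannot lie on the same open side.
      obtain ⟨V, B, T, s, t, hE, hPe, hQe, hs0, ht0⟩ := exists_common_vertex hN haf hbf
        (fun hE h1 h2 => by
          have := circ_injOn hr (by
            rw [abs_lt]; constructor <;> linarith [Real.pi_gt_three])
            (H.edge_unique hE h1 h2 (hi a) (hi b))
          linarith)
      have R := hE.regular hN
      have hPQ : ‖circ c r a - circ c r b‖ ≤ 2 * (η / 100) * h := by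
        refine (norm_circ_sub_le hr a b).trans ?_
        rw [abs_sub_comm, abs_of_pos (by linarith)]
        calc r * (b - a) ≤ r * (2 * ℓ) := by gcongr; linarith
          _ = 2 * (η / 100) * h := by linarith
      rw [hPe, hQe] at hPQ
      -- With D = 2η/100 the parameters are at most 6η/100, which `exists_vertex_bound` requires.
      obtain ⟨hs1, ht1⟩ := R.param_le (by positivity) hPQ
      have hs1' : s ≤ 6 * (η / 100) := by linarith
      have ht1' : t ≤ 6 * (η / 100) := by linarith
      have hV := hvertex H hσr hq hc hE hs0 hs1' hPe
      have hstar := vertexStar_subset_vertexNbrs hE.mem_range.1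
      have hYV : ∑ τ' ∈ vertexStar d N V, localEnergy W k d r N q τ' ≤ Y :=
        Finset.sum_le_sum_of_subset_of_nonneg hstar fun _ _ _ => localEnergy_nonneg W k d r hN q _
      have hEV := (sum_elemEnergy_le W k d r hN q (vertexStar d N V)).trans hYV
      have hend : ∀ {B T : Plane} {s θ : ℝ}, IsElem d N τ V B T → 0 ≤ s → s ≤ 6 * (η / 100) →
          circ c r θ = V + s • (B - V) →
          ‖jump q (circ c r θ)‖ ^ 2 ≤ 3 * (C₁ + 288 * invConst) * Y := by
        intro B T s θ hE hs0 hs1 he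
        have hD : ∀ i, _ := fun i => H.normSq_transportDefect_le (k := k) hc hq i hE hs0
          (by linarith) (by
            have : s * h ≤ 6 * (η / 100) * h := by gcongr
            linarith) (by rw [← he]; exact power_circ c r θ)
        rw [← he] at hD
        have h0 := hD 0
        have h1 := hD 1
        have h2 := normSq_jump_le k q (circ c r θ) V
        have h3 : 288 * invConst * ((∑ τ ∈ vertexStar d N V, elemEnergy k d r N q 0 τ) +
          ∑ τ ∈ vertexStar d N V, elemEnergy k d r N q 1 τ) ≤ 288 * invConst * Y := by gcongr
        have h4 : C₁ * ∑ τ' ∈ vertexStar d N V, localEnergy W k d r N q τ' ≤ C₁ * Y := by gcongr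
        linarith
      have hjP := hend hE hs0 hs1' hPe
      have hjQ := hend hE.swap ht0 ht1' hQe
      have hw1 : r * (b - a) ≤ h / 8 := by
        have h1 : r * (b - a) ≤ r * (2 * ℓ) := by gcongr; linarith
        have h2 : η / 100 * h ≤ 1 / 16 / 100 * h := by gcongr
        linarith
      have e1 : (a + b) / 2 - (b - a) / 2 = a := by ring
      have e2 : (a + b) / 2 + (b - a) / 2 = b := by ring
      have e3 : (a + b) / 2 + (θ - (a + b) / 2) = θ := by ring
      have := H.normSq_jump_le_of_short_arc hc k hq hE (m := (a + b) / 2) (w := (b - a) / 2)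
        (δ := θ - (a + b) / 2) (s := s) (t := t) (by linarith)
        (by rw [abs_lt]; constructor <;> linarith) (by rw [e1]; exact hPe) (by rw [e2]; exact hQe)
        (by rw [e1, e2]; exact harc) (by rw [e3]; exact hxint)
        (by rw [show 2 * ((b - a) / 2) = b - a by ring]; exact hw1)
      rw [e1, e2, e3] at this
      have h3 : 2 * invConst * (elemEnergy k d r N q 0 τ + elemEnergy k d r N q 1 τ) ≤
        2 * invConst * Y := by gcongr
      rw [hC₂]
      linarith
    -- The cut meets the boundary of the element in finitely many points, which have arc length
    -- zero; the pointwise bound at interior points suffices.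
    have hint : jumpSq d r N q τ ≤ ∫ _ in cutArc d r N τ, C₂ * Y ∂(arcLength r) := by
      refine integral_mono_ae (((H.continuousOn_jump hq hτ).norm.pow 2).integrableOn_compact
        (isCompact_cutArc d r N τ)) (integrable_const _) ?_
      have hnull : ∀ᵐ x ∂(arcLength r), x ∉ interface r ∩ frontier (elem d N τ) :=
        measure_eq_zero_iff_ae_notMem.1 (arcLength_finite hr (H.finite_hits τ).1)
      filter_upwards [ae_restrict_mem (measurableSet_cutArc d r N τ),
        ae_restrict_of_ae hnull] with x hx hxf
      refine hpt x hx ?_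
      by_contra hcon
      exact hxf ⟨hx.1, subset_closure hx.2, hcon⟩
    rw [setIntegral_const, smul_eq_mul] at hint
    have h1 : jumpSq d r N q τ ≤ 32 * h * (C₂ * Y) :=
      hint.trans (by gcongr; exact arcLength_cutArc_le hr hN τ)
    calc h⁻¹ * jumpSq d r N q τ ≤ h⁻¹ * (32 * h * (C₂ * Y)) := by gcongr
      _ = 32 * C₂ * Y := by field_simp
      _ ≤ _ := by
        have : 0 ≤ 1 / L * Y := by positivity
        linarith

end UnfittedNitsche
end

noncomputable section
namespace UnfittedNitsche

/-! ### Cauchy–Schwarz inequalities -/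

/-- The optimal choice is t = z/X; for X = 0 a large t shows that z > 0 is impossible. -/
theorem sq_le_mul_of_forall {z X Y : ℝ} (hz : 0 ≤ z) (hX : 0 ≤ X) (hY : 0 ≤ Y)
    (h : ∀ t, 0 < t → 2 * z ≤ t * X + t⁻¹ * Y) : z ^ 2 ≤ X * Y := by
  rcases hz.eq_or_lt with rfl | hz
  · simpa using mul_nonneg hX hY
  rcases hX.eq_or_lt with rfl | hX
  · have := h ((Y + 1) / z) (by positivity)
    rw [inv_div, mul_zero, zero_add, div_mul_eq_mul_div, le_div_iff₀ (by positivity)] at this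
    nlinarith
  · have := h (z / X) (by positivity)
    rw [inv_div, div_mul_cancel₀ _ hX.ne'] at this
    have h2 : z ≤ X / z * Y := by linarith
    rw [div_mul_eq_mul_div, le_div_iff₀ hz] at h2
    linarith

/-- Young's inequality with a free parameter is integrated before optimising. In this form only the
bounds u and v have to be integrable, which spares measurability of the fluxes. -/
theorem normSq_integral_le {α : Type*} [MeasurableSpace α] {μ : Measure α} {f : α → ℂ}
    {u v : α → ℝ} (hu : Integrable u μ) (hv : Integrable v μ) (hu0 : ∀ᵐ x ∂μ, 0 ≤ u x)
    (hv0 : ∀ᵐ x ∂μ, 0 ≤ v x)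
    (h : ∀ᵐ x ∂μ, ‖f x‖ ^ 2 ≤ u x * v x) :
    ‖∫ x, f x ∂μ‖ ^ 2 ≤ (∫ x, u x ∂μ) * ∫ x, v x ∂μ := by
  refine sq_le_mul_of_forall (norm_nonneg _) (integral_nonneg_of_ae hu0)
    (integral_nonneg_of_ae hv0) fun t ht => ?_
  have hb : ∀ᵐ x ∂μ, ‖f x‖ ≤ (t * u x + t⁻¹ * v x) / 2 := by
    filter_upwards [hu0, hv0, h] with x h0 h1 h2
    refine le_of_sq_le_sq (h2.trans ?_) (by positivity)
    have e : (t * u x) * (t⁻¹ * v x) = u x * v x := by field_simp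
    rw [← e]
    nlinarith [sq_nonneg (t * u x - t⁻¹ * v x)]
  have hi : Integrable (fun x => (t * u x + t⁻¹ * v x) / 2) μ :=
    ((hu.const_mul t).add (hv.const_mul t⁻¹)).div_const 2
  have := norm_integral_le_of_norm_le hi hb
  rw [integral_div, integral_add (hu.const_mul t) (hv.const_mul t⁻¹), integral_const_mul,
    integral_const_mul] at this
  linarith

theorem normSq_sum_le {ι : Type*} (S : Finset ι) {z : ι → ℂ} {a b : ι → ℝ} (ha : ∀ i, 0 ≤ a i)
    (hb : ∀ i, 0 ≤ b i) (h : ∀ i ∈ S, ‖z i‖ ^ 2 ≤ a i * b i) :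
    ‖∑ i ∈ S, z i‖ ^ 2 ≤ (∑ i ∈ S, a i) * ∑ i ∈ S, b i := by
  have h1 : ‖∑ i ∈ S, z i‖ ≤ √(∑ i ∈ S, a i) * √(∑ i ∈ S, b i) := by
    refine (norm_sum_le _ _).trans ((Finset.sum_le_sum fun i hi => ?_).trans
      (Real.sum_sqrt_mul_sqrt_le S ha hb))
    rw [← Real.sqrt_mul (ha i)]
    exact Real.le_sqrt_of_sq_le (h i hi)
  calc ‖∑ i ∈ S, z i‖ ^ 2 ≤ (√(∑ i ∈ S, a i) * √(∑ i ∈ S, b i)) ^ 2 := by gcongr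
    _ = _ := by
      rw [mul_pow, Real.sq_sqrt (Finset.sum_nonneg fun i _ => ha i),
        Real.sq_sqrt (Finset.sum_nonneg fun i _ => hb i)]

/-! ### Bounds for the material weight -/

theorem sum_normSq_mulVec_le (M : Matrix (Fin 2) (Fin 2) ℂ) (v : Fin 2 → ℂ) :
    ∑ j, ‖(M *ᵥ v) j‖ ^ 2 ≤ matNorm M ^ 2 * ∑ j, ‖v j‖ ^ 2 := by
  have h := (Matrix.toEuclideanCLM (n := Fin 2) (𝕜 := ℂ) M).le_opNorm (WithLp.toLp 2 v)
  have h2 : ‖Matrix.toEuclideanCLM (n := Fin 2) (𝕜 := ℂ) M (WithLp.toLp 2 v)‖ ^ 2 ≤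
      (matNorm M * ‖WithLp.toLp 2 v‖) ^ 2 := by gcongr; exact h
  rw [mul_pow, EuclideanSpace.norm_sq_eq, EuclideanSpace.norm_sq_eq] at h2
  simpa using h2

theorem normSq_dotProduct_le (a b : Fin 2 → ℂ) :
    ‖a ⬝ᵥ b‖ ^ 2 ≤ (∑ j, ‖a j‖ ^ 2) * ∑ j, ‖b j‖ ^ 2 := by
  calc ‖a ⬝ᵥ b‖ ^ 2 ≤ (∑ j, ‖a j‖ * ‖b j‖) ^ 2 := by
        gcongr
        exact (norm_sum_le _ _).trans (by simp)
    _ ≤ _ := Finset.sum_mul_sq_le_sq_mul_sq _ _ _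

theorem matNorm_nonneg (M : Matrix (Fin 2) (Fin 2) ℂ) : 0 ≤ matNorm M := norm_nonneg _

theorem MaterialWeight.matNorm_side_le (W : MaterialWeight) (r : ℝ) (i : Fin 2) (x : Plane) :
    matNorm (W.side r i x) ≤ W.supNorm i := by
  fin_cases i
  · simp only [MaterialWeight.side, MaterialWeight.supNorm, Fin.zero_eta, Matrix.cons_val_zero]
    split_ifs
    · exact le_max_left _ _
    · exact le_max_right _ _
  · simp [MaterialWeight.side, MaterialWeight.supNorm]

theorem MaterialWeight.posDef_side (W : MaterialWeight) (r : ℝ) (i : Fin 2) (x : Plane) :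
    (W.side r i x).PosDef := by
  fin_cases i
  · simp only [MaterialWeight.side, Fin.zero_eta, Matrix.cons_val_zero]
    split_ifs
    · exact W.posDefA
    · exact W.posDefB
  · simpa [MaterialWeight.side] using W.posDef0

/-- The quadratic form has a positive minimum on the compact unit sphere and is homogeneous of
degree two. -/
theorem exists_posDef_bound {M : Matrix (Fin 2) (Fin 2) ℂ} (hM : M.PosDef) :
    ∃ m : ℝ, 0 < m ∧ ∀ v : Fin 2 → ℂ, m * ∑ j, ‖v j‖ ^ 2 ≤ ((M *ᵥ v) ⬝ᵥ star v).re := by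
  let f : EuclideanSpace ℂ (Fin 2) → ℝ := fun v => ((M *ᵥ v.ofLp) ⬝ᵥ star v.ofLp).re
  have hf : Continuous f := by
    have : f = fun v => (∑ j, (∑ l, M j l * v l) * star (v j)).re := by
      funext v; simp [f, dotProduct, Matrix.mulVec]
    rw [this]
    simp only [Fin.sum_univ_two]
    fun_prop
  have hpos : ∀ v : EuclideanSpace ℂ (Fin 2), v ≠ 0 → 0 < f v := by
    intro v hv
    have hv' : v.ofLp ≠ 0 := fun h => hv (by ext j; exact congrFun h j)
    have := hM.re_dotProduct_pos hv'
    simp only [f]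
    rw [dotProduct_comm]
    exact this
  have hsc : ∀ (s : ℝ) (v : EuclideanSpace ℂ (Fin 2)), f ((s : ℂ) • v) = s ^ 2 * f v := by
    intro s v
    simp only [f, WithLp.ofLp_smul, Matrix.mulVec_smul, star_smul, smul_dotProduct,
      dotProduct_smul, smul_eq_mul]
    rw [show star (s : ℂ) = s from Complex.conj_ofReal s, ← mul_assoc, ← Complex.ofReal_mul,
      Complex.re_ofReal_mul]
    ring
  obtain ⟨v₀, hv₀, hmin⟩ := (isCompact_sphere (0 : EuclideanSpace ℂ (Fin 2)) 1).exists_isMinOn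
    (NormedSpace.sphere_nonempty.2 zero_le_one) hf.continuousOn
  have hv₀' : v₀ ≠ 0 := by
    rintro rfl
    simp at hv₀
  refine ⟨f v₀, hpos _ hv₀', fun v => ?_⟩
  by_cases hv : (WithLp.toLp 2 v : EuclideanSpace ℂ (Fin 2)) = 0
  · have hv0 : v = 0 := by
      funext j
      exact congrFun (congrArg WithLp.ofLp hv) j
    simp [hv0]
  set z : EuclideanSpace ℂ (Fin 2) := WithLp.toLp 2 v
  have hz : 0 < ‖z‖ := norm_pos_iff.2 hv
  have h1 := hmin (a := ((‖z‖⁻¹ : ℝ) : ℂ) • z) (by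
    rw [mem_sphere_zero_iff_norm, norm_smul, Complex.norm_real, norm_inv, norm_norm,
      inv_mul_cancel₀ hz.ne'])
  simp only [Set.mem_ofPred_eq] at h1
  rw [hsc] at h1
  have h2 : ∑ j, ‖v j‖ ^ 2 = ‖z‖ ^ 2 := by rw [EuclideanSpace.norm_sq_eq]
  rw [h2]
  calc f v₀ * ‖z‖ ^ 2 ≤ (‖z‖⁻¹ ^ 2 * f z) * ‖z‖ ^ 2 := by gcongr
    _ = f z := by field_simp

theorem MaterialWeight.exists_lower_bound (W : MaterialWeight) :
    ∃ m : ℝ, 0 < m ∧ ∀ (r : ℝ) (i : Fin 2) (x : Plane) (v : Fin 2 → ℂ),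
      m * ∑ j, ‖v j‖ ^ 2 ≤ ((W.side r i x *ᵥ v) ⬝ᵥ star v).re := by
  obtain ⟨a, ha, hA⟩ := exists_posDef_bound W.posDefA
  obtain ⟨b, hb, hB⟩ := exists_posDef_bound W.posDefB
  obtain ⟨e, he, h0⟩ := exists_posDef_bound W.posDef0
  refine ⟨min a (min b e), lt_min ha (lt_min hb he), fun r i x v => ?_⟩
  have hs : 0 ≤ ∑ j, ‖v j‖ ^ 2 := by positivity
  have l1 : min a (min b e) ≤ a := min_le_left _ _
  have l2 : min a (min b e) ≤ b := (min_le_right _ _).trans (min_le_left _ _)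
  have l3 : min a (min b e) ≤ e := (min_le_right _ _).trans (min_le_right _ _)
  fin_cases i
  · simp only [MaterialWeight.side]
    simp only [Fin.zero_eta, Matrix.cons_val_zero]
    split_ifs
    · exact le_trans (by gcongr) (hA v)
    · exact le_trans (by gcongr) (hB v)
  · exact le_trans (by gcongr) (h0 v)

theorem im_mulVec_dotProduct_star {M : Matrix (Fin 2) (Fin 2) ℂ} (hM : M.IsHermitian)
    (v : Fin 2 → ℂ) : ((M *ᵥ v) ⬝ᵥ star v).im = 0 := by
  rw [dotProduct_comm]
  exact hM.im_star_dotProduct_mulVec_self v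

/-! ### The flux terms -/

theorem sum_normSq_normal {r : ℝ} (hr : 0 < r) {x : Plane} (hx : x ∈ interface r) :
    ∑ j, ‖((normal r x j : ℝ) : ℂ)‖ ^ 2 = 1 := by
  have h : ‖normal r x‖ = 1 := by
    unfold normal
    split_ifs with hA
    · rw [norm_smul, norm_inv, Real.norm_of_nonneg hr.le, ← dist_eq_norm, Metric.mem_sphere.1 hA,
        inv_mul_cancel₀ hr.ne']
    · have hB : x ∈ Metric.sphere siteB r := hx.resolve_left hA
      rw [norm_smul, norm_inv, Real.norm_of_nonneg hr.le, ← dist_eq_norm, Metric.mem_sphere.1 hB,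
        inv_mul_cancel₀ hr.ne']
  have h2 : ‖normal r x‖ ^ 2 = 1 := by rw [h, one_pow]
  rw [EuclideanSpace.norm_sq_eq] at h2
  simpa using h2

theorem normSq_flux_le (W : MaterialWeight) (k : Plane) {r : ℝ} (hr : 0 < r)
    (q : Fin 2 → Plane → ℂ) (i : Fin 2) {x : Plane} (hx : x ∈ interface r) :
    ‖flux W k r q i x‖ ^ 2 ≤ W.supNorm i ^ 2 * ∑ j, ‖blochGrad k (q i) x j‖ ^ 2 := by
  unfold flux
  refine (normSq_dotProduct_le _ _).trans ?_
  rw [sum_normSq_normal hr hx, mul_one]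
  refine (sum_normSq_mulVec_le _ _).trans ?_
  have h1 := W.matNorm_side_le r i x
  have h2 := matNorm_nonneg (W.side r i x)
  gcongr

theorem kappa_nonneg (W : MaterialWeight) (d : Diagonal) {r : ℝ} {N : ℕ} (hN : 0 < N)
    (τ : ElemIndex N) (i : Fin 2) : 0 ≤ kappa W d r N τ i := by
  have hD := (weightDenom_pos W (d := d) (r := r) hN τ).le
  have h0 := partArea_nonneg d r N τ 0
  have h1 := partArea_nonneg d r N τ 1
  have w0 := (W.supNorm_pos 0).le
  have w1 := (W.supNorm_pos 1).le
  fin_cases i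
  · exact div_nonneg (mul_nonneg w1 h0) hD
  · exact div_nonneg (mul_nonneg w0 h1) hD

/-- The averaging weights compensate a small part of the element. -/
theorem kappa_supNorm_sq_le (W : MaterialWeight) (d : Diagonal) {r : ℝ} {N : ℕ} (hN : 0 < N)
    (τ : ElemIndex N) (i : Fin 2) :
    (kappa W d r N τ i * W.supNorm i) ^ 2 ≤
      max (W.supNorm 0) (W.supNorm 1) *
        (W.supNorm 0 * W.supNorm 1 / weightDenom W d r N τ) * partArea d r N τ i := by
  have hD := weightDenom_pos W (d := d) (r := r) hN τ
  have h0 := partArea_nonneg d r N τ 0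
  have h1 := partArea_nonneg d r N τ 1
  have w0 := W.supNorm_pos 0
  have w1 := W.supNorm_pos 1
  set D := weightDenom W d r N τ with hDdef
  have hsum : W.supNorm 1 * partArea d r N τ 0 + W.supNorm 0 * partArea d r N τ 1 = D := rfl
  fin_cases i
  · have e : kappa W d r N τ 0 = W.supNorm 1 * partArea d r N τ 0 / D := rfl
    have hle : W.supNorm 1 * partArea d r N τ 0 / D ≤ 1 := by
      rw [div_le_one hD, ← hsum]
      have := mul_nonneg w0.le h1
      linarith
    change (kappa W d r N τ 0 * W.supNorm 0) ^ 2 ≤ _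
    rw [e]
    -- One of the two factors κ is bounded by 1; the other keeps |K_i|/D_K.
    calc (W.supNorm 1 * partArea d r N τ 0 / D * W.supNorm 0) ^ 2
        = (W.supNorm 1 * partArea d r N τ 0 / D) * (W.supNorm 0 *
          (W.supNorm 0 * W.supNorm 1 / D) * partArea d r N τ 0) := by ring
      _ ≤ 1 * (max (W.supNorm 0) (W.supNorm 1) *
          (W.supNorm 0 * W.supNorm 1 / D) * partArea d r N τ 0) := by
          gcongr
          exact le_max_left _ _
      _ = _ := one_mul _
  · have e : kappa W d r N τ 1 = W.supNorm 0 * partArea d r N τ 1 / D := rfl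
    have hle : W.supNorm 0 * partArea d r N τ 1 / D ≤ 1 := by
      rw [div_le_one hD, ← hsum]
      have := mul_nonneg w1.le h0
      linarith
    change (kappa W d r N τ 1 * W.supNorm 1) ^ 2 ≤ _
    rw [e]
    calc (W.supNorm 0 * partArea d r N τ 1 / D * W.supNorm 1) ^ 2
        = (W.supNorm 0 * partArea d r N τ 1 / D) * (W.supNorm 1 *
          (W.supNorm 0 * W.supNorm 1 / D) * partArea d r N τ 1) := by ring
      _ ≤ 1 * (max (W.supNorm 0) (W.supNorm 1) *
          (W.supNorm 0 * W.supNorm 1 / D) * partArea d r N τ 1) := by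
          gcongr
          exact le_max_right _ _
      _ = _ := one_mul _

/-- The constant of the bound of the flux terms. -/
def MaterialWeight.fluxConst (W : MaterialWeight) : ℝ :=
  2 * invConst * max (W.supNorm 0) (W.supNorm 1)

theorem MaterialWeight.fluxConst_pos (W : MaterialWeight) : 0 < W.fluxConst := by
  have hm : 0 < max (W.supNorm 0) (W.supNorm 1) := lt_max_of_lt_left (W.supNorm_pos 0)
  have := invConst_pos
  unfold fluxConst
  positivity

theorem normSq_add_le (a b : ℂ) : ‖a + b‖ ^ 2 ≤ 2 * (‖a‖ ^ 2 + ‖b‖ ^ 2) := by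
  have h : ‖a + b‖ ^ 2 ≤ (‖a‖ + ‖b‖) ^ 2 := by gcongr; exact norm_add_le _ _
  nlinarith [sq_nonneg (‖a‖ - ‖b‖)]

namespace Admissible

variable {d : Diagonal} {r : ℝ} {N : ℕ} {τ : ElemIndex N}

/-- The area |K_i| retained from κ_i² meets |G(x)|², and their product is what the inverse estimate
bounds. No area remains in a denominator except D_K. -/
theorem normSq_avgFlux_le (H : Admissible d r N) (W : MaterialWeight) (k : Plane)
    {φ : Fin 2 → Plane → ℂ} (hφ : φ ∈ femSpace d r N) {x : Plane} (hx : x ∈ interface r)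
    (hxτ : x ∈ interior (elem d N τ)) :
    ‖avgFlux W k d r N τ φ x‖ ^ 2 ≤ W.fluxConst *
      (W.supNorm 0 * W.supNorm 1 / weightDenom W d r N τ) *
      (elemEnergy k d r N φ 0 τ + elemEnergy k d r N φ 1 τ) := by
  obtain ⟨c, hc, hxc⟩ : ∃ c, IsSite c ∧ x ∈ Metric.sphere c r := by
    rcases hx with h | h
    · exact ⟨siteA, .inl rfl, h⟩
    · exact ⟨siteB, .inr rfl, h⟩
  have hN := H.N_pos
  have hD := weightDenom_pos W (d := d) (r := r) hN τ
  have w0 := W.supNorm_pos 0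
  have w1 := W.supNorm_pos 1
  have hne := H.inter_ball_nonempty hxτ hxc
  have hm : 0 < max (W.supNorm 0) (W.supNorm 1) := lt_max_of_lt_left w0
  have key : ∀ i, ‖(kappa W d r N τ i : ℂ) * flux W k r φ i x‖ ^ 2 ≤
      max (W.supNorm 0) (W.supNorm 1) * (W.supNorm 0 * W.supNorm 1 / weightDenom W d r N τ) *
        (invConst * elemEnergy k d r N φ i τ) := by
    intro i
    obtain ⟨G, hG⟩ := exists_isBlochGrad k ((hφ i).2.1 τ
      (H.mem_subdomainElems hx (interior_subset hxτ) i))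
    have h1 := normSq_flux_le W k H.radius.1 φ i hx
    rw [hG.sum_eq hxτ] at h1
    have h2 := H.inverse_energy hc hne hG (interior_subset hxτ) hxc
    rw [norm_mul, mul_pow, Complex.norm_real, Real.norm_of_nonneg (kappa_nonneg W d hN τ i)]
    calc kappa W d r N τ i ^ 2 * ‖flux W k r φ i x‖ ^ 2
        ≤ kappa W d r N τ i ^ 2 * (W.supNorm i ^ 2 * ‖G x‖ ^ 2) := by gcongr
      _ = (kappa W d r N τ i * W.supNorm i) ^ 2 * ‖G x‖ ^ 2 := by ring
      _ ≤ (max (W.supNorm 0) (W.supNorm 1) *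
          (W.supNorm 0 * W.supNorm 1 / weightDenom W d r N τ) * partArea d r N τ i) * ‖G x‖ ^ 2 := by
          gcongr; exact kappa_supNorm_sq_le W d hN τ i
      _ = max (W.supNorm 0) (W.supNorm 1) *
          (W.supNorm 0 * W.supNorm 1 / weightDenom W d r N τ) *
          (‖G x‖ ^ 2 * partArea d r N τ i) := by ring
      _ ≤ _ := by gcongr
  rw [avgFlux, Fin.sum_univ_two]
  refine (normSq_add_le _ _).trans ?_
  have h0 := key 0
  have h1 := key 1
  rw [MaterialWeight.fluxConst]
  linarith

theorem ae_mem_interior_cutArc (H : Admissible d r N) (τ : ElemIndex N) :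
    ∀ᵐ x ∂((arcLength r).restrict (cutArc d r N τ)),
      x ∈ interface r ∧ x ∈ interior (elem d N τ) := by
  have hnull : ∀ᵐ x ∂(arcLength r), x ∉ interface r ∩ frontier (elem d N τ) :=
    measure_eq_zero_iff_ae_notMem.1 (arcLength_finite H.radius.1 (H.finite_hits τ).1)
  filter_upwards [ae_restrict_mem (measurableSet_cutArc d r N τ),
    ae_restrict_of_ae hnull] with x hx hxf
  refine ⟨hx.1, ?_⟩
  by_contra hcon
  exact hxf ⟨hx.1, subset_closure hx.2, hcon⟩

theorem integrableOn_normSq_jump (H : Admissible d r N) {q : Fin 2 → Plane → ℂ}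
    (hq : q ∈ femSpace d r N) (hτ : τ ∈ cutElems d r N) :
    IntegrableOn (fun x => ‖jump q x‖ ^ 2) (cutArc d r N τ) (arcLength r) :=
  ((H.continuousOn_jump hq hτ).norm.pow 2).integrableOn_compact (isCompact_cutArc d r N τ)

/-- The flux term on one element. -/
theorem normSq_flux_integral_le (H : Admissible d r N) (W : MaterialWeight) (k : Plane)
    {φ q : Fin 2 → Plane → ℂ} (hφ : φ ∈ femSpace d r N) (hq : q ∈ femSpace d r N)
    (hτ : τ ∈ cutElems d r N) :
    ‖∫ x in cutArc d r N τ, avgFlux W k d r N τ φ x * conj (jump q x) ∂(arcLength r)‖ ^ 2 ≤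
      (W.fluxConst * ((meshSize N)⁻¹ * (lambdaK W d r N τ * jumpSq d r N q τ))) *
        (elemEnergy k d r N φ 0 τ + elemEnergy k d r N φ 1 τ) := by
  have hh := meshSize_pos H.N_pos
  have hD := weightDenom_pos W (d := d) (r := r) H.N_pos τ
  have hF := W.fluxConst_pos
  have w0 := W.supNorm_pos 0
  have w1 := W.supNorm_pos 1
  have hE : 0 ≤ elemEnergy k d r N φ 0 τ + elemEnergy k d r N φ 1 τ :=
    add_nonneg (elemEnergy_nonneg _ _ _ _ _ _ _) (elemEnergy_nonneg _ _ _ _ _ _ _)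
  have := normSq_integral_le (μ := (arcLength r).restrict (cutArc d r N τ))
    (f := fun x => avgFlux W k d r N τ φ x * conj (jump q x))
    (u := fun _ => W.fluxConst * (W.supNorm 0 * W.supNorm 1 / weightDenom W d r N τ) *
      (elemEnergy k d r N φ 0 τ + elemEnergy k d r N φ 1 τ))
    (v := fun x => ‖jump q x‖ ^ 2) (integrable_const _) (H.integrableOn_normSq_jump hq hτ)
    (Filter.Eventually.of_forall fun _ => by positivity)
    (Filter.Eventually.of_forall fun _ => sq_nonneg _) (by
      filter_upwards [H.ae_mem_interior_cutArc τ] with x hx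
      rw [norm_mul, mul_pow, RCLike.norm_conj]
      exact mul_le_mul_of_nonneg_right (H.normSq_avgFlux_le W k hφ hx.1 hx.2) (sq_nonneg _))
  -- Integrating the constant bound gives |Γ_K|, and ‖W₁‖‖W₂‖|Γ_K|/D_K equals λ_K/h: the
  -- stabilization weight fits the flux exactly.
  refine this.trans (le_of_eq ?_)
  rw [setIntegral_const, smul_eq_mul, lambdaK]
  change _ * jumpSq d r N q τ = _
  field_simp

/-- The stabilization term on one element. -/
theorem normSq_stab_integral_le (H : Admissible d r N) {φ q : Fin 2 → Plane → ℂ}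
    (hφ : φ ∈ femSpace d r N) (hq : q ∈ femSpace d r N) (hτ : τ ∈ cutElems d r N) :
    ‖∫ x in cutArc d r N τ, jump φ x * conj (jump q x) ∂(arcLength r)‖ ^ 2 ≤
      jumpSq d r N φ τ * jumpSq d r N q τ :=
  normSq_integral_le (H.integrableOn_normSq_jump hφ hτ) (H.integrableOn_normSq_jump hq hτ)
    (Filter.Eventually.of_forall fun _ => sq_nonneg _)
    (Filter.Eventually.of_forall fun _ => sq_nonneg _)
    (Filter.Eventually.of_forall fun x => by rw [norm_mul, mul_pow, RCLike.norm_conj])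

end Admissible

end UnfittedNitsche
end

noncomputable section
namespace UnfittedNitsche

/-! ### The volume terms -/

/-- The integrand of the volume terms. -/
def bulkDensity (W : MaterialWeight) (k : Plane) (r : ℝ) (φ q : Fin 2 → Plane → ℂ) (i : Fin 2)
    (x : Plane) : ℂ :=
  (W.side r i x *ᵥ blochGrad k (φ i) x) ⬝ᵥ star (blochGrad k (q i) x)

/-- The energy density. -/
def gradSq (k : Plane) (q : Fin 2 → Plane → ℂ) (i : Fin 2) (x : Plane) : ℝ :=
  ∑ j, ‖blochGrad k (q i) x j‖ ^ 2

theorem gradSq_nonneg (k : Plane) (q : Fin 2 → Plane → ℂ) (i : Fin 2) (x : Plane) :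
    0 ≤ gradSq k q i x := Finset.sum_nonneg fun _ _ => sq_nonneg _

theorem normSq_bulkDensity_le (W : MaterialWeight) (k : Plane) (r : ℝ) (φ q : Fin 2 → Plane → ℂ)
    (i : Fin 2) (x : Plane) :
    ‖bulkDensity W k r φ q i x‖ ^ 2 ≤ W.supNorm i ^ 2 * gradSq k φ i x * gradSq k q i x := by
  unfold bulkDensity gradSq
  refine (normSq_dotProduct_le _ _).trans ?_
  have h1 := sum_normSq_mulVec_le (W.side r i x) (blochGrad k (φ i) x)
  have h2 := W.matNorm_side_le r i x
  have h3 := matNorm_nonneg (W.side r i x)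
  have h4 : ∑ j, ‖star (blochGrad k (q i) x) j‖ ^ 2 = ∑ j, ‖blochGrad k (q i) x j‖ ^ 2 := by simp
  rw [h4]
  gcongr
  refine h1.trans ?_
  gcongr

theorem measurable_side (W : MaterialWeight) (r : ℝ) (i : Fin 2) (j l : Fin 2) :
    Measurable fun x => W.side r i x j l := by
  classical
  fin_cases i
  · simp only [MaterialWeight.side, Fin.zero_eta, Matrix.cons_val_zero]
    have : (fun x : Plane => (if x ∈ Metric.closedBall siteA r then W.WA else W.WB) j l) =
        fun x => if x ∈ Metric.closedBall siteA r then W.WA j l else W.WB j l := by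
      funext x; split_ifs <;> rfl
    rw [this]
    exact Measurable.ite Metric.isClosed_closedBall.measurableSet measurable_const measurable_const
  · exact measurable_const

theorem volume_frontier_elem (d : Diagonal) (N : ℕ) (τ : ElemIndex N) :
    volume (frontier (elem d N τ)) = 0 := (convex_elem d N τ).addHaar_frontier _

theorem aedisjoint_elem (d : Diagonal) {N : ℕ} (hN : 0 < N) {τ τ' : ElemIndex N} (h : τ ≠ τ') :
    AEDisjoint volume (elem d N τ) (elem d N τ') := by
  refine measure_mono_null (t := frontier (elem d N τ) ∪ frontier (elem d N τ')) ?_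
    (measure_union_null (volume_frontier_elem d N τ) (volume_frontier_elem d N τ'))
  rintro x ⟨h1, h2⟩
  by_contra hcon
  rw [Set.mem_union, not_or] at hcon
  have i1 : x ∈ interior (elem d N τ) := by
    by_contra h; exact hcon.1 ⟨subset_closure h1, h⟩
  have i2 : x ∈ interior (elem d N τ') := by
    by_contra h; exact hcon.2 ⟨subset_closure h2, h⟩
  exact Set.disjoint_left.1 (disjoint_interior_elem d hN h) i1 i2

theorem subdomain_subset_cell {r : ℝ} (hr : RadiusOK r) (i : Fin 2) : subdomain r i ⊆ cell := by
  fin_cases i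
  · exact Set.union_subset
      (Metric.ball_subset_closedBall.trans (closedBall_site_subset_cell hr (.inl rfl)))
      (Metric.ball_subset_closedBall.trans (closedBall_site_subset_cell hr (.inr rfl)))
  · exact Set.sdiff_subset

theorem iUnion_elem_inter (d : Diagonal) {r : ℝ} (hr : RadiusOK r) {N : ℕ} (hN : 0 < N)
    (i : Fin 2) : ⋃ τ, elem d N τ ∩ subdomain r i = subdomain r i := by
  rw [← Set.iUnion_inter]
  refine Set.inter_eq_right.2 fun x hx => ?_
  obtain ⟨τ, h⟩ := exists_elem_of_mem_cell d hN (subdomain_subset_cell hr i hx)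
  exact Set.mem_iUnion.2 ⟨τ, h⟩

namespace Admissible

variable {d : Diagonal} {r : ℝ} {N : ℕ}

theorem exists_isBlochGrad_of_inter (k : Plane) {q : Fin 2 → Plane → ℂ}
    (hq : q ∈ femSpace d r N) {i : Fin 2} {τ : ElemIndex N}
    (hne : (elem d N τ ∩ subdomain r i).Nonempty) :
    ∃ G, IsBlochGrad k (q i) (elem d N τ) G := by
  obtain ⟨x, h1, h2⟩ := hne
  refine exists_isBlochGrad k ((hq i).2.1 τ ?_)
  simp only [subdomainElems, Finset.mem_filter, Finset.mem_univ, true_and]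
  exact ⟨x, subset_closure h2, h1⟩

theorem integrableOn_gradSq (H : Admissible d r N) (k : Plane) {q : Fin 2 → Plane → ℂ}
    (hq : q ∈ femSpace d r N) (i : Fin 2) :
    IntegrableOn (gradSq k q i) (subdomain r i) := by
  rw [← iUnion_elem_inter d H.radius H.N_pos i, integrableOn_finite_iUnion]
  intro τ
  rcases (elem d N τ ∩ subdomain r i).eq_empty_or_nonempty with he | hne
  · rw [he]; exact integrableOn_empty
  obtain ⟨G, hG⟩ := exists_isBlochGrad_of_inter k hq hne
  have h1 : IntegrableOn (fun x => ‖G x‖ ^ 2) (elem d N τ ∩ subdomain r i) :=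
    ((hG.cont.norm.pow 2).continuousOn.integrableOn_compact (isCompact_elem d N τ)).mono_set
      Set.inter_subset_left
  refine Integrable.congr h1 ?_
  filter_upwards [ae_mem_interior_elem d N τ _ (measurableSet_subdomain r i)] with x hx
  exact (hG.sum_eq hx).symm

/-- Measurability is obtained element by element, where the Bloch gradients agree almost everywhere
with affine functions. -/
theorem integrableOn_bulkDensity (H : Admissible d r N) (W : MaterialWeight) (k : Plane)
    {φ q : Fin 2 → Plane → ℂ} (hφ : φ ∈ femSpace d r N) (hq : q ∈ femSpace d r N) (i : Fin 2) :
    IntegrableOn (bulkDensity W k r φ q i) (subdomain r i) := by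
  have hb : IntegrableOn (fun x => W.supNorm i * (gradSq k φ i x + gradSq k q i x))
      (subdomain r i) :=
    ((H.integrableOn_gradSq k hφ i).add (H.integrableOn_gradSq k hq i)).const_mul _
  rw [← iUnion_elem_inter d H.radius H.N_pos i, integrableOn_finite_iUnion]
  intro τ
  rcases (elem d N τ ∩ subdomain r i).eq_empty_or_nonempty with he | hne
  · rw [he]; exact integrableOn_empty
  obtain ⟨G, hG⟩ := exists_isBlochGrad_of_inter k hφ hne
  obtain ⟨G', hG'⟩ := exists_isBlochGrad_of_inter k hq hne
  refine Integrable.mono' (hb.mono_set Set.inter_subset_right) ?_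
    (Filter.Eventually.of_forall fun x => ?_)
  · have hm : Measurable fun x => ∑ j, (∑ l, W.side r i x j l * G x l) * conj (G' x j) := by
      refine Finset.measurable_sum _ fun j _ => Measurable.mul
        (Finset.measurable_sum _ fun l _ => (measurable_side W r i j l).mul ?_) ?_
      · exact ((EuclideanSpace.proj l : EuclideanSpace ℂ (Fin 2) →L[ℂ] ℂ).continuous.comp
          hG.cont).measurable
      · exact (Complex.continuous_conj.comp
          ((EuclideanSpace.proj j : EuclideanSpace ℂ (Fin 2) →L[ℂ] ℂ).continuous.comp
          hG'.cont)).measurable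
    refine hm.aestronglyMeasurable.congr ?_
    filter_upwards [ae_mem_interior_elem d N τ _ (measurableSet_subdomain r i)] with x hx
    simp only [bulkDensity, dotProduct, Matrix.mulVec, Pi.star_apply]
    refine Finset.sum_congr rfl fun j _ => ?_
    rw [hG'.eq x hx j, starRingEnd_apply]
    congr 1
    exact Finset.sum_congr rfl fun l _ => by rw [hG.eq x hx l]
  · have h1 := normSq_bulkDensity_le W k r φ q i x
    have h2 := gradSq_nonneg k φ i x
    have h3 := gradSq_nonneg k q i x
    have h4 := (W.supNorm_pos i).le
    refine le_of_sq_le_sq (h1.trans ?_) (by positivity)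
    rw [mul_pow, mul_assoc]
    gcongr
    nlinarith [sq_nonneg (gradSq k φ i x), sq_nonneg (gradSq k q i x), mul_nonneg h2 h3]

theorem sum_elemEnergy (H : Admissible d r N) (k : Plane) {q : Fin 2 → Plane → ℂ}
    (hq : q ∈ femSpace d r N) (i : Fin 2) :
    ∫ x in subdomain r i, gradSq k q i x = ∑ τ, elemEnergy k d r N q i τ := by
  have hI := H.integrableOn_gradSq k hq i
  rw [← iUnion_elem_inter d H.radius H.N_pos i] at hI
  conv_lhs => rw [← iUnion_elem_inter d H.radius H.N_pos i]
  rw [integral_iUnion_ae (fun τ => ((measurableSet_elem d N τ).inter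
    (measurableSet_subdomain r i)).nullMeasurableSet) ?_ hI, tsum_fintype]
  · rfl
  · intro τ τ' h
    exact (aedisjoint_elem d H.N_pos h).mono Set.inter_subset_left Set.inter_subset_left

end Admissible

/-! ### The terms of the form -/

/-- The square of the energy seminorm. -/
def bulkSq (k : Plane) (r : ℝ) (q : Fin 2 → Plane → ℂ) : ℝ :=
  ∑ i, ∫ x in subdomain r i, gradSq k q i x

theorem bulkSq_nonneg (k : Plane) (r : ℝ) (q : Fin 2 → Plane → ℂ) : 0 ≤ bulkSq k r q :=
  Finset.sum_nonneg fun i _ => integral_nonneg fun x => gradSq_nonneg k q i x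

/-- The sum of the squares of the jumps. -/
def jumpSum (d : Diagonal) (r : ℝ) (N : ℕ) (q : Fin 2 → Plane → ℂ) : ℝ :=
  ∑ τ ∈ cutElems d r N, (meshSize N)⁻¹ * jumpSq d r N q τ

/-- The sum of the squares of the jumps, weighted as in the stabilization term. -/
def stabSum (W : MaterialWeight) (d : Diagonal) (r : ℝ) (N : ℕ) (q : Fin 2 → Plane → ℂ) : ℝ :=
  ∑ τ ∈ cutElems d r N, (meshSize N)⁻¹ * (lambdaK W d r N τ * jumpSq d r N q τ)

theorem energyNormSq_eq (k : Plane) (d : Diagonal) (r : ℝ) (N : ℕ) (q : Fin 2 → Plane → ℂ) :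
    energyNormSq k d r N q = bulkSq k r q + jumpSum d r N q := rfl

/-- The volume part of the form. -/
def bulkForm (W : MaterialWeight) (k : Plane) (r : ℝ) (φ q : Fin 2 → Plane → ℂ) : ℂ :=
  ∑ i, ∫ x in subdomain r i, bulkDensity W k r φ q i x

/-- The consistency part of the form. -/
def fluxForm (W : MaterialWeight) (k : Plane) (d : Diagonal) (r : ℝ) (N : ℕ)
    (φ q : Fin 2 → Plane → ℂ) : ℂ :=
  ∑ τ ∈ cutElems d r N, ∫ x in cutArc d r N τ,
    avgFlux W k d r N τ φ x * conj (jump q x) ∂(arcLength r)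

/-- The stabilization part of the form. -/
def stabForm (W : MaterialWeight) (d : Diagonal) (r : ℝ) (N : ℕ) (φ q : Fin 2 → Plane → ℂ) : ℂ :=
  ∑ τ ∈ cutElems d r N, (((meshSize N)⁻¹ * lambdaK W d r N τ : ℝ) : ℂ) *
    ∫ x in cutArc d r N τ, jump φ x * conj (jump q x) ∂(arcLength r)

/-- The second flux term is the conjugate of the first with exchanged arguments, so one estimate
serves both and their sum is real on the diagonal. -/
theorem nitscheForm_eq (W : MaterialWeight) (k : Plane) (lam : ℝ) (d : Diagonal) (r : ℝ) (N : ℕ)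
    (φ q : Fin 2 → Plane → ℂ) :
    nitscheForm W k lam d r N φ q = bulkForm W k r φ q - fluxForm W k d r N φ q -
      conj (fluxForm W k d r N q φ) + (lam : ℂ) * stabForm W d r N φ q := by
  have h1 : ∑ τ ∈ cutElems d r N, ∫ x in cutArc d r N τ,
      conj (avgFlux W k d r N τ q x) * jump φ x ∂(arcLength r) =
      conj (fluxForm W k d r N q φ) := by
    rw [fluxForm, map_sum]
    refine Finset.sum_congr rfl fun τ _ => ?_
    rw [← integral_conj]
    refine integral_congr_ae (Filter.Eventually.of_forall fun x => ?_)
    simp only [map_mul, Complex.conj_conj]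
  have h2 : ((meshSize N)⁻¹ : ℂ) * ∑ τ ∈ cutElems d r N, ∫ x in cutArc d r N τ,
      ((lam * lambdaK W d r N τ : ℝ) : ℂ) * jump φ x * conj (jump q x) ∂(arcLength r) =
      (lam : ℂ) * stabForm W d r N φ q := by
    rw [stabForm, Finset.mul_sum, Finset.mul_sum]
    refine Finset.sum_congr rfl fun τ _ => ?_
    simp only [mul_assoc]
    rw [integral_const_mul]
    push_cast
    ring
  rw [← h1, ← h2]
  rfl

theorem bulkForm_self_im (W : MaterialWeight) (k : Plane) (r : ℝ) (q : Fin 2 → Plane → ℂ) :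
    (bulkForm W k r q q).im = 0 := by
  rw [bulkForm, Complex.im_sum]
  refine Finset.sum_eq_zero fun i _ => ?_
  have : ∀ x, bulkDensity W k r q q i x = ((bulkDensity W k r q q i x).re : ℂ) := by
    intro x
    apply Complex.ext
    · simp
    · rw [Complex.ofReal_im]
      exact im_mulVec_dotProduct_star (W.posDef_side r i x).isHermitian _
  rw [integral_congr_ae (Filter.Eventually.of_forall this), integral_complex_ofReal,
    Complex.ofReal_im]

theorem stabForm_self (W : MaterialWeight) (d : Diagonal) (r : ℝ) (N : ℕ)
    (q : Fin 2 → Plane → ℂ) : stabForm W d r N q q = (stabSum W d r N q : ℂ) := by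
  rw [stabForm, stabSum, Complex.ofReal_sum]
  refine Finset.sum_congr rfl fun τ _ => ?_
  have : ∀ x, jump q x * conj (jump q x) = ((‖jump q x‖ ^ 2 : ℝ) : ℂ) := by
    intro x
    rw [Complex.mul_conj, Complex.normSq_eq_norm_sq]
  simp_rw [this]
  rw [integral_complex_ofReal, jumpSq]
  push_cast
  ring

theorem nitscheForm_self_im (W : MaterialWeight) (k : Plane) (lam : ℝ) (d : Diagonal) (r : ℝ)
    (N : ℕ) (q : Fin 2 → Plane → ℂ) : (nitscheForm W k lam d r N q q).im = 0 := by
  rw [nitscheForm_eq, stabForm_self]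
  simp [bulkForm_self_im]

namespace Admissible

variable {d : Diagonal} {r : ℝ} {N : ℕ}

theorem jumpSum_nonneg (H : Admissible d r N) (q : Fin 2 → Plane → ℂ) :
    0 ≤ jumpSum d r N q :=
  Finset.sum_nonneg fun τ _ =>
    mul_nonneg (inv_nonneg.2 (meshSize_pos H.N_pos).le) (jumpSq_nonneg d r N q τ)

theorem stabSum_nonneg (H : Admissible d r N) (W : MaterialWeight) (q : Fin 2 → Plane → ℂ) :
    0 ≤ stabSum W d r N q :=
  Finset.sum_nonneg fun τ _ => stab_nonneg W d r H.N_pos q τ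

theorem bulkSq_eq (H : Admissible d r N) (k : Plane) {q : Fin 2 → Plane → ℂ}
    (hq : q ∈ femSpace d r N) :
    bulkSq k r q = ∑ τ, (elemEnergy k d r N q 0 τ + elemEnergy k d r N q 1 τ) := by
  rw [bulkSq, Fin.sum_univ_two, H.sum_elemEnergy k hq, H.sum_elemEnergy k hq,
    Finset.sum_add_distrib]

theorem sum_localEnergy (H : Admissible d r N) (W : MaterialWeight) (k : Plane)
    {q : Fin 2 → Plane → ℂ} (hq : q ∈ femSpace d r N) :
    ∑ τ, localEnergy W k d r N q τ = bulkSq k r q + stabSum W d r N q := by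
  have h : stabSum W d r N q =
      ∑ τ, (meshSize N)⁻¹ * (lambdaK W d r N τ * jumpSq d r N q τ) := by
    refine Finset.sum_subset (Finset.subset_univ _) fun τ _ hτ => ?_
    rw [jumpSq_eq_zero q hτ, mul_zero, mul_zero]
  rw [h, H.bulkSq_eq k hq, ← Finset.sum_add_distrib]
  rfl

theorem le_re_bulkForm (H : Admissible d r N) (W : MaterialWeight) (k : Plane) {m : ℝ}
    (hm : ∀ (r : ℝ) (i : Fin 2) (x : Plane) (v : Fin 2 → ℂ),
      m * ∑ j, ‖v j‖ ^ 2 ≤ ((W.side r i x *ᵥ v) ⬝ᵥ star v).re)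
    {q : Fin 2 → Plane → ℂ} (hq : q ∈ femSpace d r N) :
    m * bulkSq k r q ≤ (bulkForm W k r q q).re := by
  rw [bulkForm, Complex.re_sum, bulkSq, Finset.mul_sum]
  refine Finset.sum_le_sum fun i _ => ?_
  have hI := H.integrableOn_bulkDensity W k hq hq i
  have h1 : ∫ x in subdomain r i, (bulkDensity W k r q q i x).re =
      (∫ x in subdomain r i, bulkDensity W k r q q i x).re := integral_re hI
  rw [← h1, ← integral_const_mul]
  exact integral_mono ((H.integrableOn_gradSq k hq i).const_mul m) hI.re fun x => hm r i x _

theorem normSq_bulkForm_le (H : Admissible d r N) (W : MaterialWeight) (k : Plane)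
    {φ q : Fin 2 → Plane → ℂ} (hφ : φ ∈ femSpace d r N) (hq : q ∈ femSpace d r N) :
    ‖bulkForm W k r φ q‖ ^ 2 ≤
      max (W.supNorm 0) (W.supNorm 1) ^ 2 * bulkSq k r φ * bulkSq k r q := by
  rw [bulkForm, bulkSq, Finset.mul_sum]
  refine normSq_sum_le _ (fun i => mul_nonneg (sq_nonneg _)
    (integral_nonneg fun x => gradSq_nonneg k φ i x))
    (fun i => integral_nonneg fun x => gradSq_nonneg k q i x) fun i _ => ?_
  rw [← integral_const_mul (max (W.supNorm 0) (W.supNorm 1) ^ 2)]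
  refine normSq_integral_le ((H.integrableOn_gradSq k hφ i).const_mul _)
    (H.integrableOn_gradSq k hq i)
    (Filter.Eventually.of_forall fun x => mul_nonneg (sq_nonneg _) (gradSq_nonneg k φ i x))
    (Filter.Eventually.of_forall fun x => gradSq_nonneg k q i x)
    (Filter.Eventually.of_forall fun x => (normSq_bulkDensity_le W k r φ q i x).trans ?_)
  have h1 := gradSq_nonneg k φ i x
  have h2 := gradSq_nonneg k q i x
  have h3 := (W.supNorm_pos i).le
  have h4 : W.supNorm i ≤ max (W.supNorm 0) (W.supNorm 1) := by
    fin_cases i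
    · exact le_max_left _ _
    · exact le_max_right _ _
  gcongr

/-- The bound is asymmetric: the function in the flux enters through its bulk energy, the one in the
jump through the stabilization sum only. So the Young argument for coercivity can take place before
any jump estimate. -/
theorem normSq_fluxForm_le (H : Admissible d r N) (W : MaterialWeight) (k : Plane)
    {φ q : Fin 2 → Plane → ℂ} (hφ : φ ∈ femSpace d r N) (hq : q ∈ femSpace d r N) :
    ‖fluxForm W k d r N φ q‖ ^ 2 ≤ W.fluxConst * stabSum W d r N q * bulkSq k r φ := by
  have hE : ∀ τ, 0 ≤ elemEnergy k d r N φ 0 τ + elemEnergy k d r N φ 1 τ := fun τ =>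
    add_nonneg (elemEnergy_nonneg _ _ _ _ _ _ _) (elemEnergy_nonneg _ _ _ _ _ _ _)
  have hF := W.fluxConst_pos
  have h1 : ‖fluxForm W k d r N φ q‖ ^ 2 ≤ (∑ τ ∈ cutElems d r N, W.fluxConst *
      ((meshSize N)⁻¹ * (lambdaK W d r N τ * jumpSq d r N q τ))) *
      ∑ τ ∈ cutElems d r N, (elemEnergy k d r N φ 0 τ + elemEnergy k d r N φ 1 τ) :=
    normSq_sum_le _ (fun τ => mul_nonneg hF.le (stab_nonneg W d r H.N_pos q τ)) hE
      fun τ hτ => H.normSq_flux_integral_le W k hφ hq hτ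
  rw [← Finset.mul_sum] at h1
  refine h1.trans ?_
  rw [H.bulkSq_eq k hφ]
  have h2 := H.stabSum_nonneg W q
  refine mul_le_mul_of_nonneg_left ?_ (mul_nonneg hF.le h2)
  exact Finset.sum_le_sum_of_subset_of_nonneg (Finset.subset_univ _) fun τ _ _ => hE τ

theorem normSq_stabForm_le (H : Admissible d r N) (W : MaterialWeight)
    {φ q : Fin 2 → Plane → ℂ} (hφ : φ ∈ femSpace d r N) (hq : q ∈ femSpace d r N) :
    ‖stabForm W d r N φ q‖ ^ 2 ≤ stabSum W d r N φ * stabSum W d r N q := by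
  refine normSq_sum_le _ (fun τ => stab_nonneg W d r H.N_pos φ τ)
    (fun τ => stab_nonneg W d r H.N_pos q τ) fun τ hτ => ?_
  have h0 : 0 ≤ (meshSize N)⁻¹ * lambdaK W d r N τ :=
    mul_nonneg (inv_nonneg.2 (meshSize_pos H.N_pos).le) (lambdaK_nonneg W H.N_pos τ)
  rw [norm_mul, mul_pow, Complex.norm_real, Real.norm_of_nonneg h0]
  calc _ ≤ ((meshSize N)⁻¹ * lambdaK W d r N τ) ^ 2 *
        (jumpSq d r N φ τ * jumpSq d r N q τ) := by
        gcongr; exact H.normSq_stab_integral_le hφ hq hτ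
    _ = _ := by ring

theorem stabSum_le (H : Admissible d r N) (W : MaterialWeight) (q : Fin 2 → Plane → ℂ) :
    stabSum W d r N q ≤ W.supNorm 0 * W.supNorm 1 * 1536 / min (W.supNorm 0) (W.supNorm 1) *
      jumpSum d r N q := by
  rw [stabSum, jumpSum, Finset.mul_sum]
  refine Finset.sum_le_sum fun τ _ => ?_
  have h1 := lambdaK_le W (d := d) H.radius.1 H.N_pos τ
  have h2 := jumpSq_nonneg d r N q τ
  have h3 := meshSize_pos H.N_pos
  calc (meshSize N)⁻¹ * (lambdaK W d r N τ * jumpSq d r N q τ)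
      ≤ (meshSize N)⁻¹ * (W.supNorm 0 * W.supNorm 1 * 1536 / min (W.supNorm 0) (W.supNorm 1) *
        jumpSq d r N q τ) := by gcongr
    _ = _ := by ring

end Admissible

/-- The jumps are controlled by the energy and the stabilization. -/
theorem exists_jumpSum_le (W : MaterialWeight) (k : Plane) {σ : ℝ} (hσ : 0 < σ) :
    ∃ C : ℝ, 0 < C ∧ ∀ {d : Diagonal} {r : ℝ} {N : ℕ}, Admissible d r N → meshSize N ≤ σ * r →
      ∀ {q : Fin 2 → Plane → ℂ}, q ∈ femSpace d r N →
      jumpSum d r N q ≤ C * (bulkSq k r q + stabSum W d r N q) := by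
  obtain ⟨C, hC, h⟩ := exists_jumpSq_le W k hσ
  refine ⟨C * 24, by positivity, fun {d r N} H hσr {q} hq => ?_⟩
  calc jumpSum d r N q ≤ ∑ τ ∈ cutElems d r N, C * ∑ τ' ∈ vertexNbrs d N τ,
        localEnergy W k d r N q τ' := Finset.sum_le_sum fun τ hτ => h H hσr hq τ hτ
    _ = C * ∑ τ ∈ cutElems d r N, ∑ τ' ∈ vertexNbrs d N τ, localEnergy W k d r N q τ' := by
        rw [Finset.mul_sum]
    _ ≤ C * (24 * ∑ τ, localEnergy W k d r N q τ) := by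
        gcongr
        exact sum_vertexNbrs_le d H.N_pos _ fun τ => localEnergy_nonneg W k d r H.N_pos q τ
    _ = _ := by rw [H.sum_localEnergy W k hq]; ring

theorem energyNorm_sq {d : Diagonal} {r : ℝ} {N : ℕ} (H : Admissible d r N) (k : Plane)
    (q : Fin 2 → Plane → ℂ) :
    energyNorm k d r N q ^ 2 = bulkSq k r q + jumpSum d r N q := by
  rw [energyNorm, Real.sq_sqrt, energyNormSq_eq]
  rw [energyNormSq_eq]
  exact add_nonneg (bulkSq_nonneg k r q) (H.jumpSum_nonneg q)

end UnfittedNitsche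
end

/-! ### Coercivity and boundedness of the form -/

open UnfittedNitsche in
theorem mainTheorem4 (d : Diagonal) (W : MaterialWeight) (k : Plane) (σ : ℝ) (hσ : 0 < σ) :
    ∃ lam₀ : ℝ, 0 < lam₀ ∧ ∀ lam : ℝ, lam₀ ≤ lam →
      ∃ C₅ C₆ : ℝ, 0 < C₅ ∧ 0 < C₆ ∧
        ∀ r : ℝ, 0 < r → r < dist siteA siteB / 2 →
        ∀ N : ℕ, 0 < N → meshSize N ≤ σ * r → InterfaceAssumption d r N →
          (∀ q ∈ femSpace d r N,
            (nitscheForm W k lam d r N q q).im = 0 ∧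
            C₅ * energyNorm k d r N q ^ 2 ≤ (nitscheForm W k lam d r N q q).re) ∧
          (∀ q ∈ femSpace d r N, ∀ χ ∈ femSpace d r N,
            ‖nitscheForm W k lam d r N q χ‖ ≤
              C₆ * energyNorm k d r N q * energyNorm k d r N χ) := by
  obtain ⟨m, hm, hW⟩ := W.exists_lower_bound
  obtain ⟨C, hC, hjump⟩ := exists_jumpSum_le W k hσ
  have hF := W.fluxConst_pos
  have hw0 := W.supNorm_pos 0
  have hw1 := W.supNorm_pos 1
  have hmin : 0 < min (W.supNorm 0) (W.supNorm 1) := lt_min hw0 hw1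
  have hmax : 0 < max (W.supNorm 0) (W.supNorm 1) := lt_max_of_lt_left hw0
  set F := W.fluxConst
  set M := max (W.supNorm 0) (W.supNorm 1)
  set Λ := W.supNorm 0 * W.supNorm 1 * 1536 / min (W.supNorm 0) (W.supNorm 1) with hΛ
  have hΛpos : 0 < Λ := by positivity
  -- With this value F S X = (m/2 · X)(lam₀/2 · S), so the flux terms absorb at most half of the
  -- bulk term and half of the stabilization with parameter lam₀.
  set lam₀ := 4 * F / m with hlam₀
  have hlam₀pos : 0 < lam₀ := by positivity
  refine ⟨lam₀, hlam₀pos, fun lam hlam => ?_⟩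
  have hlampos : 0 < lam := hlam₀pos.trans_le hlam
  -- The divisor comes from X + J ≤ (1 + C)(X + S).
  refine ⟨min (m / 2) (lam₀ / 2) / (1 + C), M + 2 * √(F * Λ) + lam * Λ, by positivity,
    by positivity, ?_⟩
  intro r hr hr2 N hN hσr hass
  have H : Admissible d r N := ⟨⟨hr, hr2⟩, hN, hass⟩
  refine ⟨fun q hq => ⟨nitscheForm_self_im W k lam d r N q, ?_⟩, fun q hq χ hχ => ?_⟩
  · have hX := bulkSq_nonneg k r q
    have hS := H.stabSum_nonneg W q
    have hJ := hjump H hσr hq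
    have hB := H.le_re_bulkForm W k hW hq
    have hfl := H.normSq_fluxForm_le W k hq hq
    rw [energyNorm_sq H, nitscheForm_eq, stabForm_self]
    set X := bulkSq k r q
    set S := stabSum W d r N q
    set J := jumpSum d r N q
    set z := fluxForm W k d r N q q
    have hz : 2 * z.re ≤ m / 2 * X + lam₀ / 2 * S := by
      have h1 : z.re ≤ ‖z‖ := Complex.re_le_norm z
      have h2 : ‖z‖ ≤ (m / 2 * X + lam₀ / 2 * S) / 2 := by
        refine le_of_sq_le_sq (hfl.trans ?_) (by positivity)
        have e : F * S * X = (m / 2 * X) * (lam₀ / 2 * S) := by rw [hlam₀]; field_simp; ring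
        rw [e]
        nlinarith [sq_nonneg (m / 2 * X - lam₀ / 2 * S)]
      linarith
    have hre : (bulkForm W k r q q - z - (starRingEnd ℂ) z + (lam : ℂ) * (S : ℂ)).re =
        (bulkForm W k r q q).re - 2 * z.re + lam * S := by
      simp
      ring
    rw [hre]
    have hlS : lam₀ * S ≤ lam * S := by gcongr
    have h3 : min (m / 2) (lam₀ / 2) * (X + S) ≤ m / 2 * X + lam₀ / 2 * S := by
      rw [mul_add]
      gcongr
      · exact min_le_left _ _
      · exact min_le_right _ _
    have hmm : 0 < min (m / 2) (lam₀ / 2) := by positivity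
    have h4 : min (m / 2) (lam₀ / 2) / (1 + C) * (X + J) ≤ min (m / 2) (lam₀ / 2) * (X + S) := by
      rw [div_mul_eq_mul_div, div_le_iff₀ (by positivity), mul_assoc]
      gcongr
      linarith
    linarith
  · have hXq := bulkSq_nonneg k r q
    have hXχ := bulkSq_nonneg k r χ
    have hJq := H.jumpSum_nonneg q
    have hJχ := H.jumpSum_nonneg χ
    have hSq := H.stabSum_le W q
    have hSχ := H.stabSum_le W χ
    have hSq0 := H.stabSum_nonneg W q
    have hSχ0 := H.stabSum_nonneg W χ
    have eq := energyNorm_sq H k q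
    have eχ := energyNorm_sq H k χ
    have hEq : 0 ≤ energyNorm k d r N q := Real.sqrt_nonneg _
    have hEχ : 0 ≤ energyNorm k d r N χ := Real.sqrt_nonneg _
    set Eq := energyNorm k d r N q
    set Eχ := energyNorm k d r N χ
    have hXq' : bulkSq k r q ≤ Eq ^ 2 := by linarith
    have hXχ' : bulkSq k r χ ≤ Eχ ^ 2 := by linarith
    have hSq' : stabSum W d r N q ≤ Λ * Eq ^ 2 := hSq.trans (by rw [eq]; gcongr; linarith)
    have hSχ' : stabSum W d r N χ ≤ Λ * Eχ ^ 2 := hSχ.trans (by rw [eχ]; gcongr; linarith)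
    have b1 : ‖bulkForm W k r q χ‖ ≤ M * Eq * Eχ := by
      refine le_of_sq_le_sq ((H.normSq_bulkForm_le W k hq hχ).trans ?_) (by positivity)
      calc M ^ 2 * bulkSq k r q * bulkSq k r χ ≤ M ^ 2 * Eq ^ 2 * Eχ ^ 2 := by gcongr
        _ = _ := by ring
    have b2 : ‖fluxForm W k d r N q χ‖ ≤ √(F * Λ) * Eq * Eχ := by
      refine le_of_sq_le_sq ((H.normSq_fluxForm_le W k hq hχ).trans ?_) (by positivity)
      rw [mul_pow, mul_pow, Real.sq_sqrt (by positivity)]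
      calc F * stabSum W d r N χ * bulkSq k r q ≤ F * (Λ * Eχ ^ 2) * Eq ^ 2 := by gcongr
        _ = _ := by ring
    have b3 : ‖fluxForm W k d r N χ q‖ ≤ √(F * Λ) * Eq * Eχ := by
      refine le_of_sq_le_sq ((H.normSq_fluxForm_le W k hχ hq).trans ?_) (by positivity)
      rw [mul_pow, mul_pow, Real.sq_sqrt (by positivity)]
      calc F * stabSum W d r N q * bulkSq k r χ ≤ F * (Λ * Eq ^ 2) * Eχ ^ 2 := by gcongr
        _ = _ := by ring
    have b4 : ‖stabForm W d r N q χ‖ ≤ Λ * Eq * Eχ := by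
      refine le_of_sq_le_sq ((H.normSq_stabForm_le W hq hχ).trans ?_) (by positivity)
      calc stabSum W d r N q * stabSum W d r N χ ≤ (Λ * Eq ^ 2) * (Λ * Eχ ^ 2) := by gcongr
        _ = _ := by ring
    rw [nitscheForm_eq]
    calc ‖bulkForm W k r q χ - fluxForm W k d r N q χ - (starRingEnd ℂ) (fluxForm W k d r N χ q) +
          (lam : ℂ) * stabForm W d r N q χ‖
        ≤ ‖bulkForm W k r q χ‖ + ‖fluxForm W k d r N q χ‖ + ‖fluxForm W k d r N χ q‖ +
          lam * ‖stabForm W d r N q χ‖ := by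
          refine (norm_add_le _ _).trans (add_le_add ((norm_sub_le _ _).trans
            (add_le_add (norm_sub_le _ _) (RCLike.norm_conj _).le)) (le_of_eq ?_))
          rw [norm_mul, Complex.norm_real, Real.norm_of_nonneg hlampos.le]
      _ ≤ M * Eq * Eχ + √(F * Λ) * Eq * Eχ + √(F * Λ) * Eq * Eχ + lam * (Λ * Eq * Eχ) := by
          gcongr
      _ = _ := by ring
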